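/- Consider the main problem of artificial satellite theory in Delaunay variables $(\ell,g,h,L,G,H)$: $\mu,R_\oplus>0$, $a=L^2/\mu$, $\eta=G/L=\sqrt{1-e^2}$, $p=a\eta^2$, $\cos I=H/G$, $s=\sin I$, $n=\mu^2/L^3$; the eccentric anomaly $u$ solves $u-e\sin u=\ell$, $r=a(1-e\cos u)$, $f$ is the true anomaly (in the branch continuous in $\ell$ that vanishes at $\ell=0$), and $\phi=f-\ell$. Let $D$ be the set of all $(\ell,g,h,L,G,H)\in\mathbb{R}^6$ with $0<G<L$, $|H|<G$ and $5s^2\ne4$. The Hamiltonian is $$\mathcal{H}(\epsilon)=\mathcal{H}_{0,0}+\epsilon\,\mathcal{H}_{1,0},\qquad \mathcal{H}_{0,0}=-\frac{\mu}{2a},\qquad \mathcal{H}_{1,0}=-\frac{\mu}{r}\frac{R_\oplus^2}{r^2}\frac12\Big[1-\tfrac32s^2+\tfrac32s^2\cos(2f+2g)\Big],\qquad \epsilon=J_2 ,$$ and $\mathcal{H}_{m,0}=0$ for $m\ge2$. Let $\{F;K\}=\sum_{(x,X)}\big(\partial_{x}F\,\partial_{X}K-\partial_{X}F\,\partial_{x}K\big)$,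 summed over the conjugate pairs $(x,X)=(\ell,L),(g,G),(h,H)$, let $\langle F\rangle_\ell=\frac1{2\pi}\int_0^{2\pi}F\,d\ell$, and put $$\mathcal{W}_1=-G\frac{R_\oplus^2}{p^2}\frac12\Big[\big(1-\tfrac32s^2\big)(\phi+e\sin f)+\tfrac34s^2\Big(e\sin(f+2g)+\sin(2f+2g)+\tfrac e3\sin(3f+2g)\Big)\Big]+\mathcal{C}_1,$$ $$\mathcal{C}_1=G\frac{R_\oplus^2}{p^2}\,\frac{15s^2-14}{32(5s^2-4)}\,s^2e^2\sin2g ,$$ $$\mathcal{H}_{0,1}=\langle\mathcal{H}_{1,0}\rangle_\ell,\qquad \widetilde{\mathcal{H}}_{0,2}=\{\mathcal{H}_{1,0};\mathcal{W}_1\}+\{\mathcal{H}_{0,1};\mathcal{W}_1\},\qquad \mathcal{H}_{0,2}=\langle\widetilde{\mathcal{H}}_{0,2}\rangle_\ell .$$ Then the following hold. 1. $\mathcal{W}_1$ is $C^\infty$ on $D$ and $2\pi$-periodic in each angle. 2. On $D$, the terms $\mathcal{H}_{0,1}$ and $\mathcal{H}_{0,2}$ are functions of $L,G,H$ only, namely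 $$\mathcal{H}_{0,1}=\mathcal{H}_{0,0}\frac{R_\oplus^2}{p^2}\eta\Big(1-\tfrac32s^2\Big),$$ $$\mathcal{H}_{0,2}=\mathcal{H}_{0,0}\frac{R_\oplus^4}{p^4}\frac{3}{32}\eta\Big[5(7s^4-16s^2+8)+\eta(6s^2-4)^2+\eta^2(5s^4+8s^2-8)\Big].$$ 3. These are Brouwer's: $\mathcal{H}_{0,0}+J_2\mathcal{H}_{0,1}+\frac{J_2^2}{2}\mathcal{H}_{0,2}=-F^{**}$ for every real $J_2$, where, with $k_2=\frac12J_2R_\oplus^2$ and $\theta=H/G$, $$F^{**}=\frac{\mu^2}{2L^2}+\frac{\mu^4k_2}{L^3G^3}\Big(-\tfrac12+\tfrac32\theta^2\Big)+\frac{\mu^6k_2^2}{L^{10}}\Big[\tfrac{15}{32}\tfrac{L^5}{G^5}\big(1-\tfrac{18}5\theta^2+\theta^4\big)+\tfrac38\tfrac{L^6}{G^6}(1-6\theta^2+9\theta^4)-\tfrac{15}{32}\tfrac{L^7}{G^7}(1-2\theta^2-7\theta^4)\Big].$$ 4. There is a $C^\infty$ function $\mathcal{W}_2$ on $D$, $2\pi$-periodic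 in each angle, with $n\,\partial\mathcal{W}_2/\partial\ell=\widetilde{\mathcal{H}}_{0,2}-\mathcal{H}_{0,2}$. For every such $\mathcal{W}_2$: (a) the Lie-transform recursion $\mathcal{H}_{m,q+1}=\mathcal{H}_{m+1,q}+\sum_{k=0}^{m}\binom mk\{\mathcal{H}_{m-k,q};\mathcal{W}_{k+1}\}$ (with $\mathcal{W}_k=0$ for $k\ge3$) yields on $D$ exactly the terms $\mathcal{H}_{0,1}$ and $\mathcal{H}_{0,2}$ of item 2; (b) for every compact set $P$ of momenta $(L,G,H)$ with $0<G<L$, $|H|<G$, $5s^2\ne4$, there are an open set $V\supseteq P$ of such momenta, constants $\epsilon_0>0$ and $C$, and maps $\mathcal{T}_\epsilon$ from $U=\{(\ell,g,h,L,G,H):(L,G,H)\in V\}$ to $D$, $|\epsilon|<\epsilon_0$, with $\mathcal{T}_0=\mathrm{id}$, which are the Lie transform generated by $\mathcal{W}_1+\epsilon\mathcal{W}_2$, that is, $\xi(\epsilon)=\mathcal{T}_\epsilon(x)$ solves $d\xi/d\epsilon=\{\xi;\mathcal{W}_1+\epsilon\mathcal{W}_2\}$. Each $\mathcal{T}_\epsilon$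 is a canonical transformation (injective, $C^1$, satisfying the canonical Poisson bracket relations) that commutes with the translations of the angles by multiples of $2\pi$, and for all $x\in U$ and $|\epsilon|<\epsilon_0$ $$\Big|\mathcal{H}(\epsilon)\big(\mathcal{T}_\epsilon(x)\big)-\Big(\mathcal{H}_{0,0}+\epsilon\mathcal{H}_{0,1}+\tfrac{\epsilon^2}{2}\mathcal{H}_{0,2}\Big)(L,G,H)\Big|\le C|\epsilon|^3 ,$$ where $(L,G,H)$ are the momenta of $x$. -/

import Mathlib

open scoped ContDiff

noncomputable section

/-! ### Poisson brackets and Lie transforms on `ℝ³ × ℝ³` -/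

/-- Phase space with coordinates `q` and conjugate momenta `p`. -/
abbrev Phase : Type := (Fin 3 → ℝ) × (Fin 3 → ℝ)

/-- The partial derivative `∂F/∂qᵢ`. -/
def dCoord (i : Fin 3) (F : Phase → ℝ) (x : Phase) : ℝ :=
  fderiv ℝ F x (Pi.single i 1, 0)

/-- The partial derivative `∂F/∂pᵢ`. -/
def dMom (i : Fin 3) (F : Phase → ℝ) (x : Phase) : ℝ :=
  fderiv ℝ F x (0, Pi.single i 1)

/-- The Poisson bracket `{F; K} = ∑ᵢ (∂F/∂qᵢ ∂K/∂pᵢ - ∂F/∂pᵢ ∂K/∂qᵢ)`. -/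
def poisson (F K : Phase → ℝ) (x : Phase) : ℝ :=
  ∑ i : Fin 3, (dCoord i F x * dMom i K x - dMom i F x * dCoord i K x)

/-- The Hamiltonian vector field `(∂W/∂p, -∂W/∂q)`, that is `ξ ↦ {ξ; W}` on the coordinates. -/
def hamiltonianField (W : Phase → ℝ) (x : Phase) : Phase :=
  (fun i => dMom i W x, fun i => -dCoord i W x)

/-- The triangle of the Lie transform method. With `H n` standing for `H_{n,0}` and `W m` for
`W_m` (`m ≥ 1`), `lieTriangle H W q n` is `H_{n,q}`, where
`H_{n,q+1} = H_{n+1,q} + ∑_{m=0}^{n} (n choose m) {H_{n-m,q}; W_{m+1}}`. -/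
def lieTriangle (H W : ℕ → Phase → ℝ) : ℕ → ℕ → Phase → ℝ
  | 0 => H
  | q + 1 => fun n x => lieTriangle H W q (n + 1) x +
      ∑ m ∈ Finset.range (n + 1),
        (n.choose m : ℝ) * poisson (lieTriangle H W q (n - m)) (W (m + 1)) x

/-- `T` is a canonical transformation of the open set `U` onto its image: an injective `C¹` map
whose components satisfy the canonical Poisson bracket relations. -/
structure IsCanonicalOn (T : Phase → Phase) (U : Set Phase) : Prop where
  contDiffOn : ContDiffOn ℝ 1 T U
  injOn : Set.InjOn T U
  poisson_coord_coord : ∀ x ∈ U, ∀ i j : Fin 3,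
    poisson (fun y => (T y).1 i) (fun y => (T y).1 j) x = 0
  poisson_mom_mom : ∀ x ∈ U, ∀ i j : Fin 3,
    poisson (fun y => (T y).2 i) (fun y => (T y).2 j) x = 0
  poisson_coord_mom : ∀ x ∈ U, ∀ i j : Fin 3,
    poisson (fun y => (T y).1 i) (fun y => (T y).2 j) x = if i = j then 1 else 0

/-- `T ε`, `|ε| < ε₀`, is the Lie transform on `U` generated by the determining function
`W ε`: the solution in `D` of `dξ/dε = {ξ; W ε}` with the identity as the initial condition. -/
def IsLieTransform (W : ℝ → Phase → ℝ) (D U : Set Phase) (ε₀ : ℝ) (T : ℝ → Phase → Phase) :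
    Prop :=
  ∀ x ∈ U, T 0 x = x ∧ ∀ ε : ℝ, |ε| < ε₀ →
    T ε x ∈ D ∧ HasDerivAt (fun t => T t x) (hamiltonianField (W ε) (T ε x)) ε

/-- The translate of a point whose angles `qᵢ` are increased by `2π kᵢ`. -/
def shiftAngles (k : Fin 3 → ℤ) (x : Phase) : Phase :=
  (fun i => x.1 i + 2 * Real.pi * (k i : ℝ), x.2)

/-- `F` is `2π`-periodic in each of the angles on `D`. -/
def IsAnglePeriodicOn (F : Phase → ℝ) (D : Set Phase) : Prop :=
  ∀ x ∈ D, ∀ k : Fin 3 → ℤ, F (shiftAngles k x) = F x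

/-! ### Delaunay variables: `q = (ℓ, g, h)`, `p = (L, G, H)` -/

/-- Eccentricity function `η = G / L = (1 - e²)^{1/2}`. -/
def etaD (p : Fin 3 → ℝ) : ℝ := p 1 / p 0

/-- Eccentricity. -/
def eccD (p : Fin 3 → ℝ) : ℝ := √(1 - etaD p ^ 2)

/-- Sine of the inclination `I`, where `cos I = H / G`. -/
def sinIncD (p : Fin 3 → ℝ) : ℝ := √(1 - (p 2 / p 1) ^ 2)

/-- Semi-major axis `a`, where `L = √(μ a)`. -/
def smaD (μ : ℝ) (p : Fin 3 → ℝ) : ℝ := p 0 ^ 2 / μ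

/-- Orbit parameter `p = a η²`. -/
def paramD (μ : ℝ) (p : Fin 3 → ℝ) : ℝ := smaD μ p * etaD p ^ 2

/-- Mean motion `n = μ² / L³`. -/
def meanMotionD (μ : ℝ) (p : Fin 3 → ℝ) : ℝ := μ ^ 2 / p 0 ^ 3

/-- The momenta of the elliptic, non-circular, non-equatorial orbits whose inclination is not
the critical one. -/
def momentumDomain : Set (Fin 3 → ℝ) :=
  {p | 0 < p 1 ∧ p 1 < p 0 ∧ |p 2| < p 1 ∧ 5 * sinIncD p ^ 2 - 4 ≠ 0}

/-- All phase points, of arbitrary angles, whose momenta lie in `V`. -/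
def overMomenta (V : Set (Fin 3 → ℝ)) : Set Phase := {x | x.2 ∈ V}

/-- The solution `u` of the Kepler equation `u - e sin u = ℓ`. -/
def eccentricAnomaly (e ℓ : ℝ) : ℝ := Function.invFun (fun u : ℝ => u - e * Real.sin u) ℓ

theorem kepler_strictMono {e : ℝ} (h0 : 0 ≤ e) (h1 : e < 1) :
    StrictMono (fun u : ℝ => u - e * Real.sin u) := by
  apply strictMono_of_deriv_pos
  intro u
  have h : HasDerivAt (fun u : ℝ => u - e * Real.sin u) (1 - e * Real.cos u) u :=
    (hasDerivAt_id u).sub ((Real.hasDerivAt_sin u).const_mul e)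
  rw [h.deriv]
  nlinarith [Real.cos_le_one u]

/-- The eccentric anomaly solves the Kepler equation, and it is the only solution. -/
theorem eccentricAnomaly_iff {e : ℝ} (h0 : 0 ≤ e) (h1 : e < 1) (ℓ u : ℝ) :
    u = eccentricAnomaly e ℓ ↔ u - e * Real.sin u = ℓ := by
  have hs : ∃ v : ℝ, v - e * Real.sin v = ℓ := by
    have hc : Continuous (fun u : ℝ => u - e * Real.sin u) := by fun_prop
    have := intermediate_value_Icc (a := ℓ - 1) (b := ℓ + 1) (by linarith) hc.continuousOn
    obtain ⟨v, -, hv⟩ := this (show ℓ ∈ _ by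
      constructor
      · nlinarith [Real.neg_one_le_sin (ℓ - 1)]
      · nlinarith [Real.sin_le_one (ℓ + 1)])
    exact ⟨v, hv⟩
  have he : eccentricAnomaly e ℓ - e * Real.sin (eccentricAnomaly e ℓ) = ℓ :=
    Function.invFun_eq hs
  constructor
  · rintro rfl
    exact he
  · intro h
    exact (kepler_strictMono h0 h1).injective (h.trans he.symm)

/-- The true anomaly `f`, in the branch that is continuous in `ℓ` and vanishes with it. -/
def trueAnomaly (e ℓ : ℝ) : ℝ :=
  eccentricAnomaly e ℓ + 2 * Real.arctan (e * Real.sin (eccentricAnomaly e ℓ) /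
    (1 + √(1 - e ^ 2) - e * Real.cos (eccentricAnomaly e ℓ)))

/-- The usual relations between the true anomaly and the eccentric anomaly. -/
theorem cos_sin_trueAnomaly {e : ℝ} (h0 : 0 ≤ e) (h1 : e < 1) (ℓ : ℝ) :
    Real.cos (trueAnomaly e ℓ) =
      (Real.cos (eccentricAnomaly e ℓ) - e) / (1 - e * Real.cos (eccentricAnomaly e ℓ)) ∧
    Real.sin (trueAnomaly e ℓ) =
      √(1 - e ^ 2) * Real.sin (eccentricAnomaly e ℓ) /
        (1 - e * Real.cos (eccentricAnomaly e ℓ)) := by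
  unfold trueAnomaly
  set u := eccentricAnomaly e ℓ
  set η := √(1 - e ^ 2) with hη
  have hη0 : 0 < η := Real.sqrt_pos.mpr (by nlinarith)
  have hη2 : η ^ 2 = 1 - e ^ 2 := Real.sq_sqrt (by nlinarith)
  have hsc := Real.sin_sq_add_cos_sq u
  have hd : 0 < 1 - e * Real.cos u := by nlinarith [Real.cos_le_one u]
  have hd' : 0 < 1 + η - e * Real.cos u := by linarith
  set t := e * Real.sin u / (1 + η - e * Real.cos u) with ht
  have ht2 : 1 + t ^ 2 = 2 * (1 + η) * (1 - e * Real.cos u) / (1 + η - e * Real.cos u) ^ 2 := by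
    rw [ht]
    field_simp
    linear_combination e ^ 2 * hsc + hη2
  have hpos : 0 < 1 + t ^ 2 := by positivity
  have hc : Real.cos (2 * Real.arctan t) = (1 - t ^ 2) / (1 + t ^ 2) := by
    rw [Real.cos_two_mul, Real.cos_sq_arctan]
    field_simp
    ring
  have hs : Real.sin (2 * Real.arctan t) = 2 * t / (1 + t ^ 2) := by
    have h := Real.cos_sq_arctan t
    have h' : Real.sin (Real.arctan t) = t * Real.cos (Real.arctan t) := by
      rw [Real.sin_arctan, Real.cos_arctan]
      ring
    rw [Real.sin_two_mul, h', show 2 * (t * Real.cos (Real.arctan t)) * Real.cos (Real.arctan t)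
      = 2 * t * Real.cos (Real.arctan t) ^ 2 by ring, h]
    ring
  have hc' : Real.cos (2 * Real.arctan t) =
      ((1 + η - e * Real.cos u) ^ 2 - e ^ 2 * Real.sin u ^ 2) /
        (2 * (1 + η) * (1 - e * Real.cos u)) := by
    rw [hc, ht2, ht]
    field_simp
  have hs' : Real.sin (2 * Real.arctan t) =
      e * Real.sin u * (1 + η - e * Real.cos u) / ((1 + η) * (1 - e * Real.cos u)) := by
    rw [hs, ht2, ht]
    field_simp
  rw [Real.cos_add, Real.sin_add, hc', hs']
  constructor
  · field_simp
    congr 1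
    linear_combination (-(Real.cos u * e ^ 2 + 2 * e * (1 + η - Real.cos u * e))) * hsc +
      Real.cos u * hη2
  · field_simp
    linear_combination Real.sin u * (-hη2 - e ^ 2 * hsc)

/-- The true anomaly as a function of the Delaunay variables. -/
def trueAnomalyD (x : Phase) : ℝ := trueAnomaly (eccD x.2) (x.1 0)

/-- The radius `r = a (1 - e cos u)`. -/
def radiusD (μ : ℝ) (x : Phase) : ℝ :=
  smaD μ x.2 * (1 - eccD x.2 * Real.cos (eccentricAnomaly (eccD x.2) (x.1 0)))

/-! ### The main problem -/

/-- The Hamiltonian of the main problem in Delaunay variables, where `C_{2,0} = -J₂`. -/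
def mainHamiltonian (μ R J₂ : ℝ) (x : Phase) : ℝ :=
  -μ / (2 * smaD μ x.2) + μ / radiusD μ x * (R ^ 2 / radiusD μ x ^ 2) * (1 / 2) * (-J₂) *
    (1 - 3 / 2 * sinIncD x.2 ^ 2 +
      3 / 2 * sinIncD x.2 ^ 2 * Real.cos (2 * trueAnomalyD x + 2 * x.1 1))

/-- The terms `H_{m,0}` of `mainHamiltonian μ R ε = ∑ₘ (εᵐ/m!) H_{m,0}`. -/
def hamTerm (μ R : ℝ) : ℕ → Phase → ℝ
  | 0 => fun x => -μ / (2 * smaD μ x.2)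
  | 1 => fun x => -(μ / radiusD μ x * (R ^ 2 / radiusD μ x ^ 2) * (1 / 2) *
      (1 - 3 / 2 * sinIncD x.2 ^ 2 +
        3 / 2 * sinIncD x.2 ^ 2 * Real.cos (2 * trueAnomalyD x + 2 * x.1 1)))
  | _ => fun _ => 0

/-- The integration constant `C₁`. -/
def constC1 (μ R : ℝ) (x : Phase) : ℝ :=
  x.2 1 * (R ^ 2 / paramD μ x.2 ^ 2) *
    ((15 * sinIncD x.2 ^ 2 - 14) / (32 * (5 * sinIncD x.2 ^ 2 - 4))) *
    sinIncD x.2 ^ 2 * eccD x.2 ^ 2 * Real.sin (2 * x.1 1)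

/-- The first-order determining function `W₁`, including the integration constant `C₁`. -/
def genW1 (μ R : ℝ) (x : Phase) : ℝ :=
  -(x.2 1 * (R ^ 2 / paramD μ x.2 ^ 2) * (1 / 2) *
    ((1 - 3 / 2 * sinIncD x.2 ^ 2) *
        (trueAnomalyD x - x.1 0 + eccD x.2 * Real.sin (trueAnomalyD x)) +
      3 / 4 * sinIncD x.2 ^ 2 *
        (eccD x.2 * Real.sin (trueAnomalyD x + 2 * x.1 1) +
          Real.sin (2 * trueAnomalyD x + 2 * x.1 1) +
          eccD x.2 / 3 * Real.sin (3 * trueAnomalyD x + 2 * x.1 1)))) +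
    constC1 μ R x

/-- The average `⟨F⟩` over the mean anomaly. -/
def avgMean (F : Phase → ℝ) (x : Phase) : ℝ :=
  1 / (2 * Real.pi) * ∫ t in (0 : ℝ)..(2 * Real.pi), F (Function.update x.1 0 t, x.2)

/-- The first-order new Hamiltonian `H_{0,1} = ⟨H_{1,0}⟩`. -/
def newH01 (μ R : ℝ) : Phase → ℝ := avgMean (hamTerm μ R 1)

/-- The known terms `{H_{1,0}; W₁} + {H_{0,1}; W₁}` of the second order. -/
def knownTerms2 (μ R : ℝ) (x : Phase) : ℝ :=
  poisson (hamTerm μ R 1) (genW1 μ R) x + poisson (newH01 μ R) (genW1 μ R) x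

/-- The second-order new Hamiltonian `H_{0,2}`, the average of the known terms. -/
def newH02 (μ R : ℝ) : Phase → ℝ := avgMean (knownTerms2 μ R)

/-- `W` is a second-order determining function `W₂`: a smooth function, `2π`-periodic in the
angles, that solves the second-order homological equation. -/
structure IsSecondGenerator (μ R : ℝ) (W : Phase → ℝ) : Prop where
  contDiffOn : ContDiffOn ℝ ∞ W (overMomenta momentumDomain)
  periodic : IsAnglePeriodicOn W (overMomenta momentumDomain)
  homological : ∀ x ∈ overMomenta momentumDomain,
    meanMotionD μ x.2 * dCoord 0 W x = knownTerms2 μ R x - newH02 μ R x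

/-- The sequence of determining functions `W₁, W₂, 0, 0, …` (its index starts at `1`). -/
def genTerm (W₁ W₂ : Phase → ℝ) : ℕ → Phase → ℝ
  | 1 => W₁
  | 2 => W₂
  | _ => fun _ => 0

/-! ### The secular Hamiltonian -/

/-- `H_{0,0}` as a function of the momenta. -/
def secular0 (μ : ℝ) (p : Fin 3 → ℝ) : ℝ := -μ / (2 * smaD μ p)

/-- The first-order secular term. -/
def secular1 (μ R : ℝ) (p : Fin 3 → ℝ) : ℝ :=
  secular0 μ p * (R ^ 2 / paramD μ p ^ 2) * etaD p * (1 - 3 / 2 * sinIncD p ^ 2)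

/-- The second-order secular term. -/
def secular2 (μ R : ℝ) (p : Fin 3 → ℝ) : ℝ :=
  secular0 μ p * (R ^ 4 / paramD μ p ^ 4) * (3 / 32) * etaD p *
    (5 * (7 * sinIncD p ^ 4 - 16 * sinIncD p ^ 2 + 8) +
      etaD p * (6 * sinIncD p ^ 2 - 4) ^ 2 +
      etaD p ^ 2 * (5 * sinIncD p ^ 4 + 8 * sinIncD p ^ 2 - 8))

/-- Brouwer's second-order secular force function `F**(L, G, H)`, in his own form, for the main
problem: `k₂ = J₂ R² / 2`, and the Hamiltonian is `-F**`. -/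
def brouwerSecular (μ k₂ L G H : ℝ) : ℝ :=
  μ ^ 2 / (2 * L ^ 2) +
    μ ^ 4 * k₂ / (L ^ 3 * G ^ 3) * (-(1 / 2) + 3 / 2 * (H ^ 2 / G ^ 2)) +
    μ ^ 6 * k₂ ^ 2 / L ^ 10 *
      (15 / 32 * (L ^ 5 / G ^ 5) * (1 - 18 / 5 * (H ^ 2 / G ^ 2) + H ^ 4 / G ^ 4) +
        3 / 8 * (L ^ 6 / G ^ 6) * (1 - 6 * (H ^ 2 / G ^ 2) + 9 * (H ^ 4 / G ^ 4)) -
        15 / 32 * (L ^ 7 / G ^ 7) * (1 - 2 * (H ^ 2 / G ^ 2) - 7 * (H ^ 4 / G ^ 4)))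

end

/-! Write H for H_{1,0}, S for its average, W for W₁, n for the mean motion, and subscripts for
partial derivatives. The average of the second-order terms is not found by integrating brackets. The
known terms are exhibited as n ∂_ℓ of an explicit smooth function, periodic in the angles
(`secondGen`), plus `secular2`; the fundamental theorem of calculus then gives the average
(`avgMean_eq_of_homological`), and the same function is an admissible W₂.

First order: f_ℓ = (1 + e cos f)² (L/G)³, so H is a trigonometric polynomial in f times f_ℓ and has
an elementary primitive. This gives n W_ℓ = H - S (`dCoord_zero_genW1`), whatever C₁ is, because C₁
does not contain ℓ.

Second order (`dCoord_zero_secondGen`): h is cyclic and S depends on momenta only. Substituting W_ℓ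
= (H - S)/n and integrating by parts in ℓ yields H_ℓ W_L - (H_L + S_L) W_ℓ = n ∂_ℓ[(H + S) W_L / n]
- ∂_L[(H² - S²)/n], H_g W_G - (H_G + S_G) W_g = n ∂_ℓ[W_g W_G] - 2 H_G W_g. In the last product the
part of W_g coming from C₁ is again a total derivative, up to -2 S_G ∂_g C₁. So W_L and W_G never
have to be computed. Two products remain, H² and H_G times the g-derivative of the short-period part
of W. Both are trigonometric polynomials in f times f_ℓ, and tables of amplitudes (`squareTerms`,
`mixedTerms`) give their primitives. Their means over f enter with f - ℓ, which is periodic.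

What survives averaging is collected in `secular2_eq`. The cos 4g terms of the two means cancel each
other. The cos 2g terms leave a multiple of s² e² (14 - 15 s²), and since S_G is a multiple of 5 s²
- 4, the term -2 S_G ∂_g C₁ removes it: this is what determines C₁ and its critical divisor.

Transformation: after a cutoff in the momenta, the field of W₁ + ε W₂ is smooth with bounds uniform
in the angles, by periodicity. Its flow exists on a common time interval, is C¹ through the
variational equation, and preserves the symplectic form (`exists_lieTransform`). Differentiating the
transformed Hamiltonian in ε and inserting the two homological equations leaves a derivative of size
O(ε²), hence an error O(ε³) (`exists_lieTransform_remainder_bound`). -/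

/-! ### Flows of bounded time-dependent fields and their dependence on the initial point -/

section Flow

open Set Metric
open scoped NNReal

variable {E : Type*} [NormedAddCommGroup E] [NormedSpace ℝ E]

/-- A two-sided form of Grönwall's inequality for times of absolute value at most `1`. -/
theorem norm_le_of_norm_deriv_le_two_sided {u u' : ℝ → E} {δ K ε b : ℝ} (hK : 1 ≤ K)
    (hε : 0 ≤ ε) (hb : b ≤ 1) (hu : ∀ t, |t| < b → HasDerivAt u (u' t) t)
    (hbd : ∀ t, |t| < b → ‖u' t‖ ≤ K * ‖u t‖ + ε) (h0 : ‖u 0‖ ≤ δ) {t : ℝ} (ht : |t| < b) :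
    ‖u t‖ ≤ (δ + ε) * Real.exp K := by
  have key : ∀ (w w' : ℝ → E), (∀ s, |s| < b → HasDerivAt w (w' s) s) →
      (∀ s, |s| < b → ‖w' s‖ ≤ K * ‖w s‖ + ε) → ‖w 0‖ ≤ δ → ∀ s, 0 ≤ s → s < b →
      ‖w s‖ ≤ (δ + ε) * Real.exp K := by
    intro w w' hw hwb hw0 s hs0 hsb
    have hlt : ∀ r ∈ Icc (0 : ℝ) s, |r| < b := fun r hr => by
      rw [abs_of_nonneg hr.1]; exact hr.2.trans_lt hsb
    have h := norm_le_gronwallBound_of_norm_deriv_right_le (f := w) (f' := w') (a := 0) (b := s)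
      (fun r hr => (hw r (hlt r hr)).continuousAt.continuousWithinAt)
      (fun r hr => (hw r (hlt r ⟨hr.1, hr.2.le⟩)).hasDerivWithinAt) hw0
      (fun r hr => hwb r (hlt r ⟨hr.1, hr.2.le⟩)) s ⟨hs0, le_rfl⟩
    rw [gronwallBound_of_K_ne_0 (by linarith), sub_zero] at h
    have hδ : 0 ≤ δ := (norm_nonneg _).trans hw0
    -- Here s < b ≤ 1 removes the time from the exponent, and K ≥ 1 removes the quotient ε / K from
    -- the Grönwall bound.
    have he : Real.exp (K * s) ≤ Real.exp K := Real.exp_le_exp.mpr (by nlinarith)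
    have hεK : ε / K ≤ ε := div_le_self hε hK
    have h1 : 1 ≤ Real.exp (K * s) := Real.one_le_exp (by positivity)
    have h2 : 0 ≤ ε / K := by positivity
    calc ‖w s‖ ≤ δ * Real.exp (K * s) + ε / K * (Real.exp (K * s) - 1) := h
      _ ≤ δ * Real.exp K + ε * Real.exp K := by gcongr; linarith
      _ = _ := by ring
  rcases le_total 0 t with h | h
  · exact key u u' hu hbd h0 t h (by rwa [abs_of_nonneg h] at ht)
  -- Negative times are reduced to positive ones by reversing the curve.
  · have := key (fun s => u (-s)) (fun s => -u' (-s))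
      (fun s hs => by
        have h1 := (hu (-s) (by rwa [abs_neg])).scomp s (hasDerivAt_neg s)
        simpa [Function.comp_def] using h1)
      (fun s hs => by simpa using hbd (-s) (by rwa [abs_neg])) (by simpa using h0) (-t)
      (by linarith) (by rwa [abs_of_nonpos h] at ht)
    simpa using this

/-- A time-dependent vector field that is `C¹` in space, bounded with bounded and Lipschitz
derivative, at times of absolute value at most `1`. -/
structure IsBoundedField (v : ℝ → E → E) (v' : ℝ → E → E →L[ℝ] E) (M K N : ℝ≥0) : Prop where
  one_le : 1 ≤ K
  continuous : ∀ x, Continuous fun t => v t x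
  continuous_deriv : Continuous fun p : ℝ × E => v' p.1 p.2
  hasFDerivAt : ∀ t x, HasFDerivAt (v t) (v' t x) x
  norm_le : ∀ t, |t| ≤ 1 → ∀ x, ‖v t x‖ ≤ M
  norm_deriv_le : ∀ t, |t| ≤ 1 → ∀ x, ‖v' t x‖ ≤ K
  lipschitz_deriv : ∀ t, |t| ≤ 1 → ∀ x y, ‖v' t x - v' t y‖ ≤ N * ‖x - y‖

namespace IsBoundedField

variable {v : ℝ → E → E} {v' : ℝ → E → E →L[ℝ] E} {M K N : ℝ≥0}

theorem lipschitzWith (hv : IsBoundedField v v' M K N) {t : ℝ} (ht : |t| ≤ 1) :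
    LipschitzWith K (v t) := by
  have := (convex_univ (𝕜 := ℝ) (E := E)).lipschitzOnWith_of_nnnorm_hasFDerivWithin_le
    (f := v t) (f' := v' t) (C := K) (fun x _ => (hv.hasFDerivAt t x).hasFDerivWithinAt)
    (fun x _ => hv.norm_deriv_le t ht x)
  exact lipschitzOnWith_univ.mp this

/-- Mean value inequality on the segment from a to b, where the derivative differs from its value at
a by at most N ‖b - a‖. This controls the quadratic error in `hasFDerivAt_flow`. -/
theorem taylor_le (hv : IsBoundedField v v' M K N) {t : ℝ} (ht : |t| ≤ 1) (a b : E) :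
    ‖v t b - v t a - v' t a (b - a)‖ ≤ N * ‖b - a‖ ^ 2 := by
  have := (convex_segment a b).norm_image_sub_le_of_norm_hasFDerivWithin_le'
    (f := v t) (f' := v' t) (φ := v' t a) (C := N * ‖b - a‖)
    (fun x _ => (hv.hasFDerivAt t x).hasFDerivWithinAt)
    (fun x hx => (hv.lipschitz_deriv t ht x a).trans (by
      have := norm_sub_le_of_mem_segment hx
      gcongr)) (left_mem_segment ℝ a b) (right_mem_segment ℝ a b)
  calc _ ≤ N * ‖b - a‖ * ‖b - a‖ := this
    _ = _ := by ring

/-- A bounded field has a flow, and its variational equation a solution, on a time interval that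
does not depend on the initial point. -/
theorem exists_flow [CompleteSpace E] (hv : IsBoundedField v v' M K N) :
    ∃ δ : ℝ, 0 < δ ∧ δ ≤ 1 ∧ ∃ (T : ℝ → E → E) (A : ℝ → E → E →L[ℝ] E),
      (∀ x, T 0 x = x) ∧ (∀ x, A 0 x = ContinuousLinearMap.id ℝ E) ∧
      (∀ t, |t| < δ → ∀ x, HasDerivAt (fun s => T s x) (v t (T t x)) t) ∧
      (∀ t, |t| < δ → ∀ x, HasDerivAt (fun s => A s x) (v' t (T t x) ∘L A t x) t) := by
  have hT : ∀ x : E, ∃ α : ℝ → E, α 0 = x ∧ ∀ t ∈ Icc (-1 : ℝ) 1,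
      HasDerivWithinAt α (v t (α t)) (Icc (-1) 1) t := by
    intro x
    -- The bound M holds on the whole space, so a ball of radius M suffices up to time 1, whatever
    -- the initial point.
    have hpl : IsPicardLindelof v (tmin := -1) (tmax := 1) ⟨0, by simp⟩ x M 0 M K :=
      { lipschitzOnWith := fun t ht => (hv.lipschitzWith (abs_le.mpr ht)).lipschitzOnWith
        continuousOn := fun y _ => (hv.continuous y).continuousOn
        norm_le := fun t ht y _ => hv.norm_le t (abs_le.mpr ht) y
        mul_max_le := by simp }
    exact hpl.exists_eq_forall_mem_Icc_hasDerivWithinAt₀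
  choose T hT0 hTd using hT
  have hTd' : ∀ x t, |t| < 1 → HasDerivAt (T x) (v t (T x t)) t := fun x t ht =>
    (hTd x t (abs_le.mp ht.le)).hasDerivAt (Icc_mem_nhds (abs_lt.mp ht).1 (abs_lt.mp ht).2)
  -- In the unit ball about the identity ‖β‖ ≤ 2, so the variational field is bounded by 2K there.
  -- The solution stays in this ball while 2Kδ ≤ 1; the summand 2 also makes δ < 1.
  set δ : ℝ≥0 := 1 / (2 * K + 2) with hδ
  have hδ0 : 0 < δ := by positivity
  have hδ1 : (δ : ℝ) < 1 := by
    rw [hδ]; push_cast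
    rw [div_lt_one (by positivity)]
    linarith [K.coe_nonneg]
  have hKδ : (K : ℝ) * 2 * δ ≤ 1 := by
    rw [hδ]; push_cast
    rw [mul_one_div, div_le_one (by positivity)]
    linarith
  have hA : ∀ x : E, ∃ β : ℝ → E →L[ℝ] E, β 0 = ContinuousLinearMap.id ℝ E ∧
      ∀ t ∈ Icc (-(δ : ℝ)) δ,
        HasDerivWithinAt β (v' t (T x t) ∘L β t) (Icc (-(δ : ℝ)) δ) t := by
    intro x
    have hle : ∀ t ∈ Icc (-(δ : ℝ)) δ, |t| < 1 := fun t ht => (abs_le.mpr ht).trans_lt hδ1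
    have hpl : IsPicardLindelof (fun t (β : E →L[ℝ] E) => v' t (T x t) ∘L β)
        (tmin := -δ) (tmax := δ) ⟨0, by simp⟩ (ContinuousLinearMap.id ℝ E) 1 0 (K * 2) K :=
      { lipschitzOnWith := fun t ht => by
          refine LipschitzWith.lipschitzOnWith (LipschitzWith.of_dist_le_mul fun β γ => ?_)
          rw [dist_eq_norm, dist_eq_norm, ← ContinuousLinearMap.comp_sub]
          refine (ContinuousLinearMap.opNorm_comp_le _ _).trans ?_
          gcongr
          exact hv.norm_deriv_le t (hle t ht).le _
        continuousOn := fun β _ => by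
          have h1 : ContinuousOn (T x) (Icc (-(δ : ℝ)) δ) := fun t ht =>
            (hTd' x t (hle t ht)).continuousAt.continuousWithinAt
          have h2 : ContinuousOn (fun t => v' t (T x t)) (Icc (-(δ : ℝ)) δ) :=
            hv.continuous_deriv.comp_continuousOn (continuousOn_id.prodMk h1)
          exact h2.clm_comp continuousOn_const
        norm_le := fun t ht β hβ => by
          have h1 : ‖β‖ ≤ 2 := by
            have h2 : ‖β - ContinuousLinearMap.id ℝ E‖ ≤ 1 := by
              simpa [dist_eq_norm] using hβ
            have h3 := norm_le_insert' β (ContinuousLinearMap.id ℝ E)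
            have h4 := ContinuousLinearMap.norm_id_le (𝕜 := ℝ) (E := E)
            linarith
          refine (ContinuousLinearMap.opNorm_comp_le _ _).trans ?_
          push_cast
          gcongr
          exact hv.norm_deriv_le t (hle t ht).le _
        mul_max_le := by simpa using hKδ }
    exact hpl.exists_eq_forall_mem_Icc_hasDerivWithinAt₀
  choose A hA0 hAd using hA
  refine ⟨δ, hδ0, hδ1.le, fun t x => T x t, fun t x => A x t, hT0, hA0, fun t ht x =>
    hTd' x t (ht.trans hδ1), fun t ht x => (hAd x t (abs_le.mp ht.le)).hasDerivAt
      (Icc_mem_nhds (abs_lt.mp ht).1 (abs_lt.mp ht).2)⟩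

variable {δ : ℝ} {T : ℝ → E → E} {A : ℝ → E → E →L[ℝ] E}

theorem norm_flow_sub_le (hv : IsBoundedField v v' M K N) (hδ : δ ≤ 1) (h0 : ∀ x, T 0 x = x)
    (hT : ∀ t, |t| < δ → ∀ x, HasDerivAt (fun s => T s x) (v t (T t x)) t) {t : ℝ}
    (ht : |t| < δ) (x : E) : ‖T t x - x‖ ≤ M * |t| := by
  have h := (convex_ball (0 : ℝ) δ).norm_image_sub_le_of_norm_hasDerivWithin_le
    (f := fun s => T s x) (f' := fun s => v s (T s x)) (C := M) (x := 0) (y := t)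
    (fun s hs => (hT s (by simpa using hs) x).hasDerivWithinAt)
    (fun s hs => hv.norm_le s (by have : |s| < δ := by simpa using hs
                                  linarith) _)
    (by simpa using (abs_nonneg t).trans_lt ht) (by simpa using ht)
  simpa [h0] using h

theorem norm_flow_sub_flow_le (hv : IsBoundedField v v' M K N) (hδ : δ ≤ 1)
    (h0 : ∀ x, T 0 x = x)
    (hT : ∀ t, |t| < δ → ∀ x, HasDerivAt (fun s => T s x) (v t (T t x)) t) {t : ℝ}
    (ht : |t| < δ) (x y : E) : ‖T t x - T t y‖ ≤ Real.exp K * ‖x - y‖ := by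
  have h := norm_le_of_norm_deriv_le_two_sided (u := fun s => T s x - T s y) (K := K) (ε := 0)
    (δ := ‖x - y‖) (by exact_mod_cast hv.one_le) le_rfl hδ (fun s hs => (hT s hs x).sub (hT s hs y))
    (fun s hs => by
      have := (hv.lipschitzWith (hs.le.trans hδ)).dist_le_mul (T s x) (T s y)
      simpa [dist_eq_norm] using this) (by simp [h0]) ht
  linarith

theorem norm_variation_le (hv : IsBoundedField v v' M K N) (hδ : δ ≤ 1)
    (hA0 : ∀ x, A 0 x = ContinuousLinearMap.id ℝ E)
    (hA : ∀ t, |t| < δ → ∀ x, HasDerivAt (fun s => A s x) (v' t (T t x) ∘L A t x) t) {t : ℝ}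
    (ht : |t| < δ) (x : E) : ‖A t x‖ ≤ Real.exp K := by
  have h := norm_le_of_norm_deriv_le_two_sided (u := fun s => A s x) (K := K) (ε := 0)
    (δ := 1) (by exact_mod_cast hv.one_le) le_rfl hδ (fun s hs => hA s hs x)
    (fun s hs => by
      rw [add_zero]
      refine (ContinuousLinearMap.opNorm_comp_le _ _).trans ?_
      gcongr
      exact hv.norm_deriv_le s (hs.le.trans hδ) _)
    (by rw [hA0]; exact ContinuousLinearMap.norm_id_le) ht
  linarith

/-- Two solutions of the variational equation differ by a solution of a linear equation with forcing
(v'(T x) - v'(T y)) A y. The Lipschitz bounds on v' and on the flow make the forcing O(‖x - y‖), and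
Grönwall shows that A is Lipschitz in the initial point. -/
theorem continuous_variation (hv : IsBoundedField v v' M K N) (hδ : δ ≤ 1)
    (h0 : ∀ x, T 0 x = x)
    (hT : ∀ t, |t| < δ → ∀ x, HasDerivAt (fun s => T s x) (v t (T t x)) t)
    (hA0 : ∀ x, A 0 x = ContinuousLinearMap.id ℝ E)
    (hA : ∀ t, |t| < δ → ∀ x, HasDerivAt (fun s => A s x) (v' t (T t x) ∘L A t x) t) {t : ℝ}
    (ht : |t| < δ) : Continuous (A t) := by
  refine (LipschitzWith.of_dist_le_mul (K := N * (Real.exp K).toNNReal ^ 3)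
    fun x y => ?_).continuous
  rw [dist_eq_norm, dist_eq_norm]
  have h := norm_le_of_norm_deriv_le_two_sided (u := fun s => A s x - A s y) (K := K)
    (ε := N * (Real.exp K * ‖x - y‖) * Real.exp K) (δ := 0) (by exact_mod_cast hv.one_le)
    (by positivity) hδ (fun s hs => (hA s hs x).sub (hA s hs y))
    (fun s hs => by
      have e : v' s (T s x) ∘L A s x - v' s (T s y) ∘L A s y =
          v' s (T s x) ∘L (A s x - A s y) + (v' s (T s x) - v' s (T s y)) ∘L A s y := by
        ext z; simp
      rw [e]
      refine (norm_add_le _ _).trans (add_le_add ?_ ?_)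
      · refine (ContinuousLinearMap.opNorm_comp_le _ _).trans ?_
        gcongr
        exact hv.norm_deriv_le s (hs.le.trans hδ) _
      · refine (ContinuousLinearMap.opNorm_comp_le _ _).trans ?_
        gcongr
        · exact (hv.lipschitz_deriv s (hs.le.trans hδ) _ _).trans
            (by gcongr; exact norm_flow_sub_flow_le hv hδ h0 hT hs x y)
        · exact norm_variation_le hv hδ hA0 hA hs y)
    (by simp [hA0]) ht
  refine h.trans (le_of_eq ?_)
  rw [NNReal.coe_mul, NNReal.coe_pow, Real.coe_toNNReal _ (Real.exp_pos _).le]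
  ring

/-- The error T(x + h) - T(x) - A(x) h starts at 0 and obeys the linearized equation up to a Taylor
remainder, which is O(‖h‖²) because the flow is Lipschitz. By Grönwall the error is O(‖h‖²) as well.
-/
theorem hasFDerivAt_flow (hv : IsBoundedField v v' M K N) (hδ : δ ≤ 1)
    (h0 : ∀ x, T 0 x = x)
    (hT : ∀ t, |t| < δ → ∀ x, HasDerivAt (fun s => T s x) (v t (T t x)) t)
    (hA0 : ∀ x, A 0 x = ContinuousLinearMap.id ℝ E)
    (hA : ∀ t, |t| < δ → ∀ x, HasDerivAt (fun s => A s x) (v' t (T t x) ∘L A t x) t) {t : ℝ}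
    (ht : |t| < δ) (x : E) : HasFDerivAt (T t) (A t x) x := by
  rw [hasFDerivAt_iff_isLittleO_nhds_zero]
  refine Asymptotics.IsBigO.trans_isLittleO (g := fun h : E => ‖h‖ ^ 2) ?_
    (Asymptotics.isLittleO_norm_pow_id one_lt_two)
  refine Asymptotics.IsBigO.of_bound (N * Real.exp K ^ 2 * Real.exp K)
    (Filter.Eventually.of_forall fun h => ?_)
  have hh := norm_le_of_norm_deriv_le_two_sided
    (u := fun s => T s (x + h) - T s x - A s x h) (K := K)
    (ε := N * (Real.exp K * ‖h‖) ^ 2) (δ := 0) (by exact_mod_cast hv.one_le)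
    (by positivity) hδ
    (fun s hs => ((hT s hs (x + h)).sub (hT s hs x)).sub
      ((hA s hs x).clm_apply (hasDerivAt_const s h)))
    (fun s hs => by
      have hs1 := hs.le.trans hδ
      have e : v s (T s (x + h)) - v s (T s x) - ((v' s (T s x) ∘L A s x) h + (A s x) 0) =
          v' s (T s x) (T s (x + h) - T s x - A s x h) +
          (v s (T s (x + h)) - v s (T s x) - v' s (T s x) (T s (x + h) - T s x)) := by
        simp
      rw [e]
      refine (norm_add_le _ _).trans (add_le_add ?_ ?_)
      · refine (ContinuousLinearMap.le_opNorm _ _).trans ?_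
        gcongr
        exact hv.norm_deriv_le s hs1 _
      · refine (hv.taylor_le hs1 _ _).trans ?_
        have := norm_flow_sub_flow_le hv hδ h0 hT hs (x + h) x
        rw [add_sub_cancel_left] at this
        gcongr)
    (by simp [h0, hA0]) ht
  rw [norm_pow, norm_norm]
  refine hh.trans (le_of_eq ?_)
  ring

theorem contDiff_flow (hv : IsBoundedField v v' M K N) (hδ : δ ≤ 1)
    (h0 : ∀ x, T 0 x = x)
    (hT : ∀ t, |t| < δ → ∀ x, HasDerivAt (fun s => T s x) (v t (T t x)) t)
    (hA0 : ∀ x, A 0 x = ContinuousLinearMap.id ℝ E)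
    (hA : ∀ t, |t| < δ → ∀ x, HasDerivAt (fun s => A s x) (v' t (T t x) ∘L A t x) t) {t : ℝ}
    (ht : |t| < δ) : ContDiff ℝ 1 (T t) := by
  have hd := fun x => hasFDerivAt_flow hv hδ h0 hT hA0 hA ht x
  rw [contDiff_one_iff_fderiv]
  refine ⟨fun x => (hd x).differentiableAt, ?_⟩
  rw [show fderiv ℝ (T t) = A t from funext fun x => (hd x).fderiv]
  exact continuous_variation hv hδ h0 hT hA0 hA ht

/-- Uniqueness forwards and backwards in time. Backwards to time 0 it gives injectivity of the
transformation; forwards from 0 it gives commutation with translations of the angles. -/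
theorem eq_of_hasDerivAt (hv : IsBoundedField v v' M K N) (hδ : δ ≤ 1) {f g : ℝ → E}
    (hf : ∀ t, |t| < δ → HasDerivAt f (v t (f t)) t)
    (hg : ∀ t, |t| < δ → HasDerivAt g (v t (g t)) t) {s t : ℝ} (hs : |s| < δ) (ht : |t| < δ)
    (h : f s = g s) : f t = g t := by
  have hm : ∀ r : ℝ, r ∈ Ioo (-δ) δ ↔ |r| < δ := fun r => abs_lt.symm
  refine ODE_solution_unique_of_mem_Ioo (v := v) (K := K) (s := fun _ => univ) (t₀ := s)
    (fun r hr => (hv.lipschitzWith (((hm r).mp hr).le.trans hδ)).lipschitzOnWith)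
    ((hm s).mpr hs) (fun r hr => ⟨hf r ((hm r).mp hr), mem_univ _⟩)
    (fun r hr => ⟨hg r ((hm r).mp hr), mem_univ _⟩) h ((hm t).mpr ht)

end IsBoundedField

end Flow

/-! ### Periodic functions, Poisson brackets and the symplectic form on phase space -/

section PhaseCalculus

open Set Metric Filter Topology
open scoped NNReal

theorem isOpen_overMomenta {M : Set (Fin 3 → ℝ)} (hM : IsOpen M) : IsOpen (overMomenta M) :=
  hM.preimage continuous_snd

theorem overMomenta_mem_nhds {M : Set (Fin 3 → ℝ)} (hM : IsOpen M) {x : Phase}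
    (hx : x ∈ overMomenta M) : overMomenta M ∈ 𝓝 x :=
  (isOpen_overMomenta hM).mem_nhds hx

theorem contDiffAt_of_overMomenta {G : Type*} [NormedAddCommGroup G] [NormedSpace ℝ G]
    {M : Set (Fin 3 → ℝ)} (hM : IsOpen M) {F : Phase → G}
    (hF : ContDiffOn ℝ ∞ F (overMomenta M)) {x : Phase} (hx : x ∈ overMomenta M) :
    ContDiffAt ℝ ∞ F x :=
  hF.contDiffAt (overMomenta_mem_nhds hM hx)

theorem differentiableAt_of_overMomenta {G : Type*} [NormedAddCommGroup G] [NormedSpace ℝ G]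
    {M : Set (Fin 3 → ℝ)} (hM : IsOpen M) {F : Phase → G}
    (hF : ContDiffOn ℝ ∞ F (overMomenta M)) {x : Phase} (hx : x ∈ overMomenta M) :
    DifferentiableAt ℝ F x :=
  (contDiffAt_of_overMomenta hM hF hx).differentiableAt (by simp)

theorem shiftAngles_eq_add (k : Fin 3 → ℤ) (x : Phase) :
    shiftAngles k x = x + shiftAngles k 0 := by
  ext i <;> simp [shiftAngles]

@[simp] theorem shiftAngles_snd (k : Fin 3 → ℤ) (x : Phase) : (shiftAngles k x).2 = x.2 := rfl

theorem shiftAngles_mem_iff {M : Set (Fin 3 → ℝ)} (k : Fin 3 → ℤ) (x : Phase) :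
    shiftAngles k x ∈ overMomenta M ↔ x ∈ overMomenta M := Iff.rfl

/-- A continuous function that is periodic in the angles is bounded over a compact set of
momenta. -/
theorem exists_bound_of_anglePeriodic {G : Type*} [NormedAddCommGroup G]
    {K : Set (Fin 3 → ℝ)} (hK : IsCompact K) {F : Phase → G}
    (hF : ContinuousOn F (overMomenta K))
    (hp : ∀ x ∈ overMomenta K, ∀ k : Fin 3 → ℤ, F (shiftAngles k x) = F x) :
    ∃ C : ℝ≥0, ∀ x ∈ overMomenta K, ‖F x‖ ≤ C := by
  have hc : IsCompact ((Set.univ.pi fun _ : Fin 3 => Icc (0 : ℝ) (2 * Real.pi)) ×ˢ K) :=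
    (isCompact_univ_pi fun _ => isCompact_Icc).prod hK
  obtain ⟨C, hC⟩ := hc.exists_bound_of_continuousOn (hF.mono fun x hx => hx.2)
  refine ⟨C.toNNReal, fun x hx => ?_⟩
  have hpi : (0 : ℝ) < 2 * Real.pi := by positivity
  -- This translation brings every angle into [0, 2π], where compactness applies.
  set k : Fin 3 → ℤ := fun i => -⌊x.1 i / (2 * Real.pi)⌋ with hk
  rw [← hp x hx k]
  refine (hC (shiftAngles k x) ⟨fun i _ => ?_, hx⟩).trans (Real.le_coe_toNNReal C)
  have h1 := Int.floor_le (x.1 i / (2 * Real.pi))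
  have h2 := (Int.lt_floor_add_one (x.1 i / (2 * Real.pi))).le
  rw [le_div_iff₀ hpi] at h1
  rw [div_le_iff₀ hpi] at h2
  simp only [shiftAngles, hk, Int.cast_neg, mem_Icc]
  constructor <;> linarith

theorem fderiv_anglePeriodic {G : Type*} [NormedAddCommGroup G] [NormedSpace ℝ G]
    {M : Set (Fin 3 → ℝ)} (hM : IsOpen M) {F : Phase → G}
    (hp : ∀ x ∈ overMomenta M, ∀ k : Fin 3 → ℤ, F (shiftAngles k x) = F x) :
    ∀ x ∈ overMomenta M, ∀ k : Fin 3 → ℤ, fderiv ℝ F (shiftAngles k x) = fderiv ℝ F x := by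
  intro x hx k
  rw [shiftAngles_eq_add, ← fderiv_comp_add_right]
  refine Filter.EventuallyEq.fderiv_eq ?_
  filter_upwards [overMomenta_mem_nhds hM hx] with y hy
  rw [← shiftAngles_eq_add, hp y hy]

theorem fderiv_congr_overMomenta {G : Type*} [NormedAddCommGroup G] [NormedSpace ℝ G]
    {M : Set (Fin 3 → ℝ)} (hM : IsOpen M) {F F' : Phase → G}
    (h : ∀ x ∈ overMomenta M, F x = F' x) {x : Phase} (hx : x ∈ overMomenta M) :
    fderiv ℝ F x = fderiv ℝ F' x :=
  Filter.EventuallyEq.fderiv_eq (by filter_upwards [overMomenta_mem_nhds hM hx] with y hy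
                                    exact h y hy)

theorem poisson_congr {M : Set (Fin 3 → ℝ)} (hM : IsOpen M) {F F' K K' : Phase → ℝ}
    (h : ∀ x ∈ overMomenta M, F x = F' x) (h' : ∀ x ∈ overMomenta M, K x = K' x) {x : Phase}
    (hx : x ∈ overMomenta M) : poisson F K x = poisson F' K' x := by
  simp only [poisson, dCoord, dMom, fderiv_congr_overMomenta hM h hx,
    fderiv_congr_overMomenta hM h' hx]

theorem poisson_anglePeriodic {M : Set (Fin 3 → ℝ)} (hM : IsOpen M) {F K : Phase → ℝ}
    (hF : IsAnglePeriodicOn F (overMomenta M)) (hK : IsAnglePeriodicOn K (overMomenta M)) :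
    IsAnglePeriodicOn (poisson F K) (overMomenta M) := by
  intro x hx k
  simp only [poisson, dCoord, dMom, fderiv_anglePeriodic hM hF x hx k,
    fderiv_anglePeriodic hM hK x hx k]

theorem ContDiffOn.fderiv_apply_const {M : Set (Fin 3 → ℝ)} (hM : IsOpen M)
    {G : Type*} [NormedAddCommGroup G] [NormedSpace ℝ G] {F : Phase → G}
    (hF : ContDiffOn ℝ ∞ F (overMomenta M)) (v : Phase) :
    ContDiffOn ℝ ∞ (fun x => fderiv ℝ F x v) (overMomenta M) :=
  (hF.fderiv_of_isOpen (isOpen_overMomenta hM) (by simp)).clm_apply contDiffOn_const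

theorem ContDiffOn.dCoord {M : Set (Fin 3 → ℝ)} (hM : IsOpen M) {F : Phase → ℝ}
    (hF : ContDiffOn ℝ ∞ F (overMomenta M)) (i : Fin 3) :
    ContDiffOn ℝ ∞ (dCoord i F) (overMomenta M) :=
  hF.fderiv_apply_const hM _

theorem ContDiffOn.dMom {M : Set (Fin 3 → ℝ)} (hM : IsOpen M) {F : Phase → ℝ}
    (hF : ContDiffOn ℝ ∞ F (overMomenta M)) (i : Fin 3) :
    ContDiffOn ℝ ∞ (dMom i F) (overMomenta M) :=
  hF.fderiv_apply_const hM _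

theorem ContDiffOn.poisson {M : Set (Fin 3 → ℝ)} (hM : IsOpen M) {F K : Phase → ℝ}
    (hF : ContDiffOn ℝ ∞ F (overMomenta M)) (hK : ContDiffOn ℝ ∞ K (overMomenta M)) :
    ContDiffOn ℝ ∞ (poisson F K) (overMomenta M) :=
  ContDiffOn.sum fun i _ => ((hF.dCoord hM i).mul (hK.dMom hM i)).sub
    ((hF.dMom hM i).mul (hK.dCoord hM i))

/-- Besides making Hamiltonian fields infinitesimally symplectic, this symmetry lets the
ℓ-derivatives of the other partials of W₁ be read off from the explicit ∂W₁/∂ℓ. -/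
theorem fderiv_fderiv_comm {M : Set (Fin 3 → ℝ)} (hM : IsOpen M) {F : Phase → ℝ}
    (hF : ContDiffOn ℝ ∞ F (overMomenta M)) {x : Phase} (hx : x ∈ overMomenta M) (v w : Phase) :
    fderiv ℝ (fun y => fderiv ℝ F y v) x w = fderiv ℝ (fun y => fderiv ℝ F y w) x v := by
  have h2 := contDiffAt_of_overMomenta hM hF hx
  have hs := (h2.isSymmSndFDerivAt (by
    simpa using WithTop.coe_le_coe.mpr (le_top (a := (2 : ℕ∞))))).eq v w
  have hd : DifferentiableAt ℝ (fderiv ℝ F) x :=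
    (h2.fderiv_right (m := ∞) (by simp)).differentiableAt (by simp)
  have e : ∀ u : Phase, fderiv ℝ (fun y => fderiv ℝ F y u) x =
      (fderiv ℝ (fderiv ℝ F) x).flip u := by
    intro u
    rw [fderiv_clm_apply hd (differentiableAt_const u)]
    simp
  rw [e, e]
  simpa using hs.symm

theorem fderiv_apply_eq_sum (W : Phase → ℝ) (x b : Phase) :
    fderiv ℝ W x b = ∑ i, (dCoord i W x * b.1 i + dMom i W x * b.2 i) := by
  have hb : b = ∑ i, (b.1 i • ((Pi.single i 1, 0) : Phase) + b.2 i • ((0, Pi.single i 1) : Phase)) := by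
    ext j
    · simp [Fin.sum_univ_three, Pi.single_apply]
      fin_cases j <;> simp
    · simp [Fin.sum_univ_three, Pi.single_apply]
      fin_cases j <;> simp
  conv_lhs => rw [hb]
  simp only [map_sum, map_add, map_smul, smul_eq_mul, dCoord, dMom]
  exact Finset.sum_congr rfl fun i _ => by ring

theorem fderiv_hamiltonianField (G W : Phase → ℝ) (x y : Phase) :
    fderiv ℝ G x (hamiltonianField W y) =
      ∑ i, (dCoord i G x * dMom i W y - dMom i G x * dCoord i W y) := by
  rw [fderiv_apply_eq_sum]
  exact Finset.sum_congr rfl fun i _ => by simp only [hamiltonianField]; ring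

/-- The standard symplectic form. -/
noncomputable def sympForm (a b : Phase) : ℝ := ∑ i, (a.1 i * b.2 i - a.2 i * b.1 i)

theorem sympForm_hamiltonianField (W : Phase → ℝ) (x b : Phase) :
    sympForm (hamiltonianField W x) b = fderiv ℝ W x b := by
  rw [fderiv_apply_eq_sum]
  exact Finset.sum_congr rfl fun i _ => by simp only [hamiltonianField]; ring

theorem sympForm_add_left (a a' b : Phase) :
    sympForm (a + a') b = sympForm a b + sympForm a' b := by
  simp only [sympForm, ← Finset.sum_add_distrib, Prod.fst_add, Prod.snd_add, Pi.add_apply]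
  exact Finset.sum_congr rfl fun i _ => by ring

theorem sympForm_smul_left (c : ℝ) (a b : Phase) : sympForm (c • a) b = c * sympForm a b := by
  simp only [sympForm, Finset.mul_sum, Prod.smul_fst, Prod.smul_snd, Pi.smul_apply, smul_eq_mul]
  exact Finset.sum_congr rfl fun i _ => by ring

theorem sympForm_neg_comm (a b : Phase) : sympForm a b = -sympForm b a := by
  simp only [sympForm, ← Finset.sum_neg_distrib]
  exact Finset.sum_congr rfl fun i _ => by ring

theorem hasDerivAt_sympForm {a b : ℝ → Phase} {a' b' : Phase} {t : ℝ} (ha : HasDerivAt a a' t)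
    (hb : HasDerivAt b b' t) :
    HasDerivAt (fun s => sympForm (a s) (b s)) (sympForm a' (b t) + sympForm (a t) b') t := by
  have h1 : ∀ {c : ℝ → Phase} {c' : Phase}, HasDerivAt c c' t → ∀ i : Fin 3,
      HasDerivAt (fun s => (c s).1 i) (c'.1 i) t ∧ HasDerivAt (fun s => (c s).2 i) (c'.2 i) t := by
    intro c c' hc i
    exact ⟨hasDerivAt_pi.mp hc.fst i, hasDerivAt_pi.mp hc.snd i⟩
  have := HasDerivAt.fun_sum (u := Finset.univ) fun i _ =>
    ((h1 ha i).1.mul (h1 hb i).2).sub ((h1 ha i).2.mul (h1 hb i).1)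
  refine this.congr_deriv ?_
  simp only [sympForm, ← Finset.sum_add_distrib]
  exact Finset.sum_congr rfl fun i _ => by ring

theorem contDiff_hamiltonianField {W : Phase → ℝ} (hW : ContDiff ℝ ∞ W) :
    ContDiff ℝ ∞ (hamiltonianField W) := by
  have h : ∀ v : Phase, ContDiff ℝ ∞ fun x => fderiv ℝ W x v := fun v =>
    (hW.fderiv_right (by simp)).clm_apply contDiff_const
  exact (contDiff_pi.mpr fun i => h _).prodMk (contDiff_pi.mpr fun i => (h _).neg)

/-- The derivative of a Hamiltonian vector field is an infinitesimally symplectic map. -/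
theorem sympForm_fderiv_hamiltonianField {W : Phase → ℝ} (hW : ContDiff ℝ ∞ W) (x a b : Phase) :
    sympForm (fderiv ℝ (hamiltonianField W) x a) b +
      sympForm a (fderiv ℝ (hamiltonianField W) x b) = 0 := by
  have hX : DifferentiableAt ℝ (hamiltonianField W) x :=
    (contDiff_hamiltonianField hW).differentiable (by simp) x
  have hM : IsOpen (univ : Set (Fin 3 → ℝ)) := isOpen_univ
  have hd : ∀ c : Phase, DifferentiableAt ℝ (fun y => fderiv ℝ W y c) x := fun c =>
    ((hW.fderiv_right (m := ∞) (by simp)).clm_apply contDiff_const).differentiable (by simp) x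
  have key : ∀ c d : Phase, sympForm (fderiv ℝ (hamiltonianField W) x c) d =
      fderiv ℝ (fun y => fderiv ℝ W y d) x c := by
    intro c d
    have hline : HasDerivAt (fun s : ℝ => x + s • c) c 0 := by
      simpa using ((hasDerivAt_id (0 : ℝ)).smul_const c).const_add x
    have h1 : HasDerivAt (fun s : ℝ => hamiltonianField W (x + s • c))
        (fderiv ℝ (hamiltonianField W) x c) 0 := by
      have := HasFDerivAt.comp_hasDerivAt (f := fun s : ℝ => x + s • c) (0 : ℝ)
        (l := hamiltonianField W) (by simpa using hX.hasFDerivAt) hline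
      simpa [Function.comp_def] using this
    have h2 := hasDerivAt_sympForm h1 (hasDerivAt_const (0 : ℝ) d)
    have h3 : HasDerivAt (fun s : ℝ => fderiv ℝ W (x + s • c) d)
        (fderiv ℝ (fun y => fderiv ℝ W y d) x c) 0 := by
      have := HasFDerivAt.comp_hasDerivAt (f := fun s : ℝ => x + s • c) (0 : ℝ)
        (l := fun y => fderiv ℝ W y d) (by simpa using (hd d).hasFDerivAt) hline
      simpa [Function.comp_def] using this
    simp only [sympForm_hamiltonianField] at h2
    have := h2.unique h3
    simpa [sympForm] using this
  rw [key, sympForm_neg_comm a, key,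
    fderiv_fderiv_comm hM (F := W) (hW.contDiffOn) (x := x) trivial b a]
  ring

theorem sympForm_basis_coord (i : Fin 3) (a : Phase) :
    sympForm a (0, Pi.single i 1) = a.1 i := by
  simp [sympForm, Pi.single_apply]

theorem sympForm_basis_mom (i : Fin 3) (a : Phase) :
    sympForm a (-Pi.single i 1, 0) = a.2 i := by
  simp [sympForm, Pi.single_apply]

/-- A differentiable map whose derivative preserves the symplectic form satisfies the canonical
Poisson bracket relations. -/
theorem isCanonicalOn_of_sympForm {T : Phase → Phase} {A : Phase → Phase →L[ℝ] Phase}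
    {U : Set Phase} (hC : ContDiffOn ℝ 1 T U) (hinj : InjOn T U)
    (hT : ∀ x ∈ U, HasFDerivAt T (A x) x)
    (hA : ∀ x ∈ U, ∀ v w, sympForm (A x v) (A x w) = sympForm v w) : IsCanonicalOn T U := by
  have main : ∀ x ∈ U, ∀ (F K : Phase → ℝ) (u u' : Phase),
      (∀ v, fderiv ℝ F x v = sympForm (A x v) u) → (∀ v, fderiv ℝ K x v = sympForm (A x v) u') →
      poisson F K x = sympForm u u' := by
    intro x hx F K u u' hF hK
    -- A linear map preserving a nondegenerate form is injective, hence surjective in finite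
    -- dimension. So u = A a and u' = A b, the differentials of F and K become ω(·, a) and ω(·, b),
    -- and their bracket is ω(a, b).
    have hker : Function.Injective (A x).toLinearMap := by
      rw [← LinearMap.ker_eq_bot, LinearMap.ker_eq_bot']
      intro v hv
      have hv' : A x v = 0 := hv
      have h0 : ∀ w, sympForm v w = 0 := fun w => by
        rw [← hA x hx, hv']; simp [sympForm]
      ext i
      · rw [← sympForm_basis_coord, h0]; rfl
      · rw [← sympForm_basis_mom, h0]; rfl
    have hsurj := LinearMap.surjective_of_injective hker
    obtain ⟨a, ha⟩ := hsurj u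
    obtain ⟨b, hb⟩ := hsurj u'
    have ha' : A x a = u := ha
    have hb' : A x b = u' := hb
    have hF' : ∀ v, fderiv ℝ F x v = sympForm v a := fun v => by rw [hF, ← ha', hA x hx]
    have hK' : ∀ v, fderiv ℝ K x v = sympForm v b := fun v => by rw [hK, ← hb', hA x hx]
    rw [← ha', ← hb', hA x hx]
    simp only [poisson, dCoord, dMom, hF', hK']
    simp [sympForm, Pi.single_apply, Fin.sum_univ_three]
    ring
  have h1 : ∀ x ∈ U, ∀ i v, fderiv ℝ (fun y => (T y).1 i) x v =
      sympForm (A x v) (0, Pi.single i 1) := by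
    intro x hx i v
    rw [sympForm_basis_coord, ((hasFDerivAt_pi'.mp (hT x hx).fst) i).fderiv]
    rfl
  have h2 : ∀ x ∈ U, ∀ i v, fderiv ℝ (fun y => (T y).2 i) x v =
      sympForm (A x v) (-Pi.single i 1, 0) := by
    intro x hx i v
    rw [sympForm_basis_mom, ((hasFDerivAt_pi'.mp (hT x hx).snd) i).fderiv]
    rfl
  refine ⟨hC, hinj, fun x hx i j => ?_, fun x hx i j => ?_, fun x hx i j => ?_⟩
  · rw [main x hx _ _ _ _ (h1 x hx i) (h1 x hx j)]
    simp [sympForm]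
  · rw [main x hx _ _ _ _ (h2 x hx i) (h2 x hx j)]
    simp [sympForm]
  · rw [main x hx _ _ _ _ (h1 x hx i) (h2 x hx j)]
    simp [sympForm, Pi.single_apply, eq_comm]

end PhaseCalculus

/-! ### Cutoff in the momenta and existence of the Lie transform -/

section CutoffFlow

open Set Metric Filter Topology
open scoped NNReal Manifold

/-- The cutoff equals 1 in a neighbourhood of s, not only on s. Hence it changes neither a function
nor its derivatives at points of s. -/
theorem exists_contDiff_cutoff {s t : Set (Fin 3 → ℝ)} (hs : IsClosed s) (hst : s ⊆ interior t) :
    ∃ χ : (Fin 3 → ℝ) → ℝ, ContDiff ℝ ∞ χ ∧ (∀ᶠ p in 𝓝ˢ s, χ p = 1) ∧ ∀ p ∉ t, χ p = 0 := by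
  obtain ⟨f, h1, h0, -⟩ := exists_contMDiffMap_one_nhds_of_subset_interior
    (n := ⊤) 𝓘(ℝ, Fin 3 → ℝ) hs hst
  exact ⟨f, f.contMDiff.contDiff, h1, h0⟩

/-- Cutting off a function in momentum space. -/
theorem contDiff_cutoff_mul {M K : Set (Fin 3 → ℝ)} (hM : IsOpen M) (hK : IsClosed K)
    (hKM : K ⊆ M) {χ : (Fin 3 → ℝ) → ℝ} (hχ : ContDiff ℝ ∞ χ) (h0 : ∀ p ∉ K, χ p = 0)
    {W : Phase → ℝ} (hW : ContDiffOn ℝ ∞ W (overMomenta M)) :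
    ContDiff ℝ ∞ fun x : Phase => χ x.2 * W x := by
  rw [contDiff_iff_contDiffAt]
  intro x
  by_cases hx : x.2 ∈ K
  · exact (hχ.comp contDiff_snd).contDiffAt.mul (contDiffAt_of_overMomenta hM hW (hKM hx))
  · refine ContDiffAt.congr_of_eventuallyEq (f := fun _ => (0 : ℝ)) contDiffAt_const ?_
    filter_upwards [overMomenta_mem_nhds hK.isOpen_compl (x := x) hx] with y hy
    rw [h0 _ hy, zero_mul]

/-- A smooth field that is periodic in the angles and vanishes outside a compact set of momenta
is bounded. -/
theorem exists_bound_of_compact_momenta {G : Type*} [NormedAddCommGroup G]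
    {K : Set (Fin 3 → ℝ)} (hK : IsCompact K) {F : Phase → G} (hF : Continuous F)
    (hp : ∀ x, ∀ k : Fin 3 → ℤ, F (shiftAngles k x) = F x) (h0 : ∀ x : Phase, x.2 ∉ K → F x = 0) :
    ∃ C : ℝ≥0, ∀ x, ‖F x‖ ≤ C := by
  obtain ⟨C, hC⟩ := exists_bound_of_anglePeriodic hK hF.continuousOn fun x _ => hp x
  refine ⟨C, fun x => ?_⟩
  by_cases hx : x.2 ∈ K
  · exact hC x hx
  · rw [h0 x hx, norm_zero]; exact C.2

theorem fderiv_eq_zero_of_momenta_notMem {G : Type*} [NormedAddCommGroup G] [NormedSpace ℝ G]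
    {K : Set (Fin 3 → ℝ)} (hK : IsClosed K) {F : Phase → G}
    (h0 : ∀ x : Phase, x.2 ∉ K → F x = 0) (x : Phase) (hx : x.2 ∉ K) : fderiv ℝ F x = 0 := by
  rw [fderiv_congr_overMomenta hK.isOpen_compl (F' := fun _ => 0) (fun y hy => h0 y hy) hx]
  simp

/-- The field and its first two derivatives are all periodic in the angles and vanish off K, so each
is globally bounded; the bound on the second derivative is the Lipschitz constant of the first. -/
theorem exists_bounds_of_compact_momenta {K : Set (Fin 3 → ℝ)} (hK : IsCompact K)
    {X : Phase → Phase} (hX : ContDiff ℝ ∞ X)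
    (hp : ∀ x, ∀ k : Fin 3 → ℤ, X (shiftAngles k x) = X x) (h0 : ∀ x : Phase, x.2 ∉ K → X x = 0) :
    ∃ C : ℝ≥0, (∀ x, ‖X x‖ ≤ C) ∧ (∀ x, ‖fderiv ℝ X x‖ ≤ C) ∧
      ∀ x y, ‖fderiv ℝ X x - fderiv ℝ X y‖ ≤ C * ‖x - y‖ := by
  have hX' : ContDiff ℝ ∞ (fderiv ℝ X) := hX.fderiv_right (by simp)
  have hX'' : ContDiff ℝ ∞ (fderiv ℝ (fderiv ℝ X)) := hX'.fderiv_right (by simp)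
  have hp' : ∀ x, ∀ k : Fin 3 → ℤ, fderiv ℝ X (shiftAngles k x) = fderiv ℝ X x := fun x =>
    fderiv_anglePeriodic isOpen_univ (fun y _ => hp y) x trivial
  have hp'' : ∀ x, ∀ k : Fin 3 → ℤ,
      fderiv ℝ (fderiv ℝ X) (shiftAngles k x) = fderiv ℝ (fderiv ℝ X) x := fun x =>
    fderiv_anglePeriodic isOpen_univ (fun y _ => hp' y) x trivial
  have h0' := fderiv_eq_zero_of_momenta_notMem hK.isClosed h0
  have h0'' := fderiv_eq_zero_of_momenta_notMem hK.isClosed h0'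
  obtain ⟨C, hC⟩ := exists_bound_of_compact_momenta hK hX.continuous hp h0
  obtain ⟨C', hC'⟩ := exists_bound_of_compact_momenta hK hX'.continuous hp' h0'
  obtain ⟨C'', hC''⟩ := exists_bound_of_compact_momenta hK hX''.continuous hp'' h0''
  refine ⟨max C (max C' C''), fun x => (hC x).trans (by simp), fun x => (hC' x).trans (by simp),
    fun x y => ?_⟩
  refine (convex_univ.norm_image_sub_le_of_norm_fderiv_le (𝕜 := ℝ) (f := fderiv ℝ X)
    (fun z _ => hX'.differentiable (by simp) z) (fun z _ => hC'' z) (mem_univ y)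
    (mem_univ x)).trans ?_
  gcongr
  simp

theorem hamiltonianField_anglePeriodic {M : Set (Fin 3 → ℝ)} (hM : IsOpen M) {W : Phase → ℝ}
    (hW : IsAnglePeriodicOn W (overMomenta M)) {x : Phase} (hx : x ∈ overMomenta M)
    (k : Fin 3 → ℤ) : hamiltonianField W (shiftAngles k x) = hamiltonianField W x := by
  simp only [hamiltonianField, dCoord, dMom, fderiv_anglePeriodic hM hW x hx k]

theorem hamiltonianField_add_mul {W₁ W₂ : Phase → ℝ} {x : Phase} (h₁ : DifferentiableAt ℝ W₁ x)
    (h₂ : DifferentiableAt ℝ W₂ x) (ε : ℝ) :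
    hamiltonianField (fun y => W₁ y + ε * W₂ y) x =
      hamiltonianField W₁ x + ε • hamiltonianField W₂ x := by
  have h : fderiv ℝ (fun y => W₁ y + ε * W₂ y) x = fderiv ℝ W₁ x + ε • fderiv ℝ W₂ x := by
    rw [fderiv_fun_add h₁ (h₂.const_mul ε), fderiv_const_mul h₂]
  ext i
  · simp [hamiltonianField, dMom, h]
  · simp [hamiltonianField, dCoord, h]; ring

theorem isBoundedField_hamiltonian {K : Set (Fin 3 → ℝ)} (hK : IsCompact K) {W₁ W₂ : Phase → ℝ}
    (h₁ : ContDiff ℝ ∞ W₁) (h₂ : ContDiff ℝ ∞ W₂) (hp₁ : IsAnglePeriodicOn W₁ univ)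
    (hp₂ : IsAnglePeriodicOn W₂ univ) (hz₁ : ∀ x : Phase, x.2 ∉ K → W₁ x = 0)
    (hz₂ : ∀ x : Phase, x.2 ∉ K → W₂ x = 0) :
    ∃ M K' N : ℝ≥0, IsBoundedField
      (fun t x => hamiltonianField W₁ x + t • hamiltonianField W₂ x)
      (fun t x => fderiv ℝ (hamiltonianField W₁) x + t • fderiv ℝ (hamiltonianField W₂) x)
      M K' N := by
  have hb : ∀ W : Phase → ℝ, ContDiff ℝ ∞ W → IsAnglePeriodicOn W univ →
      (∀ x : Phase, x.2 ∉ K → W x = 0) → _ := fun W hW hp hz =>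
    exists_bounds_of_compact_momenta hK (contDiff_hamiltonianField hW)
      (fun x k => hamiltonianField_anglePeriodic isOpen_univ hp (x := x) trivial k)
      (fun x hx => by
        have := fderiv_eq_zero_of_momenta_notMem hK.isClosed hz x hx
        ext i <;> simp [hamiltonianField, dCoord, dMom, this])
  obtain ⟨C₁, ha, hb₁, hc⟩ := hb W₁ h₁ hp₁ hz₁
  obtain ⟨C₂, ha', hb₂, hc'⟩ := hb W₂ h₂ hp₂ hz₂
  have hX₁ := contDiff_hamiltonianField h₁
  have hX₂ := contDiff_hamiltonianField h₂
  have hle : ∀ {G : Type} [NormedAddCommGroup G] [NormedSpace ℝ G] (t : ℝ) (g : G), |t| ≤ 1 →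
      ‖t • g‖ ≤ ‖g‖ := fun t g ht => by
    rw [norm_smul, Real.norm_eq_abs]
    exact mul_le_of_le_one_left (norm_nonneg _) ht
  -- The extra 1 only serves the normalization K ≥ 1 in `IsBoundedField`.
  refine ⟨C₁ + C₂, C₁ + C₂ + 1, C₁ + C₂,
    { one_le := by simp
      continuous := fun x => by fun_prop
      continuous_deriv := ?_
      hasFDerivAt := fun t x => ?_
      norm_le := fun t ht x => ?_
      norm_deriv_le := fun t ht x => ?_
      lipschitz_deriv := fun t ht x y => ?_ }⟩
  · have e₁ := hX₁.continuous_fderiv (by simp)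
    have e₂ := hX₂.continuous_fderiv (by simp)
    exact (e₁.comp continuous_snd).add (continuous_fst.smul (e₂.comp continuous_snd))
  · exact (hX₁.differentiable (by simp) x).hasFDerivAt.add
      ((hX₂.differentiable (by simp) x).hasFDerivAt.const_smul t)
  · push_cast
    exact (norm_add_le _ _).trans (add_le_add (ha x) ((hle t _ ht).trans (ha' x)))
  · push_cast
    have := (norm_add_le _ _).trans (add_le_add (hb₁ x) ((hle t (fderiv ℝ (hamiltonianField W₂) x)
      ht).trans (hb₂ x)))
    linarith
  · have e : fderiv ℝ (hamiltonianField W₁) x + t • fderiv ℝ (hamiltonianField W₂) x -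
        (fderiv ℝ (hamiltonianField W₁) y + t • fderiv ℝ (hamiltonianField W₂) y) =
        (fderiv ℝ (hamiltonianField W₁) x - fderiv ℝ (hamiltonianField W₁) y) +
        t • (fderiv ℝ (hamiltonianField W₂) x - fderiv ℝ (hamiltonianField W₂) y) := by
      rw [smul_sub]; abel
    rw [e]
    push_cast
    rw [add_mul]
    exact (norm_add_le _ _).trans (add_le_add (hc x y) ((hle t _ ht).trans (hc' x y)))

/-- The Lie transform generated by `W₁ + ε W₂` exists, uniformly in the angles, over a
neighbourhood of any compact set of momenta. It consists of canonical transformations that commute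
with the translations of the angles by multiples of `2π`. -/
theorem exists_lieTransform {M : Set (Fin 3 → ℝ)} (hM : IsOpen M) {W₁ W₂ : Phase → ℝ}
    (h₁ : ContDiffOn ℝ ∞ W₁ (overMomenta M)) (h₂ : ContDiffOn ℝ ∞ W₂ (overMomenta M))
    (hp₁ : IsAnglePeriodicOn W₁ (overMomenta M)) (hp₂ : IsAnglePeriodicOn W₂ (overMomenta M))
    {P : Set (Fin 3 → ℝ)} (hP : IsCompact P) (hPM : P ⊆ M) :
    ∃ (V K : Set (Fin 3 → ℝ)) (ε₀ : ℝ) (T : ℝ → Phase → Phase),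
      IsOpen V ∧ P ⊆ V ∧ V ⊆ M ∧ IsCompact K ∧ K ⊆ M ∧ 0 < ε₀ ∧ ε₀ ≤ 1 ∧
      IsLieTransform (fun ε x => W₁ x + ε * W₂ x) (overMomenta M) (overMomenta V) ε₀ T ∧
      ∀ ε : ℝ, |ε| < ε₀ → IsCanonicalOn (T ε) (overMomenta V) ∧
        ∀ x ∈ overMomenta V, T ε x ∈ overMomenta K ∧
          ∀ k : Fin 3 → ℤ, T ε (shiftAngles k x) = shiftAngles k (T ε x) := by
  -- Three nested neighbourhoods of P: points start within r/4, stay within r/2, where the cutoff is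
  -- 1, and the cutoff is supported within r, inside M.
  obtain ⟨r, hr, hrM⟩ := hP.exists_cthickening_subset_open hM hPM
  have hKc : IsCompact (cthickening r P) := hP.cthickening
  have hK'c : IsCompact (cthickening (r / 2) P) := hP.cthickening
  have hK'K : cthickening (r / 2) P ⊆ cthickening r P := cthickening_mono (by linarith) P
  obtain ⟨χ, hχ, hχ1, hχ0⟩ := exists_contDiff_cutoff (s := cthickening (r / 2) P)
    (t := cthickening r P) isClosed_cthickening
    ((cthickening_subset_thickening' hr (by linarith) P).trans
      (interior_maximal (thickening_subset_cthickening r P) isOpen_thickening))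
  have hcut : ∀ W : Phase → ℝ, ContDiffOn ℝ ∞ W (overMomenta M) →
      ContDiff ℝ ∞ fun x : Phase => χ x.2 * W x := fun W hW =>
    contDiff_cutoff_mul hM isClosed_cthickening hrM hχ hχ0 hW
  have hper : ∀ W : Phase → ℝ, IsAnglePeriodicOn W (overMomenta M) →
      IsAnglePeriodicOn (fun x : Phase => χ x.2 * W x) univ := by
    intro W hW x _ k
    by_cases hx : x.2 ∈ cthickening r P
    · simp only [shiftAngles_snd, hW x (hrM hx) k]
    · simp only [shiftAngles_snd, hχ0 _ hx, zero_mul]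
  have hz : ∀ W : Phase → ℝ, ∀ x : Phase, x.2 ∉ cthickening r P → χ x.2 * W x = 0 :=
    fun W x hx => by rw [hχ0 _ hx, zero_mul]
  set U₁ : Phase → ℝ := fun x => χ x.2 * W₁ x with hU₁
  set U₂ : Phase → ℝ := fun x => χ x.2 * W₂ x with hU₂
  have hs₁ := hcut W₁ h₁
  have hs₂ := hcut W₂ h₂
  obtain ⟨B, K', N, hv⟩ := isBoundedField_hamiltonian hKc hs₁ hs₂ (hper W₁ hp₁) (hper W₂ hp₂)
    (hz W₁) (hz W₂)
  obtain ⟨δ, hδ0, hδ1, T, A, hT0, hA0, hT, hA⟩ := hv.exists_flow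
  have hfield : ∀ x : Phase, x.2 ∈ cthickening (r / 2) P → ∀ ε : ℝ,
      hamiltonianField U₁ x + ε • hamiltonianField U₂ x =
        hamiltonianField (fun y => W₁ y + ε * W₂ y) x := by
    intro x hx ε
    have hxM : x ∈ overMomenta M := hrM (hK'K hx)
    rw [hamiltonianField_add_mul (differentiableAt_of_overMomenta hM h₁ hxM)
      (differentiableAt_of_overMomenta hM h₂ hxM)]
    have he : ∀ W : Phase → ℝ, hamiltonianField (fun y : Phase => χ y.2 * W y) x =
        hamiltonianField W x := by
      intro W
      have h1 : ∀ᶠ p in 𝓝 x.2, χ p = 1 := hχ1.filter_mono (nhds_le_nhdsSet hx)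
      have : fderiv ℝ (fun y : Phase => χ y.2 * W y) x = fderiv ℝ W x := by
        refine Filter.EventuallyEq.fderiv_eq ?_
        filter_upwards [continuous_snd.continuousAt.eventually h1] with y hy
        rw [hy, one_mul]
      simp only [hamiltonianField, dCoord, dMom, this]
    rw [he W₁, he W₂]
  -- A point moves by at most B |ε|, which is below r/4 for these times; B + 1 avoids division by
  -- zero.
  set ε₀ : ℝ := min δ (r / 4 / (B + 1)) with hε₀
  have hB : (0 : ℝ) < B + 1 := by positivity
  have hε₀pos : 0 < ε₀ := lt_min hδ0 (by positivity)
  have hε₀δ : ε₀ ≤ δ := min_le_left _ _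
  have hstay : ∀ ε : ℝ, |ε| < ε₀ → ∀ x ∈ overMomenta (thickening (r / 4) P),
      T ε x ∈ overMomenta (cthickening (r / 2) P) := by
    intro ε hε x hx
    have h1 := hv.norm_flow_sub_le hδ1 hT0 hT (hε.trans_le hε₀δ) x
    have h2 : ‖(T ε x).2 - x.2‖ < r / 4 := by
      have h3 : |ε| < r / 4 / (B + 1) := hε.trans_le (min_le_right _ _)
      rw [lt_div_iff₀ hB] at h3
      calc ‖(T ε x).2 - x.2‖ ≤ ‖T ε x - x‖ := norm_snd_le (T ε x - x)
        _ ≤ B * |ε| := h1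
        _ ≤ |ε| * (B + 1) := by nlinarith [abs_nonneg ε]
        _ < r / 4 := h3
    obtain ⟨z, hz, hzx⟩ := mem_thickening_iff.mp hx
    refine thickening_subset_cthickening _ _ (mem_thickening_iff.mpr ⟨z, hz, ?_⟩)
    calc dist (T ε x).2 z ≤ dist (T ε x).2 x.2 + dist x.2 z := dist_triangle _ _ _
      _ < r / 4 + r / 4 := add_lt_add (by rwa [dist_eq_norm]) hzx
      _ = r / 2 := by ring
  have hsymp : ∀ ε : ℝ, |ε| < ε₀ → ∀ x v w, sympForm (A ε x v) (A ε x w) = sympForm v w := by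
    intro ε hε x v w
    -- Along the variational equation ω(A v, A w) is constant, because the derivatives of both
    -- Hamiltonian fields are infinitesimally symplectic.
    have hd : ∀ s, |s| < δ → HasDerivAt (fun s => sympForm (A s x v) (A s x w)) 0 s := by
      intro s hs
      have hv' := (hA s hs x).clm_apply (hasDerivAt_const s v)
      have hw' := (hA s hs x).clm_apply (hasDerivAt_const s w)
      refine (hasDerivAt_sympForm hv' hw').congr_deriv ?_
      have e₁ := sympForm_fderiv_hamiltonianField hs₁ (T s x) (A s x v) (A s x w)
      have e₂ := sympForm_fderiv_hamiltonianField hs₂ (T s x) (A s x v) (A s x w)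
      simp only [map_zero, add_zero, ContinuousLinearMap.comp_apply,
        add_apply, smul_apply]
      rw [sympForm_neg_comm (A s x v)] at e₁ e₂ ⊢
      rw [sympForm_add_left, sympForm_add_left, sympForm_smul_left, sympForm_smul_left]
      linear_combination e₁ + s * e₂
    have h := (convex_ball (0 : ℝ) δ).norm_image_sub_le_of_norm_hasDerivWithin_le
      (f := fun s => sympForm (A s x v) (A s x w)) (f' := fun _ => 0) (C := 0) (x := 0) (y := ε)
      (fun s hs => (hd s (by simpa using hs)).hasDerivWithinAt) (by simp) (by simpa using hδ0)
      (by simpa using hε.trans_le hε₀δ)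
    simp only [zero_mul, norm_le_zero_iff, sub_eq_zero] at h
    simpa [hA0] using h
  refine ⟨thickening (r / 4) P, cthickening (r / 2) P, ε₀, T, isOpen_thickening,
    self_subset_thickening (by linarith) P,
    (thickening_subset_cthickening_of_le (by linarith) P).trans hrM, hK'c, hK'K.trans hrM,
    hε₀pos, hε₀δ.trans hδ1, fun x hx => ⟨hT0 x, fun ε hε => ?_⟩, fun ε hε => ⟨?_, fun x hx =>
      ⟨hstay ε hε x hx, fun k => ?_⟩⟩⟩
  · have hs := hstay ε hε x hx
    exact ⟨hrM (hK'K hs), hfield _ hs ε ▸ hT ε (hε.trans_le hε₀δ) x⟩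
  · refine isCanonicalOn_of_sympForm (A := A ε) ?_ ?_ ?_ ?_
    · exact (hv.contDiff_flow hδ1 hT0 hT hA0 hA (hε.trans_le hε₀δ)).contDiffOn
    · intro x _ y _ hxy
      have := hv.eq_of_hasDerivAt hδ1 (fun t ht => hT t ht x) (fun t ht => hT t ht y)
        (hε.trans_le hε₀δ) (t := 0) (by simpa using hδ0) hxy
      simpa [hT0] using this
    · exact fun x _ => hv.hasFDerivAt_flow hδ1 hT0 hT hA0 hA (hε.trans_le hε₀δ) x
    · exact fun x _ => hsymp ε hε x
  -- The translate of a solution solves the same equation, the cut-off field being periodic, and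
  -- both curves start at the same point.
  · refine hv.eq_of_hasDerivAt hδ1 (f := fun t => T t (shiftAngles k x))
      (g := fun t => shiftAngles k (T t x)) (fun t ht => hT t ht _) (fun t ht => ?_) (s := 0)
      (by simpa using hδ0) (hε.trans_le hε₀δ) (by simp [hT0])
    have h1 := (hT t ht x).add_const (shiftAngles k 0)
    simp only [← shiftAngles_eq_add] at h1
    rw [hamiltonianField_anglePeriodic isOpen_univ (hper W₁ hp₁) (x := T t x) trivial,
      hamiltonianField_anglePeriodic isOpen_univ (hper W₂ hp₂) (x := T t x) trivial]
    exact h1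

end CutoffFlow

/-! ### Third-order remainder of the Lie transform -/

section LieRemainder

open Set Metric Filter Topology
open scoped NNReal

theorem abs_le_mul_pow_succ_of_hasDerivAt {f f' : ℝ → ℝ} {b C : ℝ} {k : ℕ} (hC : 0 ≤ C)
    (h0 : f 0 = 0) (hf : ∀ t, |t| < b → HasDerivAt f (f' t) t)
    (hb : ∀ t, |t| < b → |f' t| ≤ C * |t| ^ k) {t : ℝ} (ht : |t| < b) :
    |f t| ≤ C * |t| ^ (k + 1) := by
  have hm : ∀ s ∈ closedBall (0 : ℝ) |t|, |s| ≤ |t| := fun s hs => by simpa using hs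
  have h := (convex_closedBall (0 : ℝ) |t|).norm_image_sub_le_of_norm_hasDerivWithin_le
    (f := f) (f' := f') (C := C * |t| ^ k) (x := 0) (y := t)
    (fun s hs => (hf s ((hm s hs).trans_lt ht)).hasDerivWithinAt)
    (fun s hs => (hb s ((hm s hs).trans_lt ht)).trans (by have := hm s hs; gcongr))
    (by simp) (by simp)
  rw [h0, sub_zero, sub_zero, Real.norm_eq_abs, Real.norm_eq_abs] at h
  rwa [pow_succ, ← mul_assoc]

/-- Along the flow, differentiation in ε is the bracket with W₁ + ε W₂. It is split here by powers
of ε so that the homological equations can be inserted order by order. -/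
theorem hasDerivAt_comp_lieTransform {M V : Set (Fin 3 → ℝ)} (hM : IsOpen M)
    {W₁ W₂ G : Phase → ℝ} (h₁ : ContDiffOn ℝ ∞ W₁ (overMomenta M))
    (h₂ : ContDiffOn ℝ ∞ W₂ (overMomenta M)) (hG : ContDiffOn ℝ ∞ G (overMomenta M))
    {ε₀ : ℝ} {T : ℝ → Phase → Phase}
    (hT : IsLieTransform (fun ε x => W₁ x + ε * W₂ x) (overMomenta M) (overMomenta V) ε₀ T)
    {x : Phase} (hx : x ∈ overMomenta V) {ε : ℝ} (hε : |ε| < ε₀) :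
    HasDerivAt (fun t => G (T t x))
      (poisson G W₁ (T ε x) + ε * poisson G W₂ (T ε x)) ε := by
  obtain ⟨hD, hd⟩ := (hT x hx).2 ε hε
  have h := (differentiableAt_of_overMomenta hM hG hD).hasFDerivAt.comp_hasDerivAt ε hd
  refine h.congr_deriv ?_
  rw [hamiltonianField_add_mul (differentiableAt_of_overMomenta hM h₁ hD)
    (differentiableAt_of_overMomenta hM h₂ hD), map_add, map_smul, fderiv_hamiltonianField,
    fderiv_hamiltonianField]
  rfl

/-- If the terms `S₁`, `S₂` satisfy the homological equations of the first two orders, then the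
Lie transform reduces `H₀ + ε H₁` to `H₀ + ε S₁ + ε² S₂ / 2` up to terms of the third order. -/
theorem exists_lieTransform_remainder_bound {M V K : Set (Fin 3 → ℝ)} (hM : IsOpen M)
    (hK : IsCompact K) (hKM : K ⊆ M) {H₀ H₁ S₁ S₂ W₁ W₂ : Phase → ℝ}
    (hH₀ : ContDiffOn ℝ ∞ H₀ (overMomenta M)) (hH₁ : ContDiffOn ℝ ∞ H₁ (overMomenta M))
    (hS₁ : ContDiffOn ℝ ∞ S₁ (overMomenta M)) (hS₂ : ContDiffOn ℝ ∞ S₂ (overMomenta M))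
    (h₁ : ContDiffOn ℝ ∞ W₁ (overMomenta M)) (h₂ : ContDiffOn ℝ ∞ W₂ (overMomenta M))
    (pH₁ : IsAnglePeriodicOn H₁ (overMomenta M)) (pS₁ : IsAnglePeriodicOn S₁ (overMomenta M))
    (pS₂ : IsAnglePeriodicOn S₂ (overMomenta M)) (p₁ : IsAnglePeriodicOn W₁ (overMomenta M))
    (p₂ : IsAnglePeriodicOn W₂ (overMomenta M))
    (e₁ : ∀ x ∈ overMomenta M, H₁ x + poisson H₀ W₁ x = S₁ x)
    (e₂ : ∀ x ∈ overMomenta M,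
      poisson H₀ W₂ x + poisson H₁ W₁ x + poisson S₁ W₁ x = S₂ x)
    {ε₀ : ℝ} (hε₀ : ε₀ ≤ 1) {T : ℝ → Phase → Phase}
    (hT : IsLieTransform (fun ε x => W₁ x + ε * W₂ x) (overMomenta M) (overMomenta V) ε₀ T)
    (hTK : ∀ ε : ℝ, |ε| < ε₀ → ∀ x ∈ overMomenta V, T ε x ∈ overMomenta K) :
    ∃ C : ℝ, ∀ ε : ℝ, |ε| < ε₀ → ∀ x ∈ overMomenta V,
      |H₀ (T ε x) + ε * H₁ (T ε x) - (H₀ x + ε * S₁ x + ε ^ 2 / 2 * S₂ x)| ≤ C * |ε| ^ 3 := by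
  have bound : ∀ G : Phase → ℝ, ContDiffOn ℝ ∞ G (overMomenta M) →
      IsAnglePeriodicOn G (overMomenta M) → ∃ C : ℝ≥0, ∀ x ∈ overMomenta K, ‖G x‖ ≤ C :=
    fun G hG pG => exists_bound_of_anglePeriodic hK
      (hG.continuousOn.mono fun x hx => hKM hx) fun x hx => pG x (hKM hx)
  set Q : Phase → ℝ := poisson S₁ W₁
  have hQ : ContDiffOn ℝ ∞ Q (overMomenta M) := hS₁.poisson hM h₁
  have pQ : IsAnglePeriodicOn Q (overMomenta M) := poisson_anglePeriodic hM pS₁ p₁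
  obtain ⟨C₁, hC₁⟩ := bound _ (hS₁.poisson hM h₂) (poisson_anglePeriodic hM pS₁ p₂)
  obtain ⟨C₂, hC₂⟩ := bound _ (hQ.poisson hM h₁) (poisson_anglePeriodic hM pQ p₁)
  obtain ⟨C₃, hC₃⟩ := bound _ (hQ.poisson hM h₂) (poisson_anglePeriodic hM pQ p₂)
  obtain ⟨C₄, hC₄⟩ := bound _ (hS₂.poisson hM h₁) (poisson_anglePeriodic hM pS₂ p₁)
  obtain ⟨C₅, hC₅⟩ := bound _ (hS₂.poisson hM h₂) (poisson_anglePeriodic hM pS₂ p₂)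
  obtain ⟨C₆, hC₆⟩ := bound _ (hH₁.poisson hM h₂) (poisson_anglePeriodic hM pH₁ p₂)
  simp only [Real.norm_eq_abs] at hC₁ hC₂ hC₃ hC₄ hC₅ hC₆
  refine ⟨(C₁ + (C₂ + C₃)) + (C₄ + C₅) + C₆, fun ε hε x hx => ?_⟩
  have hD : ∀ {G : Phase → ℝ}, ContDiffOn ℝ ∞ G (overMomenta M) → ∀ {t : ℝ}, |t| < ε₀ →
      HasDerivAt (fun t => G (T t x)) (poisson G W₁ (T t x) + t * poisson G W₂ (T t x)) t :=
    fun hG _ ht => hasDerivAt_comp_lieTransform hM h₁ h₂ hG hT hx ht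
  have hsmall : ∀ {t : ℝ} (c : ℝ), |t| < ε₀ → |t * c| ≤ |c| := fun {t} c ht => by
    rw [abs_mul]
    exact mul_le_of_le_one_left (abs_nonneg _) (ht.le.trans hε₀)
  have hT0 : T 0 x = x := (hT x hx).1
  -- The derivative of S₁ along the flow is Q + t {S₁; W₂}, and that of t Q begins with the same Q.
  -- These cancel and leave t times a bounded function, so the difference is O(t²).
  have ha : ∀ t, |t| < ε₀ → |S₁ (T t x) - S₁ x - t * Q (T t x)| ≤
      (C₁ + (C₂ + C₃)) * |t| ^ (1 + 1) := by
    intro t ht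
    refine abs_le_mul_pow_succ_of_hasDerivAt (f := fun t => S₁ (T t x) - S₁ x - t * Q (T t x))
      (f' := fun t => t * (poisson S₁ W₂ (T t x) -
        (poisson Q W₁ (T t x) + t * poisson Q W₂ (T t x)))) (by positivity) (by simp [hT0])
      (fun s hs => ?_) (fun s hs => ?_) ht
    · refine (((hD hS₁ hs).sub_const (S₁ x)).sub ((hasDerivAt_id s).mul (hD hQ hs))).congr_deriv ?_
      simp only [id_eq, Q]
      ring
    · have hs' := hTK s hs x hx
      rw [abs_mul, pow_one, mul_comm]
      gcongr
      refine (abs_sub _ _).trans (add_le_add (hC₁ _ hs') ((abs_add_le _ _).trans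
        (add_le_add (hC₂ _ hs') ((hsmall _ hs).trans (hC₃ _ hs')))))
  have hb : ∀ t, |t| < ε₀ → |S₂ (T t x) - S₂ x| ≤ (C₄ + C₅) * |t| ^ (0 + 1) := by
    intro t ht
    refine abs_le_mul_pow_succ_of_hasDerivAt (f := fun t => S₂ (T t x) - S₂ x)
      (by positivity) (by simp [hT0]) (fun s hs => (hD hS₂ hs).sub_const (S₂ x))
      (fun s hs => ?_) ht
    have hs' := hTK s hs x hx
    rw [pow_zero, mul_one]
    exact (abs_add_le _ _).trans (add_le_add (hC₄ _ hs') ((hsmall _ hs).trans (hC₅ _ hs')))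
  -- By `e₁` and `e₂`, the derivative of H₀ + t H₁ along the flow is S₁ + t (S₂ - Q) + t² {H₁; W₂}
  -- at the moving point. Subtracting S₁(x) + t S₂(x) leaves three terms of order t², and one
  -- integration gives the cube.
  refine abs_le_mul_pow_succ_of_hasDerivAt (k := 2)
    (f := fun t => H₀ (T t x) + t * H₁ (T t x) - (H₀ x + t * S₁ x + t ^ 2 / 2 * S₂ x))
    (f' := fun t => (S₁ (T t x) - S₁ x - t * Q (T t x)) + t * (S₂ (T t x) - S₂ x) +
      t ^ 2 * poisson H₁ W₂ (T t x)) (by positivity) (by simp [hT0])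
    (fun s hs => ?_) (fun s hs => ?_) hε
  · have hsM : T s x ∈ overMomenta M := hKM (hTK s hs x hx)
    refine (((hD hH₀ hs).add ((hasDerivAt_id s).mul (hD hH₁ hs))).sub
      (((hasDerivAt_id s).mul_const (S₁ x)).const_add (H₀ x) |>.add
        (((hasDerivAt_pow 2 s).div_const 2).mul_const (S₂ x)))).congr_deriv ?_
    simp only [id_eq, ← e₁ (T s x) hsM, ← e₂ (T s x) hsM, Q]
    push_cast
    ring
  · have hs' := hTK s hs x hx
    have h1 := ha s hs
    have h2 := hb s hs
    have h3 : |s * (S₂ (T s x) - S₂ x)| ≤ (C₄ + C₅) * |s| ^ 2 := by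
      rw [abs_mul]
      calc |s| * |S₂ (T s x) - S₂ x| ≤ |s| * ((C₄ + C₅) * |s| ^ (0 + 1)) := by gcongr
        _ = _ := by ring
    have h4 : |s ^ 2 * poisson H₁ W₂ (T s x)| ≤ C₆ * |s| ^ 2 := by
      rw [abs_mul, abs_pow, mul_comm]
      gcongr
      exact hC₆ _ hs'
    calc _ ≤ _ := (abs_add_le _ _).trans (add_le_add ((abs_add_le _ _).trans (add_le_add h1 h3)) h4)
      _ = _ := by ring

end LieRemainder

/-! ### Smoothness and derivatives of the eccentric and true anomalies -/

section Kepler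

open Set Filter Topology

theorem one_sub_mul_cos_pos {e : ℝ} (h0 : 0 ≤ e) (h1 : e < 1) (u : ℝ) :
    0 < 1 - e * Real.cos u := by
  nlinarith [Real.cos_le_one u]

/-- Implicit function theorem for the Kepler equation. Requiring e > 0 keeps nearby values of e in
[0, 1), where the solution is unique. -/
theorem contDiffAt_eccentricAnomaly {z : ℝ × ℝ} (h0 : 0 < z.1) (h1 : z.1 < 1) :
    ContDiffAt ℝ ∞ (fun y : ℝ × ℝ => eccentricAnomaly y.1 y.2) z := by
  set F : (ℝ × ℝ) × ℝ → ℝ := fun w => w.2 - w.1.1 * Real.sin w.2 - w.1.2 with hF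
  set u : ℝ := eccentricAnomaly z.1 z.2 with hu
  have hFs : ContDiff ℝ ∞ F := by fun_prop
  have hz : F (z, u) = 0 := by
    simp only [hF]
    rw [(eccentricAnomaly_iff h0.le h1 z.2 u).mp hu, sub_self]
  -- The partial derivative in u is multiplication by 1 - e cos u, which is positive.
  have hinv : (fderiv ℝ F (z, u) ∘L .inr ℝ (ℝ × ℝ) ℝ).IsInvertible := by
    have hc : (1 - z.1 * Real.cos u) ≠ 0 := (one_sub_mul_cos_pos h0.le h1 u).ne'
    refine ⟨ContinuousLinearEquiv.smulLeft (Units.mk0 _ hc), ?_⟩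
    have h1 : HasDerivAt (fun s : ℝ => F (z, s)) (1 - z.1 * Real.cos u) u :=
      ((hasDerivAt_id u).sub ((Real.hasDerivAt_sin u).const_mul z.1)).sub_const z.2
    have h2 : HasDerivAt (fun s : ℝ => F (z, s)) (fderiv ℝ F (z, u) (0, 1)) u :=
      (hFs.differentiable (by simp) (z, u)).hasFDerivAt.comp_hasDerivAt u
        ((hasDerivAt_const u z).prodMk (hasDerivAt_id u))
    ext
    simpa using h1.unique h2
  have hcd : ContDiffAt ℝ ∞ F (z, u) := hFs.contDiffAt
  have hs := hcd.contDiffAt_implicitFunction (by simp) hinv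
  refine hs.congr_of_eventuallyEq ?_
  have hev := hcd.eventually_apply_implicitFunction (by simp) hinv
  have hop : ∀ᶠ y : ℝ × ℝ in 𝓝 z, 0 < y.1 ∧ y.1 < 1 :=
    (continuous_fst.continuousAt.eventually (lt_mem_nhds h0)).and
      (continuous_fst.continuousAt.eventually (gt_mem_nhds h1))
  filter_upwards [hev, hop] with y hy hy'
  rw [hz] at hy
  exact ((eccentricAnomaly_iff hy'.1.le hy'.2 y.2 _).mpr (sub_eq_zero.mp hy)).symm

/-- The form u + 2 arctan(...) has no branch jumps: its denominator is at least 1 - e cos u > 0. -/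
theorem contDiffAt_trueAnomaly {z : ℝ × ℝ} (h0 : 0 < z.1) (h1 : z.1 < 1) :
    ContDiffAt ℝ ∞ (fun y : ℝ × ℝ => trueAnomaly y.1 y.2) z := by
  have hE := contDiffAt_eccentricAnomaly h0 h1
  have hs : ContDiffAt ℝ ∞ (fun y : ℝ × ℝ => √(1 - y.1 ^ 2)) z :=
    ContDiffAt.sqrt (by fun_prop) (by nlinarith)
  unfold trueAnomaly
  refine hE.add (contDiffAt_const.mul (Real.contDiff_arctan.contDiffAt.comp z
    ((contDiffAt_fst.mul (Real.contDiff_sin.contDiffAt.comp z hE)).div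
      ((contDiffAt_const.add hs).sub (contDiffAt_fst.mul (Real.contDiff_cos.contDiffAt.comp z hE)))
      ?_)))
  have h2 := one_sub_mul_cos_pos h0.le h1 (eccentricAnomaly z.1 z.2)
  have h3 := Real.sqrt_nonneg (1 - z.1 ^ 2)
  linarith

theorem hasDerivAt_eccentricAnomaly {e l : ℝ → ℝ} {e' l' t : ℝ} (h0 : 0 < e t) (h1 : e t < 1)
    (he : HasDerivAt e e' t) (hl : HasDerivAt l l' t) :
    HasDerivAt (fun s => eccentricAnomaly (e s) (l s))
      ((l' + e' * Real.sin (eccentricAnomaly (e t) (l t))) /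
        (1 - e t * Real.cos (eccentricAnomaly (e t) (l t)))) t := by
  have hd : DifferentiableAt ℝ (fun s => eccentricAnomaly (e s) (l s)) t :=
    DifferentiableAt.comp t (f := fun s => (e s, l s)) (g := fun y : ℝ × ℝ =>
      eccentricAnomaly y.1 y.2) ((contDiffAt_eccentricAnomaly h0 h1).differentiableAt (by simp))
      (he.prodMk hl).differentiableAt
  set u := fun s => eccentricAnomaly (e s) (l s) with hu
  have hu' := hd.hasDerivAt
  have hk : (fun s => u s - e s * Real.sin (u s)) =ᶠ[𝓝 t] l := by
    filter_upwards [he.continuousAt.eventually (lt_mem_nhds h0),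
      he.continuousAt.eventually (gt_mem_nhds h1)] with s hs0 hs1
    exact (eccentricAnomaly_iff hs0.le hs1 (l s) (u s)).mp rfl
  have h2 := (hu'.sub (he.mul hu'.sin)).unique (hl.congr_of_eventuallyEq hk)
  refine hu'.congr_deriv ?_
  have hc := one_sub_mul_cos_pos h0.le h1 (u t)
  rw [eq_div_iff hc.ne']
  linear_combination h2

theorem one_add_mul_cos_trueAnomaly {e : ℝ} (h0 : 0 ≤ e) (h1 : e < 1) (l : ℝ) :
    1 + e * Real.cos (trueAnomaly e l) =
      (1 - e ^ 2) / (1 - e * Real.cos (eccentricAnomaly e l)) := by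
  have hc := one_sub_mul_cos_pos h0 h1 (eccentricAnomaly e l)
  rw [(cos_sin_trueAnomaly h0 h1 l).1]
  field_simp
  ring

/-- The derivative of `cos f` along a curve, rewritten as a multiple of `sin f`. -/
theorem cos_trueAnomaly_deriv_eq {η ρ su cu e e' l' : ℝ} (hη0 : 0 < η) (hρ : 0 < ρ)
    (hη2 : η ^ 2 = 1 - e ^ 2) (hρd : ρ = 1 - e * cu) (hsc : su ^ 2 + cu ^ 2 = 1) :
    ((-su * ((l' + e' * su) / ρ) - e') * ρ -
      (cu - e) * -(e' * cu + e * (-su * ((l' + e' * su) / ρ)))) / ρ ^ 2 =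
    -(η * su / ρ) * ((η ^ 2 * l' + su * (ρ + η ^ 2) * e') / (η * ρ ^ 2)) := by
  field_simp
  rw [hη2]
  grind

/-- The derivative of `sin f` along a curve, rewritten as a multiple of `cos f`. -/
theorem sin_trueAnomaly_deriv_eq {η ρ su cu e e' l' : ℝ} (hη0 : 0 < η) (hρ : 0 < ρ)
    (hη2 : η ^ 2 = 1 - e ^ 2) (hρd : ρ = 1 - e * cu) (hsc : su ^ 2 + cu ^ 2 = 1) :
    ((-(e * e') / η * su + η * (cu * ((l' + e' * su) / ρ))) * ρ -
        η * su * -(e' * cu + e * (-su * ((l' + e' * su) / ρ)))) / ρ ^ 2 =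
    (cu - e) / ρ * ((η ^ 2 * l' + su * (ρ + η ^ 2) * e') / (η * ρ ^ 2)) := by
  field_simp
  rw [hη2]
  grind

theorem hasDerivAt_trueAnomaly {e l : ℝ → ℝ} {e' l' t : ℝ} (h0 : 0 < e t) (h1 : e t < 1)
    (he : HasDerivAt e e' t) (hl : HasDerivAt l l' t) :
    HasDerivAt (fun s => trueAnomaly (e s) (l s))
      ((1 + e t * Real.cos (trueAnomaly (e t) (l t))) ^ 2 / √(1 - e t ^ 2) ^ 3 * l' +
        Real.sin (trueAnomaly (e t) (l t)) *
          (2 + e t * Real.cos (trueAnomaly (e t) (l t))) / √(1 - e t ^ 2) ^ 2 * e') t := by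
  have hd : DifferentiableAt ℝ (fun s => trueAnomaly (e s) (l s)) t :=
    DifferentiableAt.comp t (f := fun s => (e s, l s)) (g := fun y : ℝ × ℝ =>
      trueAnomaly y.1 y.2) ((contDiffAt_trueAnomaly h0 h1).differentiableAt (by simp))
      (he.prodMk hl).differentiableAt
  have hf' := hd.hasDerivAt
  set f' := deriv (fun s => trueAnomaly (e s) (l s)) t
  refine hf'.congr_deriv ?_
  have hu := hasDerivAt_eccentricAnomaly h0 h1 he hl
  have hpos : 0 < 1 - e t ^ 2 := by nlinarith
  have hη : HasDerivAt (fun s => √(1 - e s ^ 2)) (-(e t * e') / √(1 - e t ^ 2)) t := by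
    refine (((he.pow 2).const_sub 1).sqrt hpos.ne').congr_deriv ?_
    have := Real.sqrt_pos.mpr hpos
    simp only [Pi.pow_apply]
    push_cast
    field_simp
  have hη0 := Real.sqrt_pos.mpr hpos
  have hη2 := Real.sq_sqrt hpos.le
  have hcs := cos_sin_trueAnomaly h0.le h1 (l t)
  have hk := one_add_mul_cos_trueAnomaly h0.le h1 (l t)
  have hρ := one_sub_mul_cos_pos h0.le h1 (eccentricAnomaly (e t) (l t))
  have hev : ∀ᶠ s in 𝓝 t, 0 < e s ∧ e s < 1 :=
    (he.continuousAt.eventually (lt_mem_nhds h0)).and (he.continuousAt.eventually (gt_mem_nhds h1))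
  -- Once f is known to be differentiable, its derivative follows from the rational expressions of
  -- cos f and sin f in u. Both are needed, since either of sin f and cos f may vanish.
  have hc := hf'.cos.unique (((hu.cos.sub he).div ((he.mul hu.cos).const_sub 1)
    hρ.ne').congr_of_eventuallyEq (by
      filter_upwards [hev] with s hs
      exact (cos_sin_trueAnomaly hs.1.le hs.2 (l s)).1))
  have hs := hf'.sin.unique (((hη.mul hu.sin).div ((he.mul hu.cos).const_sub 1)
    hρ.ne').congr_of_eventuallyEq (by
      filter_upwards [hev] with s hs
      exact (cos_sin_trueAnomaly hs.1.le hs.2 (l s)).2))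
  have hsc := Real.sin_sq_add_cos_sq (eccentricAnomaly (e t) (l t))
  have hsc' := Real.sin_sq_add_cos_sq (trueAnomaly (e t) (l t))
  have e2 : (2 : ℝ) + e t * Real.cos (trueAnomaly (e t) (l t)) =
      1 + (1 + e t * Real.cos (trueAnomaly (e t) (l t))) := by ring
  rw [e2, hk]
  simp only [Pi.mul_apply, Pi.sub_apply] at hc hs
  rw [hcs.1] at hs
  rw [hcs.2] at hc ⊢
  rw [hcs.1, hcs.2] at hsc'
  generalize Real.sin (eccentricAnomaly (e t) (l t)) = su at *
  generalize Real.cos (eccentricAnomaly (e t) (l t)) = cu at *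
  generalize √(1 - e t ^ 2) = η at *
  generalize e t = ee at *
  set ρ := 1 - ee * cu with hρd
  rw [← hη2]
  rw [cos_trueAnomaly_deriv_eq hη0 hρ hη2 hρd hsc] at hc
  rw [sin_trueAnomaly_deriv_eq hη0 hρ hη2 hρd hsc] at hs
  have hF : (η ^ 2 / ρ) ^ 2 / η ^ 3 * l' + η * su / ρ * (1 + η ^ 2 / ρ) / η ^ 2 * e' =
      (η ^ 2 * l' + su * (ρ + η ^ 2) * e') / (η * ρ ^ 2) := by
    field_simp
  rw [hF]
  generalize (η ^ 2 * l' + su * (ρ + η ^ 2) * e') / (η * ρ ^ 2) = F at *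
  -- The two equations read sin f (f' - F) = 0 and cos f (f' - F) = 0; sin² f + cos² f = 1 combines
  -- them into f' = F.
  linear_combination (-(f' - F)) * hsc' - (η * su / ρ) * hc + ((cu - ee) / ρ) * hs

end Kepler

/-! ### Primitives of the trigonometric polynomials of the second order -/

section TrigonometricSums

/-- A sum of terms `a sin (m f + k (2 f + γ))`, listed as triples `(a, m, k)`. -/
noncomputable def sinSum (l : List (ℝ × ℤ × ℤ)) (f γ : ℝ) : ℝ :=
  (l.map fun t => t.1 * Real.sin (t.2.1 * f + t.2.2 * (2 * f + γ))).sum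

/-- The derivative of `sinSum` with respect to `f`. -/
noncomputable def cosSum (l : List (ℝ × ℤ × ℤ)) (f γ : ℝ) : ℝ :=
  (l.map fun t => t.1 * (t.2.1 + 2 * t.2.2) * Real.cos (t.2.1 * f + t.2.2 * (2 * f + γ))).sum

theorem hasDerivAt_sinSum (l : List (ℝ × ℤ × ℤ)) (γ : ℝ) {f : ℝ → ℝ} {f' t : ℝ}
    (hf : HasDerivAt f f' t) :
    HasDerivAt (fun s => sinSum l (f s) γ) (cosSum l (f t) γ * f') t := by
  induction l with
  | nil => simpa [sinSum, cosSum] using hasDerivAt_const t (0 : ℝ)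
  | cons a l ih =>
    have h := ((((hf.const_mul (a.2.1 : ℝ)).add (((hf.const_mul 2).add_const γ).const_mul (a.2.2 : ℝ))).sin
      ).const_mul a.1).add ih
    simp only [sinSum, cosSum, List.map_cons, List.sum_cons] at h ⊢
    refine h.congr_deriv ?_
    simp only [Pi.add_apply]
    ring

theorem sinSum_add_two_pi (l : List (ℝ × ℤ × ℤ)) (f γ : ℝ) (i j : ℤ) :
    sinSum l (f + 2 * Real.pi * i) (γ + 2 * (2 * Real.pi * j)) = sinSum l f γ := by
  unfold sinSum
  congr 2
  funext t
  rw [show (t.2.1 : ℝ) * (f + 2 * Real.pi * i) +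
      t.2.2 * (2 * (f + 2 * Real.pi * i) + (γ + 2 * (2 * Real.pi * j))) =
      t.2.1 * f + t.2.2 * (2 * f + γ) +
        ((t.2.1 * i + t.2.2 * (2 * i + 2 * j) : ℤ) : ℝ) * (2 * Real.pi) by push_cast; ring,
    Real.sin_add_int_mul_two_pi]

theorem cos_four_mul_eq (x : ℝ) : Real.cos (4 * x) = 8 * Real.cos x ^ 4 - 8 * Real.cos x ^ 2 + 1 := by
  rw [show 4 * x = 2 * (2 * x) by ring, Real.cos_two_mul, Real.cos_two_mul]
  ring

theorem sin_four_mul_eq (x : ℝ) :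
    Real.sin (4 * x) = (8 * Real.cos x ^ 3 - 4 * Real.cos x) * Real.sin x := by
  rw [show 4 * x = 2 * (2 * x) by ring, Real.sin_two_mul, Real.cos_two_mul, Real.sin_two_mul]
  ring

theorem sin_three_mul_eq (x : ℝ) : Real.sin (3 * x) = (4 * Real.cos x ^ 2 - 1) * Real.sin x := by
  rw [Real.sin_three_mul]
  linear_combination (-4 * Real.sin x) * Real.sin_sq_add_cos_sq x

/-- The amplitudes of the periodic part of the primitive of `(1 + e cos f)⁴ B²`, where
`B = 1 - 3 b / 2 + (3 b / 2) cos (2 f + γ)`. -/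
noncomputable def squareTerms (e b : ℝ) : List (ℝ × ℤ × ℤ) :=
  [(4 * e + 3 * e ^ 3 - 12 * b * e - 9 * b * e ^ 3 + 27 / 2 * b ^ 2 * e + 81 / 8 * b ^ 2 * e ^ 3, 1, 0),
    (3 / 2 * e ^ 2 + 1 / 4 * e ^ 4 - 9 / 2 * b * e ^ 2 - 3 / 4 * b * e ^ 4 + 81 / 16 * b ^ 2 * e ^ 2 + 27 / 32 * b ^ 2 * e ^ 4, 2, 0),
    (1 / 3 * e ^ 3 - b * e ^ 3 + 9 / 8 * b ^ 2 * e ^ 3, 3, 0),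
    (1 / 32 * e ^ 4 - 3 / 32 * b * e ^ 4 + 27 / 256 * b ^ 2 * e ^ 4, 4, 0),
    (-3 / 32 * b * e ^ 4 + 9 / 64 * b ^ 2 * e ^ 4, -4, 1),
    (-3 / 2 * b * e ^ 3 + 9 / 4 * b ^ 2 * e ^ 3, -3, 1),
    (6 * b * e + 9 / 2 * b * e ^ 3 - 9 * b ^ 2 * e - 27 / 4 * b ^ 2 * e ^ 3, -1, 1),
    (3 / 2 * b + 9 / 2 * b * e ^ 2 + 9 / 16 * b * e ^ 4 - 9 / 4 * b ^ 2 - 27 / 4 * b ^ 2 * e ^ 2 - 27 / 32 * b ^ 2 * e ^ 4, 0, 1),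
    (2 * b * e + 3 / 2 * b * e ^ 3 - 3 * b ^ 2 * e - 9 / 4 * b ^ 2 * e ^ 3, 1, 1),
    (9 / 8 * b * e ^ 2 + 3 / 16 * b * e ^ 4 - 27 / 16 * b ^ 2 * e ^ 2 - 9 / 32 * b ^ 2 * e ^ 4, 2, 1),
    (3 / 10 * b * e ^ 3 - 9 / 20 * b ^ 2 * e ^ 3, 3, 1),
    (1 / 32 * b * e ^ 4 - 3 / 64 * b ^ 2 * e ^ 4, 4, 1),
    (9 / 16 * b ^ 2 * e ^ 3, -3, 2),
    (27 / 32 * b ^ 2 * e ^ 2 + 9 / 64 * b ^ 2 * e ^ 4, -2, 2),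
    (3 / 4 * b ^ 2 * e + 9 / 16 * b ^ 2 * e ^ 3, -1, 2),
    (9 / 32 * b ^ 2 + 27 / 32 * b ^ 2 * e ^ 2 + 27 / 256 * b ^ 2 * e ^ 4, 0, 2),
    (9 / 20 * b ^ 2 * e + 27 / 80 * b ^ 2 * e ^ 3, 1, 2),
    (9 / 32 * b ^ 2 * e ^ 2 + 3 / 64 * b ^ 2 * e ^ 4, 2, 2),
    (9 / 112 * b ^ 2 * e ^ 3, 3, 2),
    (9 / 1024 * b ^ 2 * e ^ 4, 4, 2)]

/-- The average of `(1 + e cos f)⁴ B²` with respect to `f`. -/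
noncomputable def squareMean (e b γ : ℝ) : ℝ :=
  1 + 3 * e ^ 2 + 3 / 8 * e ^ 4 - 3 * b - 9 * b * e ^ 2 - 9 / 8 * b * e ^ 4 + 27 / 8 * b ^ 2 + 81 / 8 * b ^ 2 * e ^ 2 + 81 / 64 * b ^ 2 * e ^ 4 +
    (9 / 2 * b * e ^ 2 + 3 / 4 * b * e ^ 4 - 27 / 4 * b ^ 2 * e ^ 2 - 9 / 8 * b ^ 2 * e ^ 4) * Real.cos γ +
    (9 / 128 * b ^ 2 * e ^ 4) * Real.cos (2 * γ)

/-- This identity certifies the table. The index pairs (-2, 1) and (-4, 2) are absent from it: their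
phases γ and 2γ do not contain f, so these terms belong to the mean. -/
theorem cosSum_squareTerms (e b f γ : ℝ) :
    cosSum (squareTerms e b) f γ + squareMean e b γ =
      (1 + e * Real.cos f) ^ 4 * (1 - 3 / 2 * b + 3 / 2 * b * Real.cos (2 * f + γ)) ^ 2 := by
  -- With ψ = 2f + γ in place of γ, both sides are polynomials in the sines and cosines of f and ψ,
  -- to be compared modulo the two relations sin² + cos² = 1.
  obtain ⟨ψ, rfl⟩ : ∃ ψ, γ = ψ - 2 * f := ⟨γ + 2 * f, by ring⟩
  simp only [cosSum, squareTerms, squareMean, List.map_cons, List.map_nil, List.sum_cons,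
    List.sum_nil, add_sub_cancel, Real.cos_add, Real.cos_sub, mul_sub, ← mul_assoc, neg_mul,
    Real.cos_neg, Real.sin_neg, Real.cos_two_mul, Real.sin_two_mul, Real.cos_three_mul,
    sin_three_mul_eq, cos_four_mul_eq, sin_four_mul_eq, zero_mul, one_mul, Real.cos_zero,
    Real.sin_zero, Int.cast_neg, Int.cast_ofNat, Int.cast_one, Int.cast_zero]
  norm_num only [cos_four_mul_eq, sin_four_mul_eq]
  have h1 := Real.sin_sq_add_cos_sq f
  have h2 := Real.sin_sq_add_cos_sq ψ
  generalize Real.sin f = y at *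
  generalize Real.cos f = x at *
  generalize Real.sin ψ = S at *
  generalize Real.cos ψ = C at *
  grind

/-- The amplitudes of the periodic part of the primitive of the second-order terms that stem from
the motion of the node and of the perigee. -/
noncomputable def mixedTerms (e b : ℝ) : List (ℝ × ℤ × ℤ) :=
  [(-21 / 2 * b * e + 27 / 4 * b ^ 2 / e + 429 / 16 * b ^ 2 * e, 1, 0),
    (-3 / 2 * b * e ^ 2 + 57 / 8 * b ^ 2 + 15 / 4 * b ^ 2 * e ^ 2, 2, 0),
    (45 / 16 * b ^ 2 * e, 3, 0),
    (3 / 8 * b ^ 2 * e ^ 2, 4, 0),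
    (-9 / 16 * b * e ^ 2 + 27 / 32 * b ^ 2 * e ^ 2, -4, 1),
    (-45 / 8 * b * e + 135 / 16 * b ^ 2 * e, -3, 1),
    (9 / 2 * b / e + 219 / 8 * b * e - 27 / 4 * b ^ 2 / e - 549 / 16 * b ^ 2 * e, -1, 1),
    (12 * b + 21 / 4 * b * e ^ 2 - 63 / 4 * b ^ 2 - 51 / 8 * b ^ 2 * e ^ 2, 0, 1),
    (3 / 2 * b / e + 49 / 8 * b * e - 9 / 4 * b ^ 2 / e - 127 / 16 * b ^ 2 * e, 1, 1),
    (3 / 2 * b + 15 / 16 * b * e ^ 2 - 9 / 4 * b ^ 2 - 39 / 32 * b ^ 2 * e ^ 2, 2, 1),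
    (21 / 40 * b * e - 63 / 80 * b ^ 2 * e, 3, 1),
    (1 / 16 * b * e ^ 2 - 3 / 32 * b ^ 2 * e ^ 2, 4, 1),
    (9 / 32 * b ^ 2 * e, -3, 2),
    (-9 / 8 * b * e ^ 2 - 9 / 16 * b ^ 2 + 69 / 32 * b ^ 2 * e ^ 2, -2, 2),
    (-9 / 4 * b * e - 3 / 8 * b ^ 2 / e + 165 / 32 * b ^ 2 * e, -1, 2),
    (-9 / 8 * b - 3 / 4 * b * e ^ 2 + 75 / 16 * b ^ 2 + 27 / 16 * b ^ 2 * e ^ 2, 0, 2),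
    (-3 / 4 * b * e + 63 / 40 * b ^ 2 / e + 507 / 160 * b ^ 2 * e, 1, 2),
    (-1 / 8 * b * e ^ 2 + 25 / 16 * b ^ 2 + 17 / 32 * b ^ 2 * e ^ 2, 2, 2),
    (117 / 224 * b ^ 2 * e, 3, 2),
    (15 / 256 * b ^ 2 * e ^ 2, 4, 2)]

/-- The average that goes with `mixedTerms`. -/
noncomputable def mixedMean (e b γ : ℝ) : ℝ :=
  -9 / 2 * b - 3 * b * e ^ 2 + 51 / 4 * b ^ 2 + 6 * b ^ 2 * e ^ 2 +
    (9 * b + 33 / 4 * b * e ^ 2 - 27 / 2 * b ^ 2 - 81 / 8 * b ^ 2 * e ^ 2) * Real.cos γ +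
    (9 / 32 * b ^ 2 * e ^ 2) * Real.cos (2 * γ)

/-- The right side is the product of a factor from ∂W₁/∂g and the bracket of `dMom_one_hamTerm_one`.
Its 1/e comes from the dependence of e and f on G, whence the condition e ≠ 0. -/
theorem cosSum_mixedTerms {e : ℝ} (he : e ≠ 0) (b f γ : ℝ) :
    cosSum (mixedTerms e b) f γ + mixedMean e b γ =
      2 * (b * (3 / 2 * Real.cos (2 * f + γ) + 2 * e * Real.cos f * Real.cos (2 * f + γ) +
        e * Real.sin (2 * f + γ) * Real.sin f)) *
      (6 * (1 + e * Real.cos f) * (1 - 3 / 2 * b + 3 / 2 * b * Real.cos (2 * f + γ)) +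
        (3 * (1 - 3 / 2 * b + 3 / 2 * b * Real.cos (2 * f + γ)) *
            ((1 - e ^ 2) * Real.cos f / e - Real.sin f ^ 2 * (2 + e * Real.cos f)) +
          (1 + e * Real.cos f) * (-3 * b * Real.sin (2 * f + γ)) * Real.sin f *
            (2 + e * Real.cos f) / e) -
        (1 + e * Real.cos f) * (2 * (1 - b) * (3 / 2 * Real.cos (2 * f + γ) - 3 / 2))) := by
  obtain ⟨ψ, rfl⟩ : ∃ ψ, γ = ψ - 2 * f := ⟨γ + 2 * f, by ring⟩
  simp only [cosSum, mixedTerms, mixedMean, List.map_cons, List.map_nil, List.sum_cons,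
    List.sum_nil, add_sub_cancel, Real.cos_add, Real.cos_sub, mul_sub, ← mul_assoc, neg_mul,
    Real.cos_neg, Real.sin_neg, Real.cos_two_mul, Real.sin_two_mul, Real.cos_three_mul,
    sin_three_mul_eq, cos_four_mul_eq, sin_four_mul_eq, zero_mul, one_mul, Real.cos_zero,
    Real.sin_zero, Int.cast_neg, Int.cast_ofNat, Int.cast_one, Int.cast_zero]
  norm_num only [cos_four_mul_eq, sin_four_mul_eq]
  have h1 := Real.sin_sq_add_cos_sq f
  have h2 := Real.sin_sq_add_cos_sq ψ
  generalize Real.sin f = y at *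
  generalize Real.cos f = x at *
  generalize Real.sin ψ = S at *
  generalize Real.cos ψ = C at *
  field_simp
  grind

theorem contDiff_sinSum_squareTerms :
    ContDiff ℝ ∞ fun z : ℝ × ℝ × ℝ × ℝ => sinSum (squareTerms z.1 z.2.1) z.2.2.1 z.2.2.2 := by
  simp only [sinSum, squareTerms, List.map_cons, List.map_nil, List.sum_cons, List.sum_nil]
  fun_prop

theorem contDiffAt_sinSum_mixedTerms {z : ℝ × ℝ × ℝ × ℝ} (hz : z.1 ≠ 0) :
    ContDiffAt ℝ ∞ (fun z : ℝ × ℝ × ℝ × ℝ => sinSum (mixedTerms z.1 z.2.1) z.2.2.1 z.2.2.2) z := by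
  simp only [sinSum, mixedTerms, List.map_cons, List.map_nil, List.sum_cons, List.sum_nil]
  fun_prop (disch := assumption)

end TrigonometricSums

/-! ### Smoothness and directional derivatives of the Delaunay functions -/

section DelaunayCalculus

open Set Filter Topology

theorem sinIncD_sq {p : Fin 3 → ℝ} (h : |p 2| < p 1) : sinIncD p ^ 2 = 1 - (p 2 / p 1) ^ 2 := by
  refine Real.sq_sqrt ?_
  have h1 : 0 < p 1 := (abs_nonneg _).trans_lt h
  rw [sub_nonneg, sq_le_one_iff_abs_le_one, abs_div, abs_of_pos h1, div_le_one h1]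
  exact h.le

theorem etaD_sq_lt_one {p : Fin 3 → ℝ} (h0 : 0 < p 1) (h1 : p 1 < p 0) : etaD p ^ 2 < 1 := by
  have h2 : 0 < p 0 := h0.trans h1
  rw [etaD, sq_lt_one_iff₀ (by positivity), div_lt_one h2]
  exact h1

theorem eccD_sq {p : Fin 3 → ℝ} (h0 : 0 < p 1) (h1 : p 1 < p 0) :
    eccD p ^ 2 = 1 - (p 1 / p 0) ^ 2 :=
  Real.sq_sqrt (sub_nonneg.mpr (etaD_sq_lt_one h0 h1).le)

theorem eccD_pos {p : Fin 3 → ℝ} (h0 : 0 < p 1) (h1 : p 1 < p 0) : 0 < eccD p :=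
  Real.sqrt_pos.mpr (sub_pos.mpr (etaD_sq_lt_one h0 h1))

theorem eccD_lt_one {p : Fin 3 → ℝ} (h0 : 0 < p 1) (h1 : p 1 < p 0) : eccD p < 1 := by
  have h2 : 0 < p 0 := h0.trans h1
  have h3 : 0 < (p 1 / p 0) ^ 2 := by positivity
  have := eccD_sq h0 h1
  nlinarith [eccD_pos h0 h1]

theorem sqrt_one_sub_eccD_sq {p : Fin 3 → ℝ} (h0 : 0 < p 1) (h1 : p 1 < p 0) :
    √(1 - eccD p ^ 2) = p 1 / p 0 := by
  have h2 : 0 < p 0 := h0.trans h1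
  rw [eccD_sq h0 h1, sub_sub_cancel, Real.sqrt_sq (by positivity)]

theorem isOpen_momentumDomain : IsOpen momentumDomain := by
  rw [isOpen_iff_mem_nhds]
  rintro p ⟨h0, h1, h2, h3⟩
  have c : ∀ i : Fin 3, ContinuousAt (fun q : Fin 3 → ℝ => q i) p := fun i =>
    (continuous_apply i).continuousAt
  have hs : ContinuousAt (fun q : Fin 3 → ℝ => 5 * sinIncD q ^ 2 - 4) p := by
    unfold sinIncD
    exact ((((continuousAt_const.sub (((c 2).div (c 1) h0.ne').pow 2)).sqrt).pow 2).const_mul 5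
      ).sub continuousAt_const
  filter_upwards [(c 1).eventually (lt_mem_nhds h0), (c 1).eventually_lt (c 0) h1,
    ((c 2).abs).eventually_lt (c 1) h2, hs.eventually_ne h3] with q q0 q1 q2 q3
  exact ⟨q0, q1, q2, q3⟩

variable {μ R : ℝ} {x : Phase}

theorem contDiffAt_eccD {p : Fin 3 → ℝ} (h : p ∈ momentumDomain) : ContDiffAt ℝ ∞ eccD p := by
  have h2 : p 0 ≠ 0 := (h.1.trans h.2.1).ne'
  have h3 := etaD_sq_lt_one h.1 h.2.1
  unfold eccD etaD
  refine ContDiffAt.sqrt (by fun_prop (disch := exact h2)) ?_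
  unfold etaD at h3
  linarith

theorem contDiffOn_eccD :
    ContDiffOn ℝ ∞ (fun x : Phase => eccD x.2) (overMomenta momentumDomain) := fun x hx =>
  ((contDiffAt_eccD hx).comp x contDiffAt_snd).contDiffWithinAt

theorem contDiffOn_trueAnomalyD :
    ContDiffOn ℝ ∞ trueAnomalyD (overMomenta momentumDomain) := by
  intro x hx
  have h1 := contDiffAt_of_overMomenta isOpen_momentumDomain contDiffOn_eccD hx
  have h2 : ContDiffAt ℝ ∞ (fun x : Phase => x.1 0) x := by fun_prop
  exact (ContDiffAt.comp x (f := fun y : Phase => (eccD y.2, y.1 0))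
    (g := fun y : ℝ × ℝ => trueAnomaly y.1 y.2)
    (contDiffAt_trueAnomaly (eccD_pos hx.1 hx.2.1) (eccD_lt_one hx.1 hx.2.1))
    (h1.prodMk h2)).contDiffWithinAt

/-- All explicit partial derivatives are computed along straight lines in phase space, so that only
one-variable rules are needed. -/
theorem hasDerivAt_line {F : Phase → ℝ} (hF : DifferentiableAt ℝ F x) (v : Phase) :
    HasDerivAt (fun t : ℝ => F (x + t • v)) (fderiv ℝ F x v) 0 := by
  have hline : HasDerivAt (fun s : ℝ => x + s • v) v 0 := by
    simpa using ((hasDerivAt_id (0 : ℝ)).smul_const v).const_add x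
  have := HasFDerivAt.comp_hasDerivAt (f := fun s : ℝ => x + s • v) (0 : ℝ)
    (l := F) (by simpa using hF.hasFDerivAt) hline
  simpa [Function.comp_def] using this

theorem fderiv_apply_eq_of_hasDerivAt_line {F : Phase → ℝ} (hF : DifferentiableAt ℝ F x)
    {v : Phase} {c : ℝ} (h : HasDerivAt (fun t : ℝ => F (x + t • v)) c 0) :
    fderiv ℝ F x v = c :=
  (hasDerivAt_line hF v).unique h

theorem fderiv_apply_eq_zero_of_line {F : Phase → ℝ} (hF : DifferentiableAt ℝ F x) {v : Phase}
    (h : ∀ t : ℝ, F (x + t • v) = F x) : fderiv ℝ F x v = 0 :=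
  fderiv_apply_eq_of_hasDerivAt_line hF (by simpa only [h] using hasDerivAt_const (0 : ℝ) (F x))

theorem hasDerivAt_coord_line (x v : Phase) (i : Fin 3) :
    HasDerivAt (fun t : ℝ => (x + t • v).1 i) (v.1 i) 0 := by
  simpa using ((hasDerivAt_id (0 : ℝ)).mul_const (v.1 i)).const_add (x.1 i)

theorem hasDerivAt_mom_line (x v : Phase) (i : Fin 3) :
    HasDerivAt (fun t : ℝ => (x + t • v).2 i) (v.2 i) 0 := by
  simpa using ((hasDerivAt_id (0 : ℝ)).mul_const (v.2 i)).const_add (x.2 i)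

theorem hasDerivAt_eccD_line (hx : x ∈ overMomenta momentumDomain) (v : Phase) :
    HasDerivAt (fun t : ℝ => eccD (x + t • v).2)
      ((1 - eccD x.2 ^ 2) / eccD x.2 * (v.2 0 / x.2 0 - v.2 1 / x.2 1)) 0 := by
  obtain ⟨h0, h1, -, -⟩ := hx
  have h2 : 0 < x.2 0 := h0.trans h1
  have h3 := etaD_sq_lt_one h0 h1
  have h4 := eccD_pos h0 h1
  have h := ((((hasDerivAt_mom_line x v 1).div (hasDerivAt_mom_line x v 0)
    (by simpa using h2.ne')).pow 2).const_sub 1).sqrt (by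
      simp only [Pi.pow_apply, Pi.div_apply, zero_smul, add_zero]
      unfold etaD at h3
      linarith)
  refine h.congr_deriv ?_
  simp only [Pi.pow_apply, Pi.div_apply, zero_smul, add_zero]
  have e : √(1 - (x.2 1 / x.2 0) ^ 2) = eccD x.2 := rfl
  rw [e, eccD_sq h0 h1]
  simp only [Nat.reduceSub, pow_one, Nat.cast_ofNat]
  field_simp
  ring

theorem hasDerivAt_sinIncD_sq_line (hx : x ∈ overMomenta momentumDomain) {v : Phase}
    (hv : v.2 2 = 0) :
    HasDerivAt (fun t : ℝ => sinIncD (x + t • v).2 ^ 2)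
      (2 * (1 - sinIncD x.2 ^ 2) / x.2 1 * v.2 1) 0 := by
  have h1 : x.2 1 ≠ 0 := hx.1.ne'
  have h := (((hasDerivAt_mom_line x v 2).div (hasDerivAt_mom_line x v 1)
    (by simpa using h1)).pow 2).const_sub 1
  refine (h.congr_deriv ?_).congr_of_eventuallyEq ?_
  · simp only [Pi.div_apply, zero_smul, add_zero, hv, sinIncD_sq hx.2.2.1]
    simp only [Nat.reduceSub, pow_one, Nat.cast_ofNat]
    field_simp
    ring
  · have hc : ContinuousAt (fun t : ℝ => x + t • v) 0 := by fun_prop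
    have hm : overMomenta momentumDomain ∈ 𝓝 (x + (0 : ℝ) • v) := by
      simpa using overMomenta_mem_nhds isOpen_momentumDomain hx
    filter_upwards [hc.preimage_mem_nhds hm] with t ht
    exact sinIncD_sq ht.2.2.1

theorem hasDerivAt_trueAnomalyD_line (hx : x ∈ overMomenta momentumDomain) (v : Phase) :
    HasDerivAt (fun t : ℝ => trueAnomalyD (x + t • v))
      ((1 + eccD x.2 * Real.cos (trueAnomalyD x)) ^ 2 * (x.2 0 / x.2 1) ^ 3 * v.1 0 +
        Real.sin (trueAnomalyD x) * (2 + eccD x.2 * Real.cos (trueAnomalyD x)) / eccD x.2 *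
          (v.2 0 / x.2 0 - v.2 1 / x.2 1)) 0 := by
  obtain ⟨h0, h1, -, -⟩ := id hx
  have h2 : 0 < x.2 0 := h0.trans h1
  have h4 := eccD_pos h0 h1
  have h5 : 1 - eccD x.2 ^ 2 ≠ 0 := by
    rw [eccD_sq h0 h1]; have : x.2 1 / x.2 0 ≠ 0 := by positivity
    simpa using this
  have h := hasDerivAt_trueAnomaly (e := fun t : ℝ => eccD (x + t • v).2)
    (l := fun t : ℝ => (x + t • v).1 0) (t := 0) (by simpa using h4)
    (by simpa using eccD_lt_one h0 h1) (hasDerivAt_eccD_line hx v) (hasDerivAt_coord_line x v 0)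
  refine h.congr_deriv ?_
  simp only [zero_smul, add_zero]
  have e : trueAnomaly (eccD x.2) (x.1 0) = trueAnomalyD x := rfl
  have h6 : √(1 - eccD x.2 ^ 2) ^ 2 = 1 - eccD x.2 ^ 2 :=
    Real.sq_sqrt (by nlinarith [eccD_lt_one h0 h1])
  rw [e, h6, sqrt_one_sub_eccD_sq h0 h1]
  field_simp

theorem radiusD_eq (hμ : 0 < μ) (hx : x ∈ overMomenta momentumDomain) :
    radiusD μ x = x.2 1 ^ 2 / (μ * (1 + eccD x.2 * Real.cos (trueAnomalyD x))) ∧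
      0 < 1 + eccD x.2 * Real.cos (trueAnomalyD x) := by
  obtain ⟨h0, h1, -, -⟩ := hx
  have h2 : 0 < x.2 0 := h0.trans h1
  have h3 := eccD_pos h0 h1
  have h4 := eccD_lt_one h0 h1
  have hk : 0 < 1 + eccD x.2 * Real.cos (trueAnomalyD x) := by
    nlinarith [Real.neg_one_le_cos (trueAnomalyD x)]
  refine ⟨?_, hk⟩
  have h5 := one_add_mul_cos_trueAnomaly h3.le h4 (x.1 0)
  have h6 := one_sub_mul_cos_pos h3.le h4 (eccentricAnomaly (eccD x.2) (x.1 0))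
  have e : trueAnomaly (eccD x.2) (x.1 0) = trueAnomalyD x := rfl
  rw [e, eccD_sq h0 h1] at h5
  rw [radiusD, smaD, h5]
  field_simp
  ring

theorem paramD_eq (hμ : 0 < μ) {p : Fin 3 → ℝ} (h : 0 < p 0) : paramD μ p = p 1 ^ 2 / μ := by
  rw [paramD, smaD, etaD]
  field_simp

/-- The disturbing function in terms of the true anomaly. -/
theorem hamTerm_one_eq (hμ : 0 < μ) (hx : x ∈ overMomenta momentumDomain) :
    hamTerm μ R 1 x = -(μ ^ 4 * R ^ 2 / 2 / x.2 1 ^ 6 *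
      (1 + eccD x.2 * Real.cos (trueAnomalyD x)) ^ 3 *
      (1 - 3 / 2 * sinIncD x.2 ^ 2 +
        3 / 2 * sinIncD x.2 ^ 2 * Real.cos (2 * trueAnomalyD x + 2 * x.1 1))) := by
  obtain ⟨h1, h2⟩ := radiusD_eq hμ hx
  have h0 := hx.1
  simp only [hamTerm, h1]
  field_simp

theorem constC1_eq (hμ : 0 < μ) (hx : x ∈ overMomenta momentumDomain) :
    constC1 μ R x = μ ^ 2 * R ^ 2 / x.2 1 ^ 3 *
      ((15 * sinIncD x.2 ^ 2 - 14) / (32 * (5 * sinIncD x.2 ^ 2 - 4))) *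
      sinIncD x.2 ^ 2 * eccD x.2 ^ 2 * Real.sin (2 * x.1 1) := by
  have h0 := hx.1
  rw [constC1, paramD_eq hμ (h0.trans hx.2.1)]
  have h3 := hx.2.2.2
  field_simp

/-- The short-period part of the first-order determining function. -/
noncomputable def shortPeriodGen (μ R : ℝ) (x : Phase) : ℝ :=
  -(μ ^ 2 * R ^ 2 / 2 / x.2 1 ^ 3 *
      ((1 - 3 / 2 * sinIncD x.2 ^ 2) *
        (trueAnomalyD x - x.1 0 + eccD x.2 * Real.sin (trueAnomalyD x)) +
      3 / 4 * sinIncD x.2 ^ 2 *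
        (eccD x.2 * Real.sin (trueAnomalyD x + 2 * x.1 1) +
          Real.sin (2 * trueAnomalyD x + 2 * x.1 1) +
          eccD x.2 / 3 * Real.sin (3 * trueAnomalyD x + 2 * x.1 1))))

theorem genW1_eq (hμ : 0 < μ) (hx : x ∈ overMomenta momentumDomain) :
    genW1 μ R x = shortPeriodGen μ R x + constC1 μ R x := by
  have h0 := hx.1
  rw [genW1, paramD_eq hμ (h0.trans hx.2.1)]
  congr 2
  field_simp

theorem secular1_eq (hμ : 0 < μ) {p : Fin 3 → ℝ} (h0 : 0 < p 1) (h1 : p 1 < p 0) :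
    secular1 μ R p = -(μ ^ 4 * R ^ 2 / 2 / (p 0 ^ 3 * p 1 ^ 3) * (1 - 3 / 2 * sinIncD p ^ 2)) := by
  have h2 : 0 < p 0 := h0.trans h1
  rw [secular1, paramD_eq hμ h2, secular0, smaD, etaD]
  field_simp

end DelaunayCalculus

/-! ### Derivative formulas, smoothness and periodicity of the terms -/

section PartialDerivatives

open Set Filter Topology

variable {μ R : ℝ} {x : Phase}

/-- For directions that change only the angles: e and b stay fixed. The harmonics f + γ and 3f + γ
combine with 2f + γ into the factor 1 + e cos f in front of f'. -/
theorem hasDerivAt_shortPeriod (c e b : ℝ) {f l γ : ℝ → ℝ} {f' l' γ' t : ℝ}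
    (hf : HasDerivAt f f' t) (hl : HasDerivAt l l' t) (hγ : HasDerivAt γ γ' t) :
    HasDerivAt (fun t => -(c * ((1 - 3 / 2 * b) * (f t - l t + e * Real.sin (f t)) +
      3 / 4 * b * (e * Real.sin (f t + γ t) + Real.sin (2 * f t + γ t) +
        e / 3 * Real.sin (3 * f t + γ t)))))
      (-(c * ((1 - 3 / 2 * b) * ((1 + e * Real.cos (f t)) * f' - l') +
        3 / 2 * b * (1 + e * Real.cos (f t)) * Real.cos (2 * f t + γ t) * f' +
        b * (3 / 4 * Real.cos (2 * f t + γ t) + e * Real.cos (f t) * Real.cos (2 * f t + γ t) +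
          1 / 2 * e * Real.sin (2 * f t + γ t) * Real.sin (f t)) * γ'))) t := by
  have h := (((((hf.sub hl).add (hf.sin.const_mul e)).const_mul (1 - 3 / 2 * b)).add
    (((((hf.add hγ).sin.const_mul e).add ((hf.const_mul 2).add hγ).sin).add
      (((hf.const_mul 3).add hγ).sin.const_mul (e / 3))).const_mul (3 / 4 * b))).const_mul c).neg
  refine h.congr_deriv ?_
  simp only [Pi.add_apply]
  have e₁ : Real.cos (f t + γ t) = Real.cos (2 * f t + γ t) * Real.cos (f t) +
      Real.sin (2 * f t + γ t) * Real.sin (f t) := by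
    rw [← Real.cos_sub]; ring_nf
  have e₃ : Real.cos (3 * f t + γ t) = Real.cos (2 * f t + γ t) * Real.cos (f t) -
      Real.sin (2 * f t + γ t) * Real.sin (f t) := by
    rw [← Real.cos_add]; ring_nf
  rw [e₁, e₃]
  ring

theorem hasDerivAt_disturbing (c γ : ℝ) {e f b G : ℝ → ℝ} {e' f' b' G' t : ℝ}
    (he : HasDerivAt e e' t) (hf : HasDerivAt f f' t) (hb : HasDerivAt b b' t)
    (hG : HasDerivAt G G' t) (hG0 : G t ≠ 0) :
    HasDerivAt (fun t => -(c / G t ^ 6 * (1 + e t * Real.cos (f t)) ^ 3 *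
      (1 - 3 / 2 * b t + 3 / 2 * b t * Real.cos (2 * f t + γ))))
      (-(c / G t ^ 6 * (1 + e t * Real.cos (f t)) ^ 2 *
        (-6 * G' / G t * (1 + e t * Real.cos (f t)) *
            (1 - 3 / 2 * b t + 3 / 2 * b t * Real.cos (2 * f t + γ)) +
          3 * (e' * Real.cos (f t) - e t * Real.sin (f t) * f') *
            (1 - 3 / 2 * b t + 3 / 2 * b t * Real.cos (2 * f t + γ)) +
          (1 + e t * Real.cos (f t)) * (b' * (3 / 2 * Real.cos (2 * f t + γ) - 3 / 2) -
            3 * b t * Real.sin (2 * f t + γ) * f')))) t := by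
  have h := ((((hasDerivAt_const t c).div (hG.pow 6) (pow_ne_zero 6 hG0)).mul
    (((he.mul hf.cos).const_add 1).pow 3)).mul
    (((hb.const_mul (3 / 2)).const_sub 1).add ((hb.const_mul (3 / 2)).mul
      ((hf.const_mul 2).add_const γ).cos))).neg
  refine h.congr_deriv ?_
  simp only [Pi.mul_apply, Pi.pow_apply, Pi.add_apply, Pi.div_apply, Nat.cast_ofNat,
    Nat.reduceSub]
  field_simp
  ring

theorem contDiffAt_sinIncD {p : Fin 3 → ℝ} (h : p ∈ momentumDomain) :
    ContDiffAt ℝ ∞ sinIncD p := by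
  have h2 : p 1 ≠ 0 := h.1.ne'
  have h3 : (p 2 / p 1) ^ 2 < 1 := by
    rw [sq_lt_one_iff_abs_lt_one, abs_div, abs_of_pos h.1, div_lt_one h.1]
    exact h.2.2.1
  unfold sinIncD
  exact ContDiffAt.sqrt (by fun_prop (disch := exact h2)) (by linarith)

theorem contDiffOn_hamTerm_zero (hμ : 0 < μ) :
    ContDiffOn ℝ ∞ (hamTerm μ R 0) (overMomenta momentumDomain) := by
  intro x hx
  have h2 : 0 < x.2 0 := hx.1.trans hx.2.1
  refine ContDiffAt.contDiffWithinAt ?_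
  unfold hamTerm smaD
  fun_prop (disch := positivity)

theorem contDiffOn_hamTerm_one (hμ : 0 < μ) :
    ContDiffOn ℝ ∞ (hamTerm μ R 1) (overMomenta momentumDomain) := by
  refine ContDiffOn.congr ?_ fun x hx => hamTerm_one_eq hμ hx
  intro x hx
  have h1 : 0 < x.2 1 := hx.1
  have h2 := contDiffAt_eccD hx
  have h3 := contDiffAt_sinIncD hx
  have h4 := contDiffAt_of_overMomenta isOpen_momentumDomain contDiffOn_trueAnomalyD hx
  refine ContDiffAt.contDiffWithinAt ?_
  fun_prop (disch := positivity)

theorem contDiffOn_constC1 (hμ : 0 < μ) :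
    ContDiffOn ℝ ∞ (constC1 μ R) (overMomenta momentumDomain) := by
  refine ContDiffOn.congr ?_ fun x hx => constC1_eq hμ hx
  intro x hx
  have h1 : x.2 1 ^ 3 ≠ 0 := pow_ne_zero 3 hx.1.ne'
  have h2 := contDiffAt_eccD hx
  have h3 := contDiffAt_sinIncD hx
  have h4 : 32 * (5 * sinIncD x.2 ^ 2 - 4) ≠ 0 := mul_ne_zero (by norm_num) hx.2.2.2
  refine ContDiffAt.contDiffWithinAt ?_
  fun_prop (disch := assumption)

theorem contDiffOn_shortPeriodGen :
    ContDiffOn ℝ ∞ (shortPeriodGen μ R) (overMomenta momentumDomain) := by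
  intro x hx
  have h1 : 0 < x.2 1 := hx.1
  have h2 := contDiffAt_eccD hx
  have h3 := contDiffAt_sinIncD hx
  have h4 := contDiffAt_of_overMomenta isOpen_momentumDomain contDiffOn_trueAnomalyD hx
  refine ContDiffAt.contDiffWithinAt ?_
  unfold shortPeriodGen
  fun_prop (disch := positivity)

theorem contDiffOn_genW1 (hμ : 0 < μ) :
    ContDiffOn ℝ ∞ (genW1 μ R) (overMomenta momentumDomain) :=
  (contDiffOn_shortPeriodGen.add (contDiffOn_constC1 hμ)).congr fun _ hx => genW1_eq hμ hx

theorem contDiffOn_secular1 (hμ : 0 < μ) :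
    ContDiffOn ℝ ∞ (fun x : Phase => secular1 μ R x.2) (overMomenta momentumDomain) := by
  refine ContDiffOn.congr ?_ fun x hx => secular1_eq hμ hx.1 hx.2.1
  intro x hx
  have h1 : 0 < x.2 1 := hx.1
  have h2 : 0 < x.2 0 := hx.1.trans hx.2.1
  have h3 := contDiffAt_sinIncD hx
  refine ContDiffAt.contDiffWithinAt ?_
  fun_prop (disch := positivity)

theorem contDiffOn_secular2 (hμ : 0 < μ) :
    ContDiffOn ℝ ∞ (fun x : Phase => secular2 μ R x.2) (overMomenta momentumDomain) := by
  intro x hx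
  have h1 : 0 < x.2 1 := hx.1
  have h2 : 0 < x.2 0 := hx.1.trans hx.2.1
  have h3 := contDiffAt_sinIncD hx
  refine ContDiffAt.contDiffWithinAt ?_
  unfold secular2 secular0 paramD smaD etaD
  fun_prop (disch := positivity)

/-- A function whose derivative with respect to the mean anomaly is a multiple of that of the true
anomaly by a trigonometric sum, up to a function of the other variables. -/
noncomputable def anomalyGen (c : ℝ) (n : ℕ) (l : ℝ → ℝ → List (ℝ × ℤ × ℤ)) (m : ℝ → ℝ → ℝ → ℝ)
    (x : Phase) : ℝ :=
  c / x.2 1 ^ n * (sinSum (l (eccD x.2) (sinIncD x.2 ^ 2)) (trueAnomalyD x) (2 * x.1 1) +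
    m (eccD x.2) (sinIncD x.2 ^ 2) (2 * x.1 1) * (trueAnomalyD x - x.1 0))

theorem contDiffOn_anomalyGen_square (c : ℝ) (n : ℕ) :
    ContDiffOn ℝ ∞ (anomalyGen c n squareTerms squareMean) (overMomenta momentumDomain) := by
  intro x hx
  have h1 : 0 < x.2 1 := hx.1
  have h2 := contDiffAt_eccD hx
  have h3 := contDiffAt_sinIncD hx
  have h4 := contDiffAt_of_overMomenta isOpen_momentumDomain contDiffOn_trueAnomalyD hx
  have h5 : ContDiffAt ℝ ∞ (fun x : Phase => sinSum (squareTerms (eccD x.2) (sinIncD x.2 ^ 2))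
      (trueAnomalyD x) (2 * x.1 1)) x :=
    ContDiffAt.comp x (f := fun x : Phase =>
      (eccD x.2, sinIncD x.2 ^ 2, trueAnomalyD x, 2 * x.1 1))
      contDiff_sinSum_squareTerms.contDiffAt (by fun_prop)
  refine ContDiffAt.contDiffWithinAt ?_
  unfold anomalyGen
  refine ContDiffAt.mul (by fun_prop (disch := positivity)) (h5.add ?_)
  unfold squareMean
  fun_prop

theorem contDiffOn_anomalyGen_mixed (c : ℝ) (n : ℕ) :
    ContDiffOn ℝ ∞ (anomalyGen c n mixedTerms mixedMean) (overMomenta momentumDomain) := by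
  intro x hx
  have h1 : 0 < x.2 1 := hx.1
  have h2 := contDiffAt_eccD hx
  have h3 := contDiffAt_sinIncD hx
  have h4 := contDiffAt_of_overMomenta isOpen_momentumDomain contDiffOn_trueAnomalyD hx
  have h5 : ContDiffAt ℝ ∞ (fun x : Phase => sinSum (mixedTerms (eccD x.2) (sinIncD x.2 ^ 2))
      (trueAnomalyD x) (2 * x.1 1)) x :=
    ContDiffAt.comp x (f := fun x : Phase =>
      (eccD x.2, sinIncD x.2 ^ 2, trueAnomalyD x, 2 * x.1 1))
      (contDiffAt_sinSum_mixedTerms (eccD_pos hx.1 hx.2.1).ne') (by fun_prop)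
  refine ContDiffAt.contDiffWithinAt ?_
  unfold anomalyGen
  refine ContDiffAt.mul (by fun_prop (disch := positivity)) (h5.add ?_)
  unfold mixedMean
  fun_prop

/-! #### Periodicity -/

theorem eccentricAnomaly_add_two_pi {e : ℝ} (h0 : 0 ≤ e) (h1 : e < 1) (l : ℝ) (k : ℤ) :
    eccentricAnomaly e (l + 2 * Real.pi * k) = eccentricAnomaly e l + 2 * Real.pi * k := by
  symm
  rw [eccentricAnomaly_iff h0 h1, mul_comm (2 * Real.pi), Real.sin_add_int_mul_two_pi]
  have := (eccentricAnomaly_iff h0 h1 l _).mp rfl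
  linarith

/-- Since f advances by a full turn with ℓ, the difference f - ℓ is periodic and may appear in W₁
and in `anomalyGen`. -/
theorem trueAnomaly_add_two_pi {e : ℝ} (h0 : 0 ≤ e) (h1 : e < 1) (l : ℝ) (k : ℤ) :
    trueAnomaly e (l + 2 * Real.pi * k) = trueAnomaly e l + 2 * Real.pi * k := by
  unfold trueAnomaly
  rw [eccentricAnomaly_add_two_pi h0 h1]
  rw [mul_comm (2 * Real.pi) (k : ℝ), Real.sin_add_int_mul_two_pi, Real.cos_add_int_mul_two_pi]
  ring

theorem trueAnomalyD_shiftAngles (hx : x ∈ overMomenta momentumDomain) (k : Fin 3 → ℤ) :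
    trueAnomalyD (shiftAngles k x) = trueAnomalyD x + 2 * Real.pi * k 0 :=
  trueAnomaly_add_two_pi (eccD_pos hx.1 hx.2.1).le (eccD_lt_one hx.1 hx.2.1) _ _

theorem sin_mul_add_two_pi (m n i j : ℤ) (f g : ℝ) :
    Real.sin (m * (f + 2 * Real.pi * i) + n * (g + 2 * Real.pi * j)) =
      Real.sin (m * f + n * g) := by
  rw [show (m : ℝ) * (f + 2 * Real.pi * i) + n * (g + 2 * Real.pi * j) =
    m * f + n * g + ((m * i + n * j : ℤ) : ℝ) * (2 * Real.pi) by push_cast; ring,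
    Real.sin_add_int_mul_two_pi]

theorem cos_mul_add_two_pi (m n i j : ℤ) (f g : ℝ) :
    Real.cos (m * (f + 2 * Real.pi * i) + n * (g + 2 * Real.pi * j)) =
      Real.cos (m * f + n * g) := by
  rw [show (m : ℝ) * (f + 2 * Real.pi * i) + n * (g + 2 * Real.pi * j) =
    m * f + n * g + ((m * i + n * j : ℤ) : ℝ) * (2 * Real.pi) by push_cast; ring,
    Real.cos_add_int_mul_two_pi]

theorem constC1_periodic : IsAnglePeriodicOn (constC1 μ R) (overMomenta momentumDomain) := by
  intro x _ k
  have h := sin_mul_add_two_pi 0 2 0 (k 1) 0 (x.1 1)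
  norm_num at h
  simp only [constC1, shiftAngles, h]

theorem genW1_periodic : IsAnglePeriodicOn (genW1 μ R) (overMomenta momentumDomain) := by
  intro x hx k
  have hs := fun m n => sin_mul_add_two_pi m n (k 0) (k 1) (trueAnomalyD x) (x.1 1)
  have h0 := hs 1 0
  have h1 := hs 1 2
  have h2 := hs 2 2
  have h3 := hs 3 2
  norm_num at h0 h1 h2 h3
  simp only [genW1, constC1_periodic x hx k, trueAnomalyD_shiftAngles hx, shiftAngles_snd]
  simp only [shiftAngles, h0, h1, h2, h3, add_sub_add_right_eq_sub]

theorem hamTerm_one_periodic (hμ : 0 < μ) :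
    IsAnglePeriodicOn (hamTerm μ R 1) (overMomenta momentumDomain) := by
  intro x hx k
  have hs := fun m n => cos_mul_add_two_pi m n (k 0) (k 1) (trueAnomalyD x) (x.1 1)
  have h0 := hs 1 0
  have h2 := hs 2 2
  norm_num at h0 h2
  rw [hamTerm_one_eq hμ hx, hamTerm_one_eq hμ ((shiftAngles_mem_iff k x).mpr hx)]
  simp only [trueAnomalyD_shiftAngles hx, shiftAngles_snd]
  simp only [shiftAngles, h0, h2]

theorem anomalyGen_periodic {c : ℝ} {n : ℕ} {l : ℝ → ℝ → List (ℝ × ℤ × ℤ)}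
    {m : ℝ → ℝ → ℝ → ℝ}
    (hm : ∀ (e b g : ℝ) (j : ℤ), m e b (2 * (g + 2 * Real.pi * j)) = m e b (2 * g)) :
    IsAnglePeriodicOn (anomalyGen c n l m) (overMomenta momentumDomain) := by
  intro x hx k
  have h := sinSum_add_two_pi (l (eccD x.2) (sinIncD x.2 ^ 2)) (trueAnomalyD x) (2 * x.1 1) (k 0)
    (k 1)
  simp only [anomalyGen, trueAnomalyD_shiftAngles hx, shiftAngles_snd]
  simp only [shiftAngles, hm, add_sub_add_right_eq_sub]
  rw [mul_add 2 (x.1 1), h]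

theorem squareMean_periodic (e b g : ℝ) (j : ℤ) :
    squareMean e b (2 * (g + 2 * Real.pi * j)) = squareMean e b (2 * g) := by
  have h2 := cos_mul_add_two_pi 0 2 0 j 0 g
  have h4 := cos_mul_add_two_pi 0 4 0 j 0 g
  norm_num at h2 h4
  simp only [squareMean, h2, ← mul_assoc]
  norm_num only [h4]

theorem mixedMean_periodic (e b g : ℝ) (j : ℤ) :
    mixedMean e b (2 * (g + 2 * Real.pi * j)) = mixedMean e b (2 * g) := by
  have h2 := cos_mul_add_two_pi 0 2 0 j 0 g
  have h4 := cos_mul_add_two_pi 0 4 0 j 0 g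
  norm_num at h2 h4
  simp only [mixedMean, h2, ← mul_assoc]
  norm_num only [h4]

end PartialDerivatives

/-! ### Explicit partial derivatives and the first-order homological equation -/

section PartialDerivativeValues

open Set Filter Topology

variable {μ R : ℝ} {x : Phase}

theorem dCoord_apply_of_eq_add {F F₁ F₂ : Phase → ℝ}
    (h : ∀ y ∈ overMomenta momentumDomain, F y = F₁ y + F₂ y)
    (h₁ : ContDiffOn ℝ ∞ F₁ (overMomenta momentumDomain))
    (h₂ : ContDiffOn ℝ ∞ F₂ (overMomenta momentumDomain))
    (hx : x ∈ overMomenta momentumDomain) (i : Fin 3) :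
    dCoord i F x = dCoord i F₁ x + dCoord i F₂ x := by
  have d₁ := differentiableAt_of_overMomenta isOpen_momentumDomain h₁ hx
  have d₂ := differentiableAt_of_overMomenta isOpen_momentumDomain h₂ hx
  simp only [dCoord]
  rw [fderiv_congr_overMomenta isOpen_momentumDomain h hx, fderiv_fun_add d₁ d₂]
  rfl

theorem fderiv_shortPeriodGen_coord (hx : x ∈ overMomenta momentumDomain) (w : Fin 3 → ℝ) :
    fderiv ℝ (shortPeriodGen μ R) x (w, 0) =
      -(μ ^ 2 * R ^ 2 / 2 / x.2 1 ^ 3 * ((1 - 3 / 2 * sinIncD x.2 ^ 2) *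
          ((1 + eccD x.2 * Real.cos (trueAnomalyD x)) *
            ((1 + eccD x.2 * Real.cos (trueAnomalyD x)) ^ 2 * (x.2 0 / x.2 1) ^ 3 * w 0) - w 0) +
        3 / 2 * sinIncD x.2 ^ 2 * (1 + eccD x.2 * Real.cos (trueAnomalyD x)) *
          Real.cos (2 * trueAnomalyD x + 2 * x.1 1) *
            ((1 + eccD x.2 * Real.cos (trueAnomalyD x)) ^ 2 * (x.2 0 / x.2 1) ^ 3 * w 0) +
        sinIncD x.2 ^ 2 * (3 / 4 * Real.cos (2 * trueAnomalyD x + 2 * x.1 1) +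
          eccD x.2 * Real.cos (trueAnomalyD x) * Real.cos (2 * trueAnomalyD x + 2 * x.1 1) +
          1 / 2 * eccD x.2 * Real.sin (2 * trueAnomalyD x + 2 * x.1 1) *
            Real.sin (trueAnomalyD x)) * (2 * w 1))) := by
  refine fderiv_apply_eq_of_hasDerivAt_line
    (differentiableAt_of_overMomenta isOpen_momentumDomain contDiffOn_shortPeriodGen hx) ?_
  have h := hasDerivAt_shortPeriod (μ ^ 2 * R ^ 2 / 2 / x.2 1 ^ 3) (eccD x.2) (sinIncD x.2 ^ 2)
    (hasDerivAt_trueAnomalyD_line hx (w, 0)) (hasDerivAt_coord_line x (w, 0) 0)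
    ((hasDerivAt_coord_line x (w, 0) 1).const_mul 2)
  simp only [zero_smul, add_zero, Pi.zero_apply, zero_div, sub_zero, mul_zero] at h
  simpa only [shortPeriodGen, Prod.snd_add, Prod.smul_snd, smul_zero, add_zero] using h

theorem fderiv_constC1_coord (hμ : 0 < μ) (hx : x ∈ overMomenta momentumDomain)
    (w : Fin 3 → ℝ) :
    fderiv ℝ (constC1 μ R) x (w, 0) = μ ^ 2 * R ^ 2 / 2 / x.2 1 ^ 3 *
      ((15 * sinIncD x.2 ^ 2 - 14) / (8 * (5 * sinIncD x.2 ^ 2 - 4))) *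
      sinIncD x.2 ^ 2 * eccD x.2 ^ 2 * Real.cos (2 * x.1 1) * w 1 := by
  refine fderiv_apply_eq_of_hasDerivAt_line
    (differentiableAt_of_overMomenta isOpen_momentumDomain (contDiffOn_constC1 hμ) hx) ?_
  have h := ((hasDerivAt_coord_line x (w, 0) 1).const_mul 2).sin.const_mul
    (x.2 1 * (R ^ 2 / paramD μ x.2 ^ 2) *
    ((15 * sinIncD x.2 ^ 2 - 14) / (32 * (5 * sinIncD x.2 ^ 2 - 4))) *
    sinIncD x.2 ^ 2 * eccD x.2 ^ 2)
  simp only [zero_smul, add_zero] at h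
  simp only [constC1, Prod.snd_add, Prod.smul_snd, smul_zero, add_zero]
  refine h.congr_deriv ?_
  have h0 := hx.1
  have h3 := hx.2.2.2
  rw [paramD_eq hμ (h0.trans hx.2.1)]
  field_simp
  ring

theorem dCoord_zero_constC1 (hμ : 0 < μ) (hx : x ∈ overMomenta momentumDomain) :
    dCoord 0 (constC1 μ R) x = 0 := by
  rw [dCoord, fderiv_constC1_coord hμ hx]
  simp

/-- The homological equation of the first order. -/
theorem dCoord_zero_genW1 (hμ : 0 < μ) (hx : x ∈ overMomenta momentumDomain) :
    dCoord 0 (genW1 μ R) x = (hamTerm μ R 1 x - secular1 μ R x.2) / meanMotionD μ x.2 := by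
  rw [dCoord_apply_of_eq_add (fun y hy => genW1_eq hμ hy) contDiffOn_shortPeriodGen
    (contDiffOn_constC1 hμ) hx, dCoord_zero_constC1 hμ hx, dCoord,
    fderiv_shortPeriodGen_coord hx, hamTerm_one_eq hμ hx, secular1_eq hμ hx.1 hx.2.1, meanMotionD]
  have h0 : 0 < x.2 1 := hx.1
  have h1 : 0 < x.2 0 := hx.1.trans hx.2.1
  simp only [Pi.single_eq_same, Pi.single_apply, Fin.reduceEq, if_false]
  field_simp
  ring

theorem meanMotionD_pos (hμ : 0 < μ) (hx : x ∈ overMomenta momentumDomain) :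
    0 < meanMotionD μ x.2 := by
  have h1 : 0 < x.2 0 := hx.1.trans hx.2.1
  unfold meanMotionD
  positivity

/-- The factor (1 + e cos f)² is kept in front because it is the f-dependent part of ∂f/∂ℓ; the rest
is left in the shape of `cosSum_mixedTerms`. -/
theorem dMom_one_hamTerm_one (hμ : 0 < μ) (hx : x ∈ overMomenta momentumDomain) :
    dMom 1 (hamTerm μ R 1) x = μ ^ 4 * R ^ 2 / 2 / x.2 1 ^ 7 *
      (1 + eccD x.2 * Real.cos (trueAnomalyD x)) ^ 2 *
      (6 * (1 + eccD x.2 * Real.cos (trueAnomalyD x)) * (1 - 3 / 2 * sinIncD x.2 ^ 2 +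
          3 / 2 * sinIncD x.2 ^ 2 * Real.cos (2 * trueAnomalyD x + 2 * x.1 1)) +
        (3 * (1 - 3 / 2 * sinIncD x.2 ^ 2 +
            3 / 2 * sinIncD x.2 ^ 2 * Real.cos (2 * trueAnomalyD x + 2 * x.1 1)) *
            ((1 - eccD x.2 ^ 2) * Real.cos (trueAnomalyD x) / eccD x.2 -
              Real.sin (trueAnomalyD x) ^ 2 * (2 + eccD x.2 * Real.cos (trueAnomalyD x))) +
          (1 + eccD x.2 * Real.cos (trueAnomalyD x)) *
            (-3 * sinIncD x.2 ^ 2 * Real.sin (2 * trueAnomalyD x + 2 * x.1 1)) *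
            Real.sin (trueAnomalyD x) * (2 + eccD x.2 * Real.cos (trueAnomalyD x)) / eccD x.2) -
        (1 + eccD x.2 * Real.cos (trueAnomalyD x)) * (2 * (1 - sinIncD x.2 ^ 2) *
          (3 / 2 * Real.cos (2 * trueAnomalyD x + 2 * x.1 1) - 3 / 2))) := by
  have h0 : 0 < x.2 1 := hx.1
  have he := eccD_pos hx.1 hx.2.1
  rw [dMom, fderiv_congr_overMomenta isOpen_momentumDomain (fun y hy => hamTerm_one_eq hμ hy) hx]
  refine fderiv_apply_eq_of_hasDerivAt_line
    (differentiableAt_of_overMomenta isOpen_momentumDomain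
      ((contDiffOn_hamTerm_one hμ).congr fun y hy => (hamTerm_one_eq hμ hy).symm) hx) ?_
  have h := hasDerivAt_disturbing (μ ^ 4 * R ^ 2 / 2) (2 * x.1 1)
    (hasDerivAt_eccD_line hx (0, Pi.single 1 1)) (hasDerivAt_trueAnomalyD_line hx (0, Pi.single 1 1))
    (hasDerivAt_sinIncD_sq_line hx (v := (0, Pi.single 1 1)) (by simp))
    (hasDerivAt_mom_line x (0, Pi.single 1 1) 1) (by simpa using h0.ne')
  simp only [zero_smul, add_zero] at h
  simp only [Prod.fst_add, Prod.smul_fst, smul_zero, add_zero]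
  refine h.congr_deriv ?_
  simp only [Pi.single_eq_same, Pi.single_apply, Fin.reduceEq, if_false, Pi.zero_apply]
  generalize Real.cos (2 * trueAnomalyD x + 2 * x.1 1) = C
  generalize Real.sin (2 * trueAnomalyD x + 2 * x.1 1) = S
  generalize Real.cos (trueAnomalyD x) = c
  generalize Real.sin (trueAnomalyD x) = s
  field_simp
  ring

/-- The product of the derivatives along the perigee, expressed by `mixedTerms`. -/
theorem dMom_one_hamTerm_mul (hμ : 0 < μ) (hx : x ∈ overMomenta momentumDomain) :
    -2 * dMom 1 (hamTerm μ R 1) x * dCoord 1 (shortPeriodGen μ R) x =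
      meanMotionD μ x.2 * (μ ^ 4 * R ^ 4 / 4 / x.2 1 ^ 7) *
      ((cosSum (mixedTerms (eccD x.2) (sinIncD x.2 ^ 2)) (trueAnomalyD x) (2 * x.1 1) +
        mixedMean (eccD x.2) (sinIncD x.2 ^ 2) (2 * x.1 1)) *
        ((1 + eccD x.2 * Real.cos (trueAnomalyD x)) ^ 2 * (x.2 0 / x.2 1) ^ 3)) := by
  have h0 : 0 < x.2 1 := hx.1
  have h1 : 0 < x.2 0 := hx.1.trans hx.2.1
  have he := eccD_pos hx.1 hx.2.1
  rw [dMom_one_hamTerm_one hμ hx, cosSum_mixedTerms he.ne', dCoord, fderiv_shortPeriodGen_coord hx,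
    meanMotionD]
  simp only [Pi.single_eq_same, Pi.single_apply, Fin.reduceEq, if_false, mul_zero, sub_zero,
    zero_add]
  -- The long bracket occurs literally on both sides, so only prefactors have to be compared.
  generalize 6 * (1 + eccD x.2 * Real.cos (trueAnomalyD x)) * _ + _ - _ = X
  field_simp
  ring

/-- The factor 5 s² - 4 in the G-derivative is that of the first-order drift of the perigee; it
reappears as the divisor of C₁. -/
theorem fderiv_secular1_mom (hμ : 0 < μ) (hx : x ∈ overMomenta momentumDomain) {w : Fin 3 → ℝ}
    (hw : w 2 = 0) :
    fderiv ℝ (fun y : Phase => secular1 μ R y.2) x (0, w) =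
      -3 / x.2 0 * secular1 μ R x.2 * w 0 -
        μ ^ 4 * R ^ 2 / 2 / (x.2 0 ^ 3 * x.2 1 ^ 4) * (3 / 2) * (5 * sinIncD x.2 ^ 2 - 4) * w 1 := by
  have h0 : 0 < x.2 1 := hx.1
  have h1 : 0 < x.2 0 := hx.1.trans hx.2.1
  rw [fderiv_congr_overMomenta isOpen_momentumDomain
    (fun y hy => secular1_eq (R := R) hμ hy.1 hy.2.1) hx]
  refine fderiv_apply_eq_of_hasDerivAt_line (differentiableAt_of_overMomenta isOpen_momentumDomain
    ((contDiffOn_secular1 hμ).congr fun y hy => (secular1_eq hμ hy.1 hy.2.1).symm) hx) ?_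
  have h := ((((hasDerivAt_const (0 : ℝ) (μ ^ 4 * R ^ 2 / 2)).div
    (((hasDerivAt_mom_line x (0, w) 0).pow 3).mul ((hasDerivAt_mom_line x (0, w) 1).pow 3))
    (by simp [h0.ne', h1.ne'])).mul
    (((hasDerivAt_sinIncD_sq_line hx (v := (0, w)) hw).const_mul (3 / 2)).const_sub 1))).neg
  refine h.congr_deriv ?_
  simp only [Pi.mul_apply, Pi.pow_apply, Pi.div_apply, zero_smul, add_zero, Nat.cast_ofNat,
    Nat.reduceSub, secular1_eq hμ hx.1 hx.2.1]
  field_simp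
  ring

/-- Differentiating m (f - ℓ) gives m ∂f/∂ℓ - m: the first part completes the oscillating sum to the
full polynomial, the second subtracts its average. -/
theorem dCoord_zero_anomalyGen {c : ℝ} {n : ℕ} {l : ℝ → ℝ → List (ℝ × ℤ × ℤ)}
    {m : ℝ → ℝ → ℝ → ℝ}
    (hd : ContDiffOn ℝ ∞ (anomalyGen c n l m) (overMomenta momentumDomain))
    (hx : x ∈ overMomenta momentumDomain) :
    dCoord 0 (anomalyGen c n l m) x = c / x.2 1 ^ n *
      ((cosSum (l (eccD x.2) (sinIncD x.2 ^ 2)) (trueAnomalyD x) (2 * x.1 1) +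
        m (eccD x.2) (sinIncD x.2 ^ 2) (2 * x.1 1)) *
        ((1 + eccD x.2 * Real.cos (trueAnomalyD x)) ^ 2 * (x.2 0 / x.2 1) ^ 3) -
        m (eccD x.2) (sinIncD x.2 ^ 2) (2 * x.1 1)) := by
  refine fderiv_apply_eq_of_hasDerivAt_line
    (differentiableAt_of_overMomenta isOpen_momentumDomain hd hx) ?_
  have hf := hasDerivAt_trueAnomalyD_line hx (Pi.single 0 1, 0)
  have h := ((hasDerivAt_sinSum (l (eccD x.2) (sinIncD x.2 ^ 2)) (2 * x.1 1) hf).add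
    ((hf.sub (hasDerivAt_coord_line x (Pi.single 0 1, 0) 0)).const_mul
      (m (eccD x.2) (sinIncD x.2 ^ 2) (2 * x.1 1)))).const_mul (c / x.2 1 ^ n)
  simp only [zero_smul, add_zero, Pi.zero_apply, zero_div, sub_zero, mul_zero, Pi.single_eq_same,
    mul_one] at h
  have hfun : (fun t : ℝ => anomalyGen c n l m (x + t • (Pi.single 0 1, 0))) = fun t =>
      c / x.2 1 ^ n * (sinSum (l (eccD x.2) (sinIncD x.2 ^ 2))
        (trueAnomalyD (x + t • (Pi.single 0 1, 0))) (2 * x.1 1) +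
        m (eccD x.2) (sinIncD x.2 ^ 2) (2 * x.1 1) *
          (trueAnomalyD (x + t • (Pi.single 0 1, 0)) - (x + t • (Pi.single 0 1, 0) : Phase).1 0)) := by
    funext t
    simp [anomalyGen]
  rw [hfun]
  refine h.congr_deriv ?_
  ring

theorem dCoord_two_eq_zero {F : Phase → ℝ}
    (hF : ContDiffOn ℝ ∞ F (overMomenta momentumDomain)) (hx : x ∈ overMomenta momentumDomain)
    (h : ∀ t : ℝ, F (x + t • (Pi.single 2 1, 0)) = F x) : dCoord 2 F x = 0 :=
  fderiv_apply_eq_zero_of_line (differentiableAt_of_overMomenta isOpen_momentumDomain hF hx) h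

theorem dCoord_two_hamTerm_one (hμ : 0 < μ) (hx : x ∈ overMomenta momentumDomain) :
    dCoord 2 (hamTerm μ R 1) x = 0 :=
  dCoord_two_eq_zero (contDiffOn_hamTerm_one hμ) hx fun t => by
    simp [hamTerm, radiusD, trueAnomalyD]

theorem dCoord_two_genW1 (hμ : 0 < μ) (hx : x ∈ overMomenta momentumDomain) :
    dCoord 2 (genW1 μ R) x = 0 :=
  dCoord_two_eq_zero (contDiffOn_genW1 hμ) hx fun t => by
    simp [genW1, constC1, trueAnomalyD]

theorem dCoord_secular (S : (Fin 3 → ℝ) → ℝ)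
    (hS : ContDiffOn ℝ ∞ (fun y : Phase => S y.2) (overMomenta momentumDomain))
    (hx : x ∈ overMomenta momentumDomain) (i : Fin 3) : dCoord i (fun y => S y.2) x = 0 :=
  fderiv_apply_eq_zero_of_line (differentiableAt_of_overMomenta isOpen_momentumDomain hS hx)
    fun t => by simp

/-- H_{0,0} depends on L alone and its L-derivative is n, so each homological equation is an
equation for ∂/∂ℓ. -/
theorem poisson_hamTerm_zero (hμ : 0 < μ) (hx : x ∈ overMomenta momentumDomain) (F : Phase → ℝ) :
    poisson (hamTerm μ R 0) F x = -(meanMotionD μ x.2 * dCoord 0 F x) := by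
  have h1 : 0 < x.2 0 := hx.1.trans hx.2.1
  have hd := differentiableAt_of_overMomenta isOpen_momentumDomain
    (contDiffOn_hamTerm_zero (R := R) hμ) hx
  have hm : ∀ w : Fin 3 → ℝ, fderiv ℝ (hamTerm μ R 0) x (0, w) = meanMotionD μ x.2 * w 0 := by
    intro w
    refine fderiv_apply_eq_of_hasDerivAt_line hd ?_
    have h := (hasDerivAt_const (0 : ℝ) (-μ)).div
      ((((hasDerivAt_mom_line x (0, w) 0).pow 2).div_const μ).const_mul 2)
      (by simp [h1.ne', hμ.ne'])
    refine h.congr_deriv ?_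
    simp only [Pi.pow_apply, zero_smul, add_zero, Nat.cast_ofNat, Nat.reduceSub, meanMotionD]
    field_simp
    ring
  have hc : ∀ i, dCoord i (hamTerm μ R 0) x = 0 := fun i =>
    fderiv_apply_eq_zero_of_line hd fun t => by simp [hamTerm]
  simp only [poisson, Fin.sum_univ_three, hc, dMom, hm]
  simp

end PartialDerivativeValues

/-! ### The second-order generator in closed form -/

section SecondOrder

open Set Filter Topology

variable {μ R : ℝ} {x : Phase}

theorem hasDerivAt_inv_meanMotionD_line (hμ : 0 < μ) (hx : x ∈ overMomenta momentumDomain)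
    (v : Phase) :
    HasDerivAt (fun t : ℝ => (meanMotionD μ (x + t • v).2)⁻¹)
      (3 / x.2 0 * v.2 0 * (meanMotionD μ x.2)⁻¹) 0 := by
  have h1 : 0 < x.2 0 := hx.1.trans hx.2.1
  have h := ((hasDerivAt_mom_line x v 0).pow 3).div_const (μ ^ 2)
  simp only [meanMotionD, inv_div]
  refine h.congr_deriv ?_
  simp only [zero_smul, add_zero, Nat.cast_ofNat, Nat.reduceSub]
  field_simp

/-- The mixed derivatives of the first-order determining function that involve the mean anomaly. -/
theorem dCoord_zero_fderiv_genW1 (hμ : 0 < μ) (hx : x ∈ overMomenta momentumDomain) (v : Phase) :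
    dCoord 0 (fun y => fderiv ℝ (genW1 μ R) y v) x =
      (fderiv ℝ (hamTerm μ R 1) x v - fderiv ℝ (fun y : Phase => secular1 μ R y.2) x v) *
          (meanMotionD μ x.2)⁻¹ +
        (hamTerm μ R 1 x - secular1 μ R x.2) * (3 / x.2 0 * v.2 0 * (meanMotionD μ x.2)⁻¹) := by
  have hW := contDiffOn_genW1 (R := R) hμ
  have hd := hW.dCoord isOpen_momentumDomain 0
  have hH := differentiableAt_of_overMomenta isOpen_momentumDomain
    (contDiffOn_hamTerm_one (R := R) hμ) hx
  have hS := differentiableAt_of_overMomenta isOpen_momentumDomain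
    (contDiffOn_secular1 (R := R) hμ) hx
  have heq : ∀ y ∈ overMomenta momentumDomain, dCoord 0 (genW1 μ R) y =
      (hamTerm μ R 1 y - secular1 μ R y.2) * (meanMotionD μ y.2)⁻¹ := fun y hy => by
    rw [dCoord_zero_genW1 hμ hy, div_eq_mul_inv]
  -- The ℓ-derivative is moved inside, onto W₁, where the first-order homological equation replaces
  -- it by (H - S)/n.
  have hcd := fderiv_fderiv_comm isOpen_momentumDomain hW hx v (Pi.single 0 1, 0)
  refine hcd.trans ?_
  change fderiv ℝ (dCoord 0 (genW1 μ R)) x v = _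
  rw [fderiv_congr_overMomenta isOpen_momentumDomain heq hx]
  refine fderiv_apply_eq_of_hasDerivAt_line (differentiableAt_of_overMomenta isOpen_momentumDomain
    (hd.congr fun y hy => (heq y hy).symm) hx) ?_
  have h := ((hasDerivAt_line hH v).sub (hasDerivAt_line hS v)).mul
    (hasDerivAt_inv_meanMotionD_line hμ hx v)
  refine h.congr_deriv ?_
  simp

/-- The derivative of the average `squareMean` with respect to the momentum `L`. -/
noncomputable def squareMeanDeriv (e b γ : ℝ) : ℝ :=
  (1 - e ^ 2) * (6 - 18 * b + 81 / 4 * b ^ 2 + 3 / 2 * e ^ 2 - 9 / 2 * b * e ^ 2 +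
    81 / 16 * b ^ 2 * e ^ 2 + (9 * b - 27 / 2 * b ^ 2 + 3 * b * e ^ 2 - 9 / 2 * b ^ 2 * e ^ 2) *
      Real.cos γ + 9 / 32 * b ^ 2 * e ^ 2 * Real.cos (2 * γ))

/-- The assumed form (1 - e²)/e · c is the variation of e along L, with c = 1/L. The mean is even in
e, so the 1/e cancels. -/
theorem hasDerivAt_squareMean (b γ : ℝ) {e : ℝ → ℝ} {c t : ℝ} (h0 : e t ≠ 0)
    (he : HasDerivAt e ((1 - e t ^ 2) / e t * c) t) :
    HasDerivAt (fun s => squareMean (e s) b γ) (squareMeanDeriv (e t) b γ * c) t := by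
  unfold squareMean squareMeanDeriv
  have h2 := he.pow 2
  have h4 := he.pow 4
  have h := (((((h2.const_mul (3 - 9 * b + 81 / 8 * b ^ 2))).add
    (h4.const_mul (3 / 8 - 9 / 8 * b + 81 / 64 * b ^ 2))).add
    ((((h2.const_mul (9 / 2 * b - 27 / 4 * b ^ 2))).add
      (h4.const_mul (3 / 4 * b - 9 / 8 * b ^ 2))).mul_const (Real.cos γ))).add
    ((h4.const_mul (9 / 128 * b ^ 2)).mul_const (Real.cos (2 * γ)))).const_add
      (1 - 3 * b + 27 / 8 * b ^ 2)
  refine (h.congr_deriv ?_).congr_of_eventuallyEq (Eventually.of_forall fun s => ?_)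
  · push_cast
    field_simp
    ring
  · simp only [Pi.pow_apply, Pi.add_apply]
    ring

/-- The function whose derivative with respect to the mean anomaly is the oscillating part of the
square of the disturbing function. -/
noncomputable def squareGen (μ R : ℝ) : Phase → ℝ :=
  anomalyGen (μ ^ 6 * R ^ 4 / 4) 9 squareTerms squareMean

theorem dCoord_zero_squareGen (hμ : 0 < μ) (hx : x ∈ overMomenta momentumDomain) :
    dCoord 0 (squareGen μ R) x = hamTerm μ R 1 x ^ 2 * (meanMotionD μ x.2)⁻¹ -
      μ ^ 6 * R ^ 4 / 4 / x.2 1 ^ 9 *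
        squareMean (eccD x.2) (sinIncD x.2 ^ 2) (2 * x.1 1) := by
  have h0 : 0 < x.2 1 := hx.1
  have h1 : 0 < x.2 0 := hx.1.trans hx.2.1
  rw [squareGen, dCoord_zero_anomalyGen (contDiffOn_anomalyGen_square _ _) hx, cosSum_squareTerms,
    hamTerm_one_eq hμ hx, meanMotionD]
  field_simp
  ring

theorem dCoord_zero_dMom_zero_squareGen (hμ : 0 < μ) (hx : x ∈ overMomenta momentumDomain) :
    dCoord 0 (dMom 0 (squareGen μ R)) x =
      2 * hamTerm μ R 1 x * dMom 0 (hamTerm μ R 1) x * (meanMotionD μ x.2)⁻¹ +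
        hamTerm μ R 1 x ^ 2 * (3 / x.2 0 * (meanMotionD μ x.2)⁻¹) -
      μ ^ 6 * R ^ 4 / 4 / x.2 1 ^ 9 *
        (squareMeanDeriv (eccD x.2) (sinIncD x.2 ^ 2) (2 * x.1 1) / x.2 0) := by
  have hA : ContDiffOn ℝ ∞ (squareGen μ R) (overMomenta momentumDomain) :=
    contDiffOn_anomalyGen_square _ _
  have hd := hA.dCoord isOpen_momentumDomain 0
  have hH := differentiableAt_of_overMomenta isOpen_momentumDomain
    (contDiffOn_hamTerm_one (R := R) hμ) hx
  have he := eccD_pos hx.1 hx.2.1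
  have hcd := fderiv_fderiv_comm isOpen_momentumDomain hA hx (0, Pi.single 0 1) (Pi.single 0 1, 0)
  refine hcd.trans ?_
  change fderiv ℝ (dCoord 0 (squareGen μ R)) x _ = _
  rw [fderiv_congr_overMomenta isOpen_momentumDomain
    (fun y hy => dCoord_zero_squareGen hμ hy) hx]
  refine fderiv_apply_eq_of_hasDerivAt_line (differentiableAt_of_overMomenta isOpen_momentumDomain
    (hd.congr fun y hy => (dCoord_zero_squareGen hμ hy).symm) hx) ?_
  set v : Phase := (0, Pi.single 0 1) with hv
  have hb : HasDerivAt (fun t : ℝ => squareMean (eccD (x + t • v).2) (sinIncD x.2 ^ 2) (2 * x.1 1))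
      (squareMeanDeriv (eccD x.2) (sinIncD x.2 ^ 2) (2 * x.1 1) * (1 / x.2 0)) 0 := by
    have h := hasDerivAt_squareMean (sinIncD x.2 ^ 2) (2 * x.1 1)
      (e := fun t : ℝ => eccD (x + t • v).2) (c := 1 / x.2 0) (t := 0) (by simpa using he.ne')
      (by simpa [hv] using hasDerivAt_eccD_line hx v)
    simpa using h
  have h := (((hasDerivAt_line hH v).pow 2).mul (hasDerivAt_inv_meanMotionD_line hμ hx v)).sub
    (hb.const_mul (μ ^ 6 * R ^ 4 / 4 / x.2 1 ^ 9))
  refine (h.congr_deriv ?_).congr_of_eventuallyEq (Eventually.of_forall fun t => ?_)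
  · simp only [Pi.pow_apply, zero_smul, add_zero, Nat.reduceSub, pow_one, Nat.cast_ofNat, hv,
      Pi.single_eq_same, dMom]
    ring
  · simp [hv, sinIncD]

/-- The second-order determining function in closed form. -/
noncomputable def secondGen (μ R : ℝ) (x : Phase) : ℝ :=
  (hamTerm μ R 1 x + secular1 μ R x.2) * (meanMotionD μ x.2)⁻¹ * dMom 0 (genW1 μ R) x +
    (dCoord 1 (genW1 μ R) x - 2 * dCoord 1 (constC1 μ R) x) * dMom 1 (genW1 μ R) x -
    dMom 0 (squareGen μ R) x * (meanMotionD μ x.2)⁻¹ +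
    anomalyGen (μ ^ 4 * R ^ 4 / 4) 7 mixedTerms mixedMean x

theorem contDiffOn_inv_meanMotionD (hμ : 0 < μ) :
    ContDiffOn ℝ ∞ (fun x : Phase => (meanMotionD μ x.2)⁻¹) (overMomenta momentumDomain) := by
  simp only [meanMotionD, inv_div]
  have := hμ.ne'
  fun_prop (disch := positivity)

theorem contDiffOn_secondGen (hμ : 0 < μ) :
    ContDiffOn ℝ ∞ (secondGen μ R) (overMomenta momentumDomain) := by
  have hM := isOpen_momentumDomain
  have hW := contDiffOn_genW1 (R := R) hμ
  have hn := contDiffOn_inv_meanMotionD hμ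
  exact ((((((contDiffOn_hamTerm_one hμ).add (contDiffOn_secular1 hμ)).mul hn).mul
    (hW.dMom hM 0)).add (((hW.dCoord hM 1).sub
      (contDiffOn_const.mul ((contDiffOn_constC1 hμ).dCoord hM 1))).mul (hW.dMom hM 1))).sub
    (((contDiffOn_anomalyGen_square _ _).dMom hM 0).mul hn)).add (contDiffOn_anomalyGen_mixed _ _)

theorem secondGen_periodic (hμ : 0 < μ) :
    IsAnglePeriodicOn (secondGen μ R) (overMomenta momentumDomain) := by
  intro x hx k
  have hM := isOpen_momentumDomain
  have hA : IsAnglePeriodicOn (squareGen μ R) (overMomenta momentumDomain) :=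
    anomalyGen_periodic squareMean_periodic
  simp only [secondGen, dCoord, dMom, hamTerm_one_periodic hμ x hx k, shiftAngles_snd,
    fderiv_anglePeriodic hM genW1_periodic x hx k, fderiv_anglePeriodic hM constC1_periodic x hx k,
    fderiv_anglePeriodic hM hA x hx k, anomalyGen_periodic mixedMean_periodic x hx k]

/-- The averages of the second-order terms add up to the second-order secular term. -/
theorem secular2_eq (hμ : 0 < μ) (hx : x ∈ overMomenta momentumDomain) :
    secular2 μ R x.2 =
      -(μ ^ 6 * R ^ 4 / 4 / x.2 1 ^ 9 *
        (squareMeanDeriv (eccD x.2) (sinIncD x.2 ^ 2) (2 * x.1 1) / x.2 0)) -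
      3 / x.2 0 * secular1 μ R x.2 ^ 2 * (meanMotionD μ x.2)⁻¹ -
      2 * dMom 1 (fun y : Phase => secular1 μ R y.2) x * dCoord 1 (constC1 μ R) x +
      meanMotionD μ x.2 * (μ ^ 4 * R ^ 4 / 4 / x.2 1 ^ 7) *
        mixedMean (eccD x.2) (sinIncD x.2 ^ 2) (2 * x.1 1) := by
  have h0 : 0 < x.2 1 := hx.1
  have h1 : 0 < x.2 0 := hx.1.trans hx.2.1
  have hc := hx.2.2.2
  rw [dMom, fderiv_secular1_mom hμ hx (by simp), dCoord, fderiv_constC1_coord hμ hx,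
    secular1_eq hμ h0 hx.2.1, secular2, secular0, paramD_eq hμ h1, smaD, etaD, meanMotionD,
    show sinIncD x.2 ^ 4 = (sinIncD x.2 ^ 2) ^ 2 by ring]
  simp only [squareMeanDeriv, mixedMean, eccD_sq h0 hx.2.1, Pi.single_eq_same, Pi.single_apply,
    Fin.reduceEq, if_false]
  -- With e² = 1 - G²/L² inserted, the cos 4g terms of the two means cancel, and the cos 2g terms
  -- are cancelled by C₁. Clearing its divisor uses `hc`.
  generalize sinIncD x.2 ^ 2 = b at *
  field_simp
  ring

/-- The homological equation of the second order. -/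
theorem dCoord_zero_secondGen (hμ : 0 < μ) (hx : x ∈ overMomenta momentumDomain) :
    meanMotionD μ x.2 * dCoord 0 (secondGen μ R) x =
      poisson (hamTerm μ R 1) (genW1 μ R) x +
        poisson (fun y : Phase => secular1 μ R y.2) (genW1 μ R) x - secular2 μ R x.2 := by
  have hM := isOpen_momentumDomain
  have h1 : 0 < x.2 0 := hx.1.trans hx.2.1
  have hn := meanMotionD_pos hμ hx
  have hW := contDiffOn_genW1 (R := R) hμ
  have hC := contDiffOn_constC1 (R := R) hμ
  have hS := contDiffOn_secular1 (R := R) hμ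
  set v : Phase := (Pi.single 0 1, 0) with hv
  have line : ∀ {F : Phase → ℝ}, ContDiffOn ℝ ∞ F (overMomenta momentumDomain) →
      HasDerivAt (fun t : ℝ => F (x + t • v)) (dCoord 0 F x) 0 := fun hF =>
    hasDerivAt_line (differentiableAt_of_overMomenta hM hF hx) v
  -- C₁ is free of ℓ, and so is its g-derivative.
  have hmixC : dCoord 0 (dCoord 1 (constC1 μ R)) x = 0 := by
    have hz : ∀ y ∈ overMomenta momentumDomain, dCoord 0 (constC1 μ R) y = (fun _ => (0 : ℝ)) y :=
      fun y hy => dCoord_zero_constC1 hμ hy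
    have hcd := fderiv_fderiv_comm hM hC hx (Pi.single 1 1, 0) (Pi.single 0 1, 0)
    refine hcd.trans ?_
    change fderiv ℝ (dCoord 0 (constC1 μ R)) x _ = _
    rw [fderiv_congr_overMomenta hM hz hx]
    simp
  -- Product rule for `secondGen` along ℓ. The mixed derivatives of W₁ it produces are then replaced
  -- by derivatives of H, S and 1/n.
  have hder := fderiv_apply_eq_of_hasDerivAt_line
    (differentiableAt_of_overMomenta hM (contDiffOn_secondGen (R := R) hμ) hx)
    ((((((line (contDiffOn_hamTerm_one (R := R) hμ)).add (line hS)).mul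
      (hasDerivAt_inv_meanMotionD_line hμ hx v)).mul (line (hW.dMom hM 0))).add
      (((line (hW.dCoord hM 1)).sub ((line (hC.dCoord hM 1)).const_mul 2)).mul
        (line (hW.dMom hM 1)))).sub
      ((line ((contDiffOn_anomalyGen_square (μ ^ 6 * R ^ 4 / 4) 9).dMom hM 0)).mul
        (hasDerivAt_inv_meanMotionD_line hμ hx v)) |>.add
      (line (contDiffOn_anomalyGen_mixed (μ ^ 4 * R ^ 4 / 4) 7)))
  have hWL : dCoord 0 (dMom 0 (genW1 μ R)) x = _ :=
    dCoord_zero_fderiv_genW1 hμ hx (0, Pi.single 0 1)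
  have hWG : dCoord 0 (dMom 1 (genW1 μ R)) x = _ :=
    dCoord_zero_fderiv_genW1 hμ hx (0, Pi.single 1 1)
  have hWg : dCoord 0 (dCoord 1 (genW1 μ R)) x = _ :=
    dCoord_zero_fderiv_genW1 hμ hx (Pi.single 1 1, 0)
  have hA : dCoord 0 (dMom 0 (anomalyGen (μ ^ 6 * R ^ 4 / 4) 9 squareTerms squareMean)) x = _ :=
    dCoord_zero_dMom_zero_squareGen hμ hx
  rw [hWL, hWG, hWg, hA, hmixC, dCoord_zero_anomalyGen (contDiffOn_anomalyGen_mixed _ _) hx,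
    dCoord_secular _ hS hx] at hder
  have hg : dCoord 1 (genW1 μ R) x =
      dCoord 1 (shortPeriodGen μ R) x + dCoord 1 (constC1 μ R) x :=
    dCoord_apply_of_eq_add (fun y hy => genW1_eq hμ hy) contDiffOn_shortPeriodGen hC hx 1
  have hSL : dMom 0 (fun y : Phase => secular1 μ R y.2) x = -3 / x.2 0 * secular1 μ R x.2 := by
    rw [dMom, fderiv_secular1_mom hμ hx (by simp)]
    simp
  have hSg := dCoord_secular _ hS hx 1
  have hmul := dMom_one_hamTerm_mul (R := R) hμ hx
  have hS2 := secular2_eq (R := R) hμ hx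
  have e1 : fderiv ℝ (hamTerm μ R 1) x (0, Pi.single 0 1) = dMom 0 (hamTerm μ R 1) x := rfl
  have e2 : fderiv ℝ (hamTerm μ R 1) x (0, Pi.single 1 1) = dMom 1 (hamTerm μ R 1) x := rfl
  have e3 : fderiv ℝ (hamTerm μ R 1) x (Pi.single 1 1, 0) = dCoord 1 (hamTerm μ R 1) x := rfl
  have e4 : fderiv ℝ (fun y : Phase => secular1 μ R y.2) x (0, Pi.single 0 1) =
    dMom 0 (fun y : Phase => secular1 μ R y.2) x := rfl
  have e5 : fderiv ℝ (fun y : Phase => secular1 μ R y.2) x (0, Pi.single 1 1) =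
    dMom 1 (fun y : Phase => secular1 μ R y.2) x := rfl
  have e6 : fderiv ℝ (fun y : Phase => secular1 μ R y.2) x (Pi.single 1 1, 0) =
    dCoord 1 (fun y : Phase => secular1 μ R y.2) x := rfl
  have e7 : fderiv ℝ (secondGen μ R) x v = dCoord 0 (secondGen μ R) x := rfl
  rw [e1, e2, e3, e4, e5, e6, e7, hSL, hSg] at hder
  simp only [Pi.single_apply, Fin.reduceEq, if_false, if_true, zero_smul, add_zero, mul_zero,
    zero_mul, sub_zero, mul_one, Pi.zero_apply, hv, Pi.mul_apply, Pi.add_apply, Pi.sub_apply]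
    at hder
  rw [hder, hS2]
  simp only [poisson, Fin.sum_univ_three, dCoord_zero_genW1 hμ hx, dCoord_two_hamTerm_one hμ hx,
    dCoord_two_genW1 hμ hx, dCoord_secular _ hS hx, hSL, hg]
  generalize cosSum (mixedTerms (eccD x.2) (sinIncD x.2 ^ 2)) (trueAnomalyD x) (2 * x.1 1) = P at *
  generalize mixedMean (eccD x.2) (sinIncD x.2 ^ 2) (2 * x.1 1) = m at *
  generalize squareMeanDeriv (eccD x.2) (sinIncD x.2 ^ 2) (2 * x.1 1) = m' at *
  generalize (1 + eccD x.2 * Real.cos (trueAnomalyD x)) ^ 2 * (x.2 0 / x.2 1) ^ 3 = w at *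
  generalize meanMotionD μ x.2 = n at *
  generalize μ ^ 4 * R ^ 4 / 4 / x.2 1 ^ 7 = K at *
  generalize μ ^ 6 * R ^ 4 / 4 / x.2 1 ^ 9 = K' at *
  have hn' := hn.ne'
  clear hder hS2 hWL hWG hWg hA hg hSL hSg hmixC line
  field_simp
  -- Integration by parts makes everything cancel formally except the product of H_G and the
  -- g-derivative of the short-period part, which `hmul` evaluates; n L comes from cleared
  -- denominators.
  linear_combination -(n * x.2 0) * hmul

end SecondOrder

/-! ### Averages, the Lie triangle and the final assembly -/

section MainTheorem

open Set Filter Topology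

variable {μ R : ℝ} {x : Phase}

/-- If `F - S` is `n` times the derivative of a periodic function with respect to the mean
anomaly, and `S` depends on the momenta only, then the average of `F` is `S`. -/
theorem avgMean_eq_of_homological {F G : Phase → ℝ} {S : (Fin 3 → ℝ) → ℝ}
    (hG : ContDiffOn ℝ ∞ G (overMomenta momentumDomain))
    (pG : IsAnglePeriodicOn G (overMomenta momentumDomain))
    (h : ∀ y ∈ overMomenta momentumDomain,
      F y = meanMotionD μ y.2 * dCoord 0 G y + S y.2)
    (hx : x ∈ overMomenta momentumDomain) : avgMean F x = S x.2 := by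
  have hM := isOpen_momentumDomain
  set y : ℝ → Phase := fun t => (Function.update x.1 0 t, x.2) with hy
  have hyD : ∀ t, y t ∈ overMomenta momentumDomain := fun t => hx
  have hyd : ∀ t, HasDerivAt y (Pi.single 0 1, 0) t := fun t =>
    (hasDerivAt_update x.1 0 t).prodMk (hasDerivAt_const t x.2)
  have hyc : Continuous y := continuous_iff_continuousAt.2 fun t => (hyd t).continuousAt
  have hd : ∀ t ∈ uIcc 0 (2 * Real.pi),
      HasDerivAt (fun t => meanMotionD μ x.2 * G (y t)) (meanMotionD μ x.2 * dCoord 0 G (y t)) t :=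
    fun t _ => ((differentiableAt_of_overMomenta hM hG (hyD t)).hasFDerivAt.comp_hasDerivAt t
      (hyd t)).const_mul _
  have hc : Continuous fun t => meanMotionD μ x.2 * dCoord 0 G (y t) :=
    continuous_const.mul ((hG.dCoord hM 0).continuousOn.comp_continuous hyc hyD)
  have hI := intervalIntegral.integral_eq_sub_of_hasDerivAt hd (hc.intervalIntegrable _ _)
  -- The endpoints of the loop differ by one full turn of ℓ, so the integral of the derivative
  -- vanishes.
  have hper : G (y (2 * Real.pi)) = G (y 0) := by
    rw [← pG (y 0) (hyD 0) (Pi.single 0 1)]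
    congr 1
    refine Prod.ext (funext fun i => ?_) rfl
    fin_cases i <;> simp [hy, shiftAngles]
  have hF : ∀ t, F (y t) = meanMotionD μ x.2 * dCoord 0 G (y t) + S x.2 := fun t => h _ (hyD t)
  simp only [avgMean]
  rw [intervalIntegral.integral_congr (fun t _ => hF t),
    intervalIntegral.integral_add (hc.intervalIntegrable _ _) intervalIntegrable_const, hI, hper,
    sub_self, intervalIntegral.integral_const]
  have := Real.pi_ne_zero
  simp
  field_simp

theorem newH01_eq (hμ : 0 < μ) (hx : x ∈ overMomenta momentumDomain) :
    newH01 μ R x = secular1 μ R x.2 :=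
  avgMean_eq_of_homological (contDiffOn_genW1 hμ) genW1_periodic (fun y hy => by
    have := (meanMotionD_pos hμ hy).ne'
    rw [dCoord_zero_genW1 hμ hy]
    field_simp
    ring) hx

theorem knownTerms2_eq (hμ : 0 < μ) (hx : x ∈ overMomenta momentumDomain) :
    knownTerms2 μ R x = poisson (hamTerm μ R 1) (genW1 μ R) x +
      poisson (fun y : Phase => secular1 μ R y.2) (genW1 μ R) x := by
  rw [knownTerms2, poisson_congr isOpen_momentumDomain (fun y hy => newH01_eq hμ hy)
    (fun _ _ => rfl) hx]

theorem newH02_eq (hμ : 0 < μ) (hx : x ∈ overMomenta momentumDomain) :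
    newH02 μ R x = secular2 μ R x.2 :=
  avgMean_eq_of_homological (contDiffOn_secondGen hμ) (secondGen_periodic hμ) (fun y hy => by
    rw [dCoord_zero_secondGen hμ hy, knownTerms2_eq hμ hy]
    ring) hx

theorem isSecondGenerator_secondGen (hμ : 0 < μ) : IsSecondGenerator μ R (secondGen μ R) where
  contDiffOn := contDiffOn_secondGen hμ
  periodic := secondGen_periodic hμ
  homological x hx := by
    rw [dCoord_zero_secondGen hμ hx, knownTerms2_eq hμ hx, newH02_eq hμ hx]

/-- The secular terms up to the second order make up Brouwer's Hamiltonian. -/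
theorem secular_eq_brouwerSecular (hμ : 0 < μ) {p : Fin 3 → ℝ} (hp : p ∈ momentumDomain)
    (J₂ : ℝ) :
    secular0 μ p + J₂ * secular1 μ R p + J₂ ^ 2 / 2 * secular2 μ R p =
      -brouwerSecular μ (J₂ * R ^ 2 / 2) (p 0) (p 1) (p 2) := by
  have h0 : 0 < p 1 := hp.1
  have h1 : 0 < p 0 := hp.1.trans hp.2.1
  simp only [secular1, secular2, secular0, brouwerSecular, paramD_eq hμ h1, smaD, etaD,
    show sinIncD p ^ 4 = (sinIncD p ^ 2) ^ 2 by ring, sinIncD_sq hp.2.2.1]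
  field_simp
  ring

theorem hamTerm_one_add_poisson (hμ : 0 < μ) (hx : x ∈ overMomenta momentumDomain) :
    hamTerm μ R 1 x + poisson (hamTerm μ R 0) (genW1 μ R) x = secular1 μ R x.2 := by
  have := (meanMotionD_pos hμ hx).ne'
  rw [poisson_hamTerm_zero hμ hx, dCoord_zero_genW1 hμ hx]
  field_simp
  ring

theorem IsSecondGenerator.poisson_eq {W₂ : Phase → ℝ} (hW : IsSecondGenerator μ R W₂) (hμ : 0 < μ)
    (hx : x ∈ overMomenta momentumDomain) :
    poisson (hamTerm μ R 0) W₂ x + poisson (hamTerm μ R 1) (genW1 μ R) x +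
      poisson (fun y : Phase => secular1 μ R y.2) (genW1 μ R) x = secular2 μ R x.2 := by
  rw [poisson_hamTerm_zero hμ hx, hW.homological x hx, knownTerms2_eq hμ hx, newH02_eq hμ hx]
  ring

theorem lieTriangle_one_zero (W₂ : Phase → ℝ) (hμ : 0 < μ) (hx : x ∈ overMomenta momentumDomain) :
    lieTriangle (hamTerm μ R) (genTerm (genW1 μ R) W₂) 1 0 x = secular1 μ R x.2 := by
  rw [← hamTerm_one_add_poisson hμ hx]
  simp [lieTriangle, genTerm]

theorem IsSecondGenerator.lieTriangle_two_zero {W₂ : Phase → ℝ} (hW : IsSecondGenerator μ R W₂)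
    (hμ : 0 < μ) (hx : x ∈ overMomenta momentumDomain) :
    lieTriangle (hamTerm μ R) (genTerm (genW1 μ R) W₂) 2 0 x = secular2 μ R x.2 := by
  -- The entry H_{0,1} of the triangle is known only over the open domain, which is enough to
  -- replace it inside a bracket.
  have h := poisson_congr isOpen_momentumDomain
    (fun y hy => lieTriangle_one_zero (R := R) W₂ hμ hy) (K := genW1 μ R) (fun _ _ => rfl) hx
  have e : lieTriangle (hamTerm μ R) (genTerm (genW1 μ R) W₂) 2 0 x =
      lieTriangle (hamTerm μ R) (genTerm (genW1 μ R) W₂) 1 1 x +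
        poisson (lieTriangle (hamTerm μ R) (genTerm (genW1 μ R) W₂) 1 0) (genW1 μ R) x := by
    rw [lieTriangle]
    simp [genTerm]
  rw [e, h, ← hW.poisson_eq hμ hx]
  simp [lieTriangle, genTerm, Finset.sum_range_succ, hamTerm]
  ring

theorem mainHamiltonian_eq (ε : ℝ) :
    mainHamiltonian μ R ε x = hamTerm μ R 0 x + ε * hamTerm μ R 1 x := by
  simp only [mainHamiltonian, hamTerm]
  ring

end MainTheorem

theorem mainTheorem1 (μ R : ℝ) (hμ : 0 < μ) (hR : 0 < R) :
    -- the completed first-order determining function is smooth and periodic in the angles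
    (ContDiffOn ℝ ∞ (genW1 μ R) (overMomenta momentumDomain) ∧
      IsAnglePeriodicOn (genW1 μ R) (overMomenta momentumDomain)) ∧
    -- the new Hamiltonian terms are functions of the momenta only, of the stated form
    (∀ x ∈ overMomenta momentumDomain,
      newH01 μ R x = secular1 μ R x.2 ∧ newH02 μ R x = secular2 μ R x.2) ∧
    -- they make up Brouwer's second-order secular Hamiltonian
    (∀ p ∈ momentumDomain, ∀ J₂ : ℝ,
      secular0 μ p + J₂ * secular1 μ R p + J₂ ^ 2 / 2 * secular2 μ R p =
        -brouwerSecular μ (J₂ * R ^ 2 / 2) (p 0) (p 1) (p 2)) ∧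
    -- the determining function can be continued to the second order, and then, however
    -- this is done,
    (∃ W₂, IsSecondGenerator μ R W₂) ∧
    ∀ W₂, IsSecondGenerator μ R W₂ →
      -- the Lie transform method produces these new Hamiltonian terms, and
      (∀ x ∈ overMomenta momentumDomain,
        lieTriangle (hamTerm μ R) (genTerm (genW1 μ R) W₂) 1 0 x = secular1 μ R x.2 ∧
        lieTriangle (hamTerm μ R) (genTerm (genW1 μ R) W₂) 2 0 x = secular2 μ R x.2) ∧
      -- the single transformation generated by `W₁ + ε W₂` is canonical, and it reduces the
      -- Hamiltonian to its secular part up to terms of the third order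
      ∀ P : Set (Fin 3 → ℝ), IsCompact P → P ⊆ momentumDomain →
        ∃ (V : Set (Fin 3 → ℝ)) (ε₀ C : ℝ) (T : ℝ → Phase → Phase),
          IsOpen V ∧ P ⊆ V ∧ V ⊆ momentumDomain ∧ 0 < ε₀ ∧
          IsLieTransform (fun ε x => genW1 μ R x + ε * W₂ x)
            (overMomenta momentumDomain) (overMomenta V) ε₀ T ∧
          ∀ ε : ℝ, |ε| < ε₀ →
            IsCanonicalOn (T ε) (overMomenta V) ∧
            ∀ x ∈ overMomenta V,
              (∀ k : Fin 3 → ℤ, T ε (shiftAngles k x) = shiftAngles k (T ε x)) ∧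
              |mainHamiltonian μ R ε (T ε x) -
                (secular0 μ x.2 + ε * secular1 μ R x.2 + ε ^ 2 / 2 * secular2 μ R x.2)| ≤
                C * |ε| ^ 3 := by
  refine ⟨⟨contDiffOn_genW1 hμ, genW1_periodic⟩, fun x hx => ⟨newH01_eq hμ hx, newH02_eq hμ hx⟩,
    fun p hp J₂ => secular_eq_brouwerSecular hμ hp J₂, ⟨_, isSecondGenerator_secondGen hμ⟩,
    fun W₂ hW => ⟨fun x hx => ⟨lieTriangle_one_zero W₂ hμ hx, hW.lieTriangle_two_zero hμ hx⟩,
      fun P hP hPM => ?_⟩⟩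
  obtain ⟨V, K, ε₀, T, hV, hPV, hVM, hK, hKM, hε₀, hε₁, hT, hTε⟩ := exists_lieTransform
    isOpen_momentumDomain (contDiffOn_genW1 (R := R) hμ) hW.contDiffOn genW1_periodic hW.periodic
    hP hPM
  -- The constant is uniform because all transformed points stay over the compact set K of momenta;
  -- the secular terms are trivially periodic.
  obtain ⟨C, hC⟩ := exists_lieTransform_remainder_bound isOpen_momentumDomain hK hKM
    (contDiffOn_hamTerm_zero hμ) (contDiffOn_hamTerm_one hμ) (contDiffOn_secular1 hμ)
    (contDiffOn_secular2 hμ) (contDiffOn_genW1 (R := R) hμ) hW.contDiffOn (hamTerm_one_periodic hμ)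
    (fun _ _ _ => rfl) (fun _ _ _ => rfl) genW1_periodic hW.periodic
    (fun x hx => hamTerm_one_add_poisson hμ hx) (fun x hx => hW.poisson_eq hμ hx) hε₁ hT
    (fun ε hε x hx => ((hTε ε hε).2 x hx).1)
  refine ⟨V, ε₀, C, T, hV, hPV, hVM, hε₀, hT, fun ε hε => ⟨(hTε ε hε).1, fun x hx =>
    ⟨((hTε ε hε).2 x hx).2, ?_⟩⟩⟩
  rw [mainHamiltonian_eq]
  exact hC ε hε x hx
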